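/- Consider the infinite chain $\mathbb Z$ with local space $\mathbb C^d$ ($1\le d<\infty$) at each site; let $\mathcal B$ be the operators on $\mathbb C^d$ and $\mathcal B_0\subset\mathcal B$ the traceless ones. A formal operator is a family $\Phi=\sum_A\Phi(A)$, $\Phi(A)\in\mathcal B_0^{\otimes A}$, indexed by the finite sets $A\subset\mathbb Z$ (with $\mathcal B_0^{\otimes\emptyset}=\mathbb C$). Its range is the supremum of $\max A-\min A+1$ over the nonempty $A$ with $\Phi(A)\ne0$ (and $0$ if there are none); $\Phi$ is local if its range is finite, $k$-local if its range is $k$, and at most $k$-local if its range is at most $k$. For local $\Phi$ and arbitrary $\Psi$ put $[\Phi,\Psi](A)=\bigl[\Phi|_B,\Psi|_B\bigr]_A$ for any sufficiently large finite $B\supset A$, where $\Phi|_B=\sum_{A'\subset B}\Phi(A')$ and $Y_A$ is the component of $Y$ in $\mathcal B^{\otimes B}=\bigoplus_{A\subset B}\mathcal B_0^{\otimes A}$. A conserved quantity of $H$ is a $\Psi$ with $[H,\Psi]=0$. Let $H=\sum_{i}h^{(2)}_i+\sum_i h^{(1)}_i$ be Hermitian and translation invariant, with $h^{(2)}_i\in\mathcal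 B_{0}\otimes\mathcal B_{0}$ on the sites $i,i+1$ and $h^{(1)}_i\in\mathcal B_{0}$ on the site $i$. Assume: (i) for every $a\in\mathcal B_0$, $[I\otimes a,h^{(2)}_1]=0$ implies $a=0$, and $[a\otimes I,h^{(2)}_1]=0$ implies $a=0$; (ii) for every family $(a_i)_{i\in\mathbb Z}$ of operators $a_i\in\mathcal B_{0}\otimes\mathcal B_{0}$ on the sites $i,i+1$: if $[h^{(2)}_i,a_{i+1}]=[a_i,h^{(2)}_{i+1}]$ for all $i$, then there is $\alpha\in\mathbb C$ with $a_i=\alpha h^{(2)}_i$ for all $i$. Let $C$ be a translation-invariant, at most one-local operator, $B_H=\sum_j j\,(h^{(2)}_j+h^{(1)}_j)+C$ and $Q^{(3)}=[B_H,H]$. Assume moreover: (A) if there is an at most two-local operator $R^{(2)}$ such that $[H,Q^{(3)}+R^{(2)}]$ is at most two-local, then $[H,Q^{(3)}]=0$. Then exactly one of the following holds. (1) $H$ is integrable: there are operators $Q_k$ ($k\ge2$), each $Q_k$ being a $k$-local conserved quantity of $H$, such that $[Q_k,Q_l]=0$ for all $k,l\ge2$. (2) $H$ is nonintegrable: every local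 conserved quantity of $H$ (translation invariant or not) is of the form $\alpha H+R$ with $\alpha\in\mathbb C$ and $R$ at most one-local. -/

import Mathlib

namespace SpinChain

/-- Operators on the sites of a finite set `A` of the chain `ℤ`, each site carrying `ℂ^d`:
matrices indexed by the basis configurations `A → Fin d`. -/
abbrev LocOp (d : ℕ) (A : Finset ℤ) : Type := Matrix (A → Fin d) (A → Fin d) ℂ

/-- Membership in `𝓑₀^{⊗A}`: the partial trace over every site of `A` vanishes.
For `A = ∅` this holds for every (scalar) operator. -/
def IsTraceless {d : ℕ} {A : Finset ℤ} (X : LocOp d A) : Prop :=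
  ∀ (a : A) (s t : A → Fin d),
    ∑ k : Fin d, X (Function.update s a k) (Function.update t a k) = 0

/-- The natural embedding `X ↦ X ⊗ I` of operators on `A` into operators on `B ⊇ A`. -/
def embed {d : ℕ} {A B : Finset ℤ} (h : A ⊆ B) (X : LocOp d A) : LocOp d B :=
  fun s t =>
    if ∀ i : B, i.1 ∉ A → s i = t i then
      X (fun a => s ⟨a.1, h a.2⟩) (fun a => t ⟨a.1, h a.2⟩)
    else 0

/-- The configuration on `B` that is `s` at the sites of `C ∩ A` and `u` elsewhere. -/
def glue {d : ℕ} {A B : Finset ℤ} (C : Finset ℤ) (s : A → Fin d) (u : B → Fin d) :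
    B → Fin d :=
  fun b => if h : b.1 ∈ C ∧ b.1 ∈ A then s ⟨b.1, h.2⟩ else u b

/-- For `C ⊆ A ⊆ B` and `Y` an operator on `B`: the normalized partial trace of `Y` over `B \ C`,
tensored with the identity so as to be an operator on `A`.  Averaging over the configurations `u`
of all of `B` is the normalized trace over `B \ C`, as `glue` discards `u` on `C`. -/
noncomputable def reduce {d : ℕ} {B : Finset ℤ} (A C : Finset ℤ) (Y : LocOp d B) : LocOp d A :=
  fun s t =>
    if ∀ i : A, i.1 ∉ C → s i = t i then
      ((d : ℂ) ^ B.card)⁻¹ * ∑ u : B → Fin d, Y (glue C s u) (glue C t u)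
    else 0

/-- For `A ⊆ B`, the component `Y_A ∈ 𝓑₀^{⊗A}` of an operator `Y` on `B` in the decomposition
`𝓑^{⊗B} = ⨁_{A ⊆ B} 𝓑₀^{⊗A}`, obtained from the partial traces by inclusion-exclusion. -/
noncomputable def component {d : ℕ} {B : Finset ℤ} (A : Finset ℤ) (Y : LocOp d B) : LocOp d A :=
  ∑ C ∈ A.powerset, (-1 : ℂ) ^ (A \ C).card • reduce A C Y

/-- Formal operators `Φ = ∑_A Φ(A)` on the infinite chain: families `A ↦ Φ(A) ∈ 𝓑₀^{⊗A}`
indexed by the finite subsets `A` of `ℤ`. -/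
def formalOps (d : ℕ) : Submodule ℂ ((A : Finset ℤ) → LocOp d A) where
  carrier := {Φ | ∀ A, IsTraceless (Φ A)}
  add_mem' := by
    intro Φ Ψ hΦ hΨ A a s t
    simp [Finset.sum_add_distrib, hΦ A a s t, hΨ A a s t]
  zero_mem' := by
    intro A a s t
    simp
  smul_mem' := by
    intro c Φ hΦ A a s t
    simp [← Finset.mul_sum, hΦ A a s t]

abbrev FormalOp (d : ℕ) : Type := formalOps d

/-- The range `max A - min A + 1` of a finite set of sites, with value `0` for `∅`. -/
noncomputable def setRange (A : Finset ℤ) : ℕ :=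
  if h : A.Nonempty then (A.max' h - A.min' h + 1).toNat else 0

/-- The range of a formal operator. `Φ` is local if it is finite, `n`-local if it is equal to `n`,
and at most `n`-local if it is at most `n`. -/
noncomputable def opRange {d : ℕ} (Φ : FormalOp d) : ℕ∞ :=
  ⨆ (A : Finset ℤ) (_ : Φ.1 A ≠ 0), (setRange A : ℕ∞)

/-- The restriction `Φ|_B = ∑_{A ⊆ B} Φ(A)`, an operator on `B`. -/
noncomputable def restrict {d : ℕ} (Φ : FormalOp d) (B : Finset ℤ) : LocOp d B :=
  ∑ A ∈ B.powerset.attach, embed (Finset.mem_powerset.1 A.2) (Φ.1 A.1)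

/-- The sites at distance at most `n` from `A`. -/
noncomputable def nbhd (A : Finset ℤ) (n : ℕ) : Finset ℤ :=
  A.biUnion fun a => Finset.Icc (a - n) (a + n)

theorem subset_nbhd (A : Finset ℤ) (n : ℕ) : A ⊆ nbhd A n := by
  intro a ha
  simp only [nbhd, Finset.mem_biUnion, Finset.mem_Icc]
  exact ⟨a, ha, by omega, by omega⟩

theorem sum_sum_update {d : ℕ} {B : Finset ℤ} (b : B) (f : (B → Fin d) → ℂ) :
    ∑ k : Fin d, ∑ u : B → Fin d, f (Function.update u b k) = d * ∑ u, f u := by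
  have hinv : Function.Involutive
      (fun p : Fin d × (B → Fin d) => (p.2 b, Function.update p.2 b p.1)) := by
    rintro ⟨k, u⟩
    simp
  have h := Equiv.sum_comp hinv.toPerm (fun p : Fin d × (B → Fin d) => f p.2)
  simp only [Function.Involutive.coe_toPerm, Fintype.sum_prod_type] at h
  rw [h]
  simp

theorem component_isTraceless {d : ℕ} {A B : Finset ℤ} (hAB : A ⊆ B) (Y : LocOp d B) :
    IsTraceless (component A Y) := by
  classical
  intro a s t
  obtain ⟨A', haA', hA⟩ : ∃ A', a.1 ∉ A' ∧ A = insert a.1 A' :=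
    ⟨A.erase a.1, by simp, (Finset.insert_erase a.2).symm⟩
  have key : ∀ C ∈ A'.powerset,
      ∑ k : Fin d, reduce A (insert a.1 C) Y (Function.update s a k) (Function.update t a k)
        = ∑ k : Fin d, reduce A C Y (Function.update s a k) (Function.update t a k) := by
    intro C hC
    have haC : a.1 ∉ C := fun h => haA' (Finset.mem_powerset.1 hC h)
    have hglue : ∀ (w : A → Fin d) (k : Fin d) (u : B → Fin d),
        glue (insert a.1 C) (Function.update w a k) u
          = glue C w (Function.update u ⟨a.1, hAB a.2⟩ k) := by
      intro w k u
      funext b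
      by_cases hb : b.1 = a.1
      · have hb' : b = ⟨a.1, hAB a.2⟩ := Subtype.ext hb
        subst hb'
        simp [glue, haC]
      · have hb' : b ≠ ⟨a.1, hAB a.2⟩ := fun h => hb (congrArg Subtype.val h)
        simp only [glue, Finset.mem_insert, hb, false_or, Function.update_of_ne hb']
        split_ifs with h
        · rw [Function.update_of_ne]
          exact fun h' => hb (congrArg Subtype.val h')
        · rfl
    have hglue' : ∀ (w : A → Fin d) (k : Fin d) (u : B → Fin d),
        glue C (Function.update w a k) u = glue C w u := by
      intro w k u
      funext b
      simp only [glue]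
      split_ifs with h
      · rw [Function.update_of_ne]
        exact fun h' => haC (congrArg Subtype.val h' ▸ h.1)
      · rfl
    have hcond : ∀ k : Fin d,
        (∀ i : A, i.1 ∉ insert a.1 C → Function.update s a k i = Function.update t a k i) ↔
          (∀ i : A, i.1 ∉ C → s i = t i ∨ i = a) := by
      intro k
      refine forall_congr' fun i => ?_
      by_cases hi : i = a
      · subst hi; simp
      · have : i.1 ≠ a.1 := fun h => hi (Subtype.ext h)
        simp [hi, this]
    have hcond' : ∀ k : Fin d,
        (∀ i : A, i.1 ∉ C → Function.update s a k i = Function.update t a k i) ↔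
          (∀ i : A, i.1 ∉ C → s i = t i ∨ i = a) := by
      intro k
      refine forall_congr' fun i => ?_
      by_cases hi : i = a
      · subst hi; simp
      · simp [hi]
    simp only [reduce, hcond, hcond', hglue, hglue']
    split_ifs
    · rw [← Finset.mul_sum,
        sum_sum_update ⟨a.1, hAB a.2⟩ (fun u => Y (glue C s u) (glue C t u))]
      simp
      ring
    · rfl
  have hsum : component A Y
      = ∑ C ∈ A'.powerset, (-1 : ℂ) ^ (A' \ C).card • (reduce A (insert a.1 C) Y
          - reduce A C Y) := by
    unfold component
    conv_lhs => rw [show A.powerset = (insert a.1 A').powerset by rw [← hA]]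
    rw [Finset.sum_powerset_insert haA', ← Finset.sum_add_distrib]
    refine Finset.sum_congr rfl fun C hC => ?_
    have haC : a.1 ∉ C := fun h => haA' (Finset.mem_powerset.1 hC h)
    have h1 : (A \ C).card = (A' \ C).card + 1 := by
      rw [hA, Finset.insert_sdiff_of_notMem _ haC, Finset.card_insert_of_notMem]
      simp [haA']
    have h2 : A \ insert a.1 C = A' \ C := by
      ext x
      have hx : x ∈ A ↔ x = a.1 ∨ x ∈ A' := by rw [← Finset.mem_insert, ← hA]
      simp only [Finset.mem_sdiff, Finset.mem_insert, hx]
      constructor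
      · rintro ⟨h | h, h'⟩ <;> simp_all
      · rintro ⟨h, h'⟩
        refine ⟨Or.inr h, ?_⟩
        rintro (h'' | h'')
        · exact haA' (h'' ▸ h)
        · exact h' h''
    rw [h1, h2, pow_succ, smul_sub]
    simp only [mul_neg, mul_one, neg_smul]
    abel
  rw [hsum]
  simp only [Matrix.sum_apply, Matrix.smul_apply, Matrix.sub_apply, smul_eq_mul]
  rw [Finset.sum_comm]
  refine Finset.sum_eq_zero fun C hC => ?_
  rw [← Finset.mul_sum, Finset.sum_sub_distrib, key C hC, sub_self, mul_zero]

/-- The commutator `[Φ, Ψ]` of formal operators, `Φ` being local: its value at `A` is the component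
`[Φ|_B, Ψ|_B]_A` for any sufficiently large finite `B ⊇ A`.  A term `[Φ(C), Ψ(C')]` has an
`A`-component only if `C` meets `A` and `C' ⊆ A ∪ C`, so the sites within distance `opRange Φ` of `A`
are enough. -/
noncomputable def comm {d : ℕ} (Φ Ψ : FormalOp d) : FormalOp d :=
  ⟨fun A =>
    component A ⁅restrict Φ (nbhd A (opRange Φ).toNat), restrict Ψ (nbhd A (opRange Φ).toNat)⁆,
   fun A => component_isTraceless (subset_nbhd A _) _⟩

/-- Self-adjointness: every component is Hermitian. -/
def IsSelfAdjointOp {d : ℕ} (Φ : FormalOp d) : Prop :=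
  ∀ A, (Φ.1 A).IsHermitian

/-- Translation invariance: the component at `A + x` is the translate of the component at `A`. -/
def IsTranslationInvariant {d : ℕ} (Φ : FormalOp d) : Prop :=
  ∀ (A : Finset ℤ) (x : ℤ) (s t : A.map (addRightEmbedding x) → Fin d),
    Φ.1 (A.map (addRightEmbedding x)) s t =
      Φ.1 A (fun a => s ⟨a.1 + x, Finset.mem_map_of_mem (addRightEmbedding x) a.2⟩)
        (fun a => t ⟨a.1 + x, Finset.mem_map_of_mem (addRightEmbedding x) a.2⟩)

/-- `Φ = ∑ᵢ h⁽²⁾ᵢ + ∑ᵢ h⁽¹⁾ᵢ` with `h⁽²⁾ᵢ = Φ({i,i+1})` and `h⁽¹⁾ᵢ = Φ({i})`: there are only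
nearest-neighbour interactions and on-site potentials. -/
def IsNearestNeighbour {d : ℕ} (Φ : FormalOp d) : Prop :=
  ∀ A, Φ.1 A ≠ 0 → ∃ i : ℤ, A = {i, i + 1} ∨ A = {i}

/-- The sum `∑ⱼ j (h⁽²⁾ⱼ + h⁽¹⁾ⱼ)`: the component at a nonempty `A` is multiplied by `min A`. -/
noncomputable def moment {d : ℕ} (H : FormalOp d) : FormalOp d :=
  ⟨fun A => if h : A.Nonempty then ((A.min' h : ℤ) : ℂ) • H.1 A else 0, by
    intro A
    by_cases h : A.Nonempty
    · simp only [h, dif_pos]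
      exact (formalOps d).smul_mem _ H.2 A
    · simp only [h, dif_neg, not_false_eq_true]
      exact (formalOps d).zero_mem A⟩

/-- The boost operator `∑ⱼ j (h⁽²⁾ⱼ + h⁽¹⁾ⱼ) + C`. -/
noncomputable def boost {d : ℕ} (H C : FormalOp d) : FormalOp d := moment H + C

/-- The operator `Q⁽³⁾ = [B_H, H]`. -/
noncomputable def Q3 {d : ℕ} (H C : FormalOp d) : FormalOp d := comm (boost H C) H

/-- A traceless one-site operator that commutes, when placed on the right or on the left site,
with the two-site interaction `h⁽²⁾₁` vanishes. -/
def InjectiveInteraction {d : ℕ} (H : FormalOp d) : Prop :=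
  (∀ a : LocOp d {2}, IsTraceless a →
    ⁅embed (B := {1, 2}) (by decide) a, H.1 {1, 2}⁆ = 0 → a = 0) ∧
  (∀ a : LocOp d {1}, IsTraceless a →
    ⁅embed (B := {1, 2}) (by decide) a, H.1 {1, 2}⁆ = 0 → a = 0)

/-- If `aᵢ ∈ 𝓑₀ ⊗ 𝓑₀` on the sites `i, i+1` satisfy `[h⁽²⁾ᵢ, aᵢ₊₁] = [aᵢ, h⁽²⁾ᵢ₊₁]` for all `i`,
as operators on the sites `i, i+1, i+2`, then `aᵢ = α h⁽²⁾ᵢ` for all `i`, with `α` independent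
of `i`. -/
def UniqueTwoLocalCharge {d : ℕ} (H : FormalOp d) : Prop :=
  ∀ a : (i : ℤ) → LocOp d {i, i + 1}, (∀ i, IsTraceless (a i)) →
    (∀ i : ℤ,
      ⁅embed (B := {i, i + 1, i + 1 + 1}) (by grind) (H.1 {i, i + 1}),
        embed (B := {i, i + 1, i + 1 + 1}) (by grind) (a (i + 1))⁆ =
      ⁅embed (B := {i, i + 1, i + 1 + 1}) (by grind) (a i),
        embed (B := {i, i + 1, i + 1 + 1}) (by grind) (H.1 {i + 1, i + 1 + 1})⁆) →
    ∃ α : ℂ, ∀ i, a i = α • H.1 {i, i + 1}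

/-- There are mutually commuting `k`-local conserved quantities for all `k ≥ 2`. -/
def IsIntegrable {d : ℕ} (H : FormalOp d) : Prop :=
  ∃ Q : ℕ → FormalOp d,
    (∀ k, 2 ≤ k → opRange (Q k) = k ∧ comm H (Q k) = 0) ∧
    ∀ k l, 2 ≤ k → 2 ≤ l → comm (Q k) (Q l) = 0

/-- The only local conserved quantities are the Hamiltonian, up to a scalar factor, and operators
that are at most one-local, and sums of these. -/
def IsNonintegrable {d : ℕ} (H : FormalOp d) : Prop :=
  ∀ Ψ : FormalOp d, opRange Ψ < ⊤ → comm H Ψ = 0 →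
    ∃ (α : ℂ) (R : FormalOp d), opRange R ≤ 1 ∧ Ψ = α • H + R

end SpinChain

/-!
An operator is conserved only if the parts of its commutator with `H` on every interval vanish. For
the longest intervals this forces, by the injectivity of the bonds, the leading part of a conserved
quantity to be a multiple of the nested commutators `[h₁, [h₂, …, [hₙ₋₁, hₙ]]]`. On intervals one
site shorter it yields a linear equation for the next-to-leading part. For `k ≥ 4` a solution of
that equation can be peeled off site by site, down to a solution of the equation for `k = 3` with a
nonzero multiple of the same source, which is the classical Reshetikhin condition. So if this
condition fails, no conserved quantity has range three or more.

If it holds, it provides an `R` as in (A), so `[H, Q₃] = 0`. By the Jacobi identity, `B = B_H` then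
maps a local translation-invariant charge `Q` to a `D = [B, Q]` with `[H, [H, D]] = 0`. The trace
per site of `[H, D]† [H, D]` equals that of `-[H, [H, D]†] D = [H, [H, D]]† D = 0`, whence
`[H, D] = 0`: the iterated commutators of `B` with `H` are conserved, and the Jacobi identity makes
them commute. Their ranges grow by exactly one at each step, again by the injectivity of the bonds.
-/

namespace SpinChain

section LocalAlgebra

variable {R ι κ : Type*} [CommRing R]

/-- Linear operators on functions of a configuration `ι → κ`, a common home for the operators on
all finite sets of sites. -/
abbrev Obs (R ι κ : Type*) [CommRing R] : Type _ := Module.End R ((ι → κ) → R)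

noncomputable instance : LieRing (Obs R ι κ) := LieRing.ofAssociativeRing

noncomputable instance : LieAlgebra R (Obs R ι κ) := LieAlgebra.ofAssociativeAlgebra

theorem lie_mem_subalgebra {S : Subalgebra R (Obs R ι κ)} {X Y : Obs R ι κ} (hX : X ∈ S)
    (hY : Y ∈ S) : ⁅X, Y⁆ ∈ S :=
  (lieSubalgebraOfSubalgebra R (Obs R ι κ) S).lie_mem hX hY

variable [DecidableEq ι] [DecidableEq κ]

/-- The matrix unit `|k⟩⟨l|` at the site `i`. -/
def siteUnit (i : ι) (k l : κ) : Obs R ι κ where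
  toFun f x := if x i = k then f (Function.update x i l) else 0
  map_add' f g := by ext x; by_cases h : x i = k <;> simp [h]
  map_smul' c f := by ext x; by_cases h : x i = k <;> simp [h]

theorem siteUnit_apply (i : ι) (k l : κ) (f : (ι → κ) → R) (x : ι → κ) :
    siteUnit i k l f x = if x i = k then f (Function.update x i l) else 0 := rfl

theorem siteUnit_mul_siteUnit (i : ι) (k l m n : κ) :
    (siteUnit i k l * siteUnit i m n : Obs R ι κ) = if l = m then siteUnit i k n else 0 := by
  refine LinearMap.ext fun f => funext fun x => ?_
  by_cases h : l = m <;> simp [siteUnit_apply, Module.End.mul_apply, h]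

theorem sum_siteUnit [Fintype κ] (i : ι) : ∑ k, (siteUnit i k k : Obs R ι κ) = 1 := by
  refine LinearMap.ext fun f => funext fun x => ?_
  simp [siteUnit_apply, LinearMap.sum_apply, Finset.sum_apply]

theorem commute_siteUnit {i j : ι} (h : i ≠ j) (k l m n : κ) :
    Commute (siteUnit i k l : Obs R ι κ) (siteUnit j m n) := by
  refine LinearMap.ext fun f => funext fun x => ?_
  simp only [Module.End.mul_apply, siteUnit_apply, Function.update_of_ne h.symm,
    Function.update_of_ne h, Function.update_comm h]
  split_ifs <;> rfl

/-- The operators acting trivially at the site `i`, encoded as those commuting with all matrix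
units there. -/
def trivialAt (i : ι) : Subalgebra R (Obs R ι κ) :=
  Subalgebra.centralizer R {X | ∃ k l, X = siteUnit i k l}

theorem mem_trivialAt {i : ι} {X : Obs R ι κ} :
    X ∈ trivialAt i ↔ ∀ k l, Commute (siteUnit i k l) X := by
  simp only [trivialAt, Subalgebra.mem_centralizer_iff, Set.mem_ofPred_eq, commute_iff_eq]
  grind

theorem siteUnit_mem_trivialAt {i j : ι} (h : i ≠ j) (k l : κ) :
    (siteUnit j k l : Obs R ι κ) ∈ trivialAt i :=
  mem_trivialAt.2 fun _ _ => commute_siteUnit h _ _ _ _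

/-- The algebra of operators on the sites of `S`. -/
def localAlgebra (S : Finset ι) : Subalgebra R (Obs R ι κ) :=
  Algebra.adjoin R {X | ∃ i ∈ S, ∃ k l, X = siteUnit i k l}

theorem siteUnit_mem_localAlgebra {S : Finset ι} {i : ι} (h : i ∈ S) (k l : κ) :
    (siteUnit i k l : Obs R ι κ) ∈ localAlgebra S :=
  Algebra.subset_adjoin ⟨i, h, k, l, rfl⟩

theorem localAlgebra_mono {S T : Finset ι} (h : S ⊆ T) :
    (localAlgebra S : Subalgebra R (Obs R ι κ)) ≤ localAlgebra T :=
  Algebra.adjoin_mono fun _ ⟨i, hi, k, l, hx⟩ => ⟨i, h hi, k, l, hx⟩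

theorem localAlgebra_le_trivialAt {S : Finset ι} {i : ι} (hi : i ∉ S) :
    (localAlgebra S : Subalgebra R (Obs R ι κ)) ≤ trivialAt i := by
  refine Algebra.adjoin_le ?_
  rintro _ ⟨j, hj, k, l, rfl⟩
  exact siteUnit_mem_trivialAt (fun h : i = j => hi (h ▸ hj)) k l

theorem mem_trivialAt_of_disjoint {S T : Finset ι} {X : Obs R ι κ} (hX : X ∈ localAlgebra S)
    (h : Disjoint T S) : ∀ i ∈ T, X ∈ trivialAt i :=
  fun _ hi => localAlgebra_le_trivialAt (Finset.disjoint_left.1 h hi) hX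

theorem commute_of_mem_trivialAt {S : Finset ι} {X Y : Obs R ι κ} (hX : X ∈ localAlgebra S)
    (hY : ∀ i ∈ S, Y ∈ trivialAt i) : Commute X Y := by
  refine (Algebra.commute_of_mem_adjoin_of_forall_mem_commute hX ?_).symm
  rintro _ ⟨i, hi, k, l, rfl⟩
  exact (mem_trivialAt.1 (hY i hi) k l).symm

theorem lie_eq_zero_of_mem_trivialAt {S : Finset ι} {X Y : Obs R ι κ} (hX : X ∈ localAlgebra S)
    (hY : ∀ i ∈ S, Y ∈ trivialAt i) : ⁅X, Y⁆ = 0 :=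
  commute_iff_lie_eq.1 (commute_of_mem_trivialAt hX hY)

theorem lie_eq_zero_of_disjoint {S T : Finset ι} {X Y : Obs R ι κ} (hX : X ∈ localAlgebra S)
    (hY : Y ∈ localAlgebra T) (h : Disjoint S T) : ⁅X, Y⁆ = 0 :=
  lie_eq_zero_of_mem_trivialAt hX (mem_trivialAt_of_disjoint hY h)

section Coefficients

variable [Fintype κ]

/-- The coefficient of the matrix unit `|k⟩⟨l|` at the site `i`, an operator acting trivially
there. -/
def siteCoeff (i : ι) (k l : κ) : Module.End R (Obs R ι κ) :=
  ∑ m, LinearMap.mulLeftRight R (siteUnit i m k, siteUnit i l m)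

theorem siteCoeff_apply (i : ι) (k l : κ) (X : Obs R ι κ) :
    siteCoeff i k l X = ∑ m, siteUnit i m k * X * siteUnit i l m := by
  simp [siteCoeff, LinearMap.sum_apply]

theorem siteUnit_mul_siteCoeff (i : ι) (k l m n : κ) (X : Obs R ι κ) :
    siteUnit i m n * siteCoeff i k l X = siteUnit i m k * X * siteUnit i l n := by
  rw [siteCoeff_apply, Finset.mul_sum, Finset.sum_eq_single n]
  · rw [← mul_assoc, ← mul_assoc, siteUnit_mul_siteUnit, if_pos rfl]
  · intro r _ hr
    rw [← mul_assoc, ← mul_assoc, siteUnit_mul_siteUnit, if_neg hr.symm, zero_mul, zero_mul]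
  · simp

theorem siteCoeff_mul_siteUnit (i : ι) (k l m n : κ) (X : Obs R ι κ) :
    siteCoeff i k l X * siteUnit i m n = siteUnit i m k * X * siteUnit i l n := by
  rw [siteCoeff_apply, Finset.sum_mul, Finset.sum_eq_single m]
  · rw [mul_assoc, siteUnit_mul_siteUnit, if_pos rfl]
  · intro r _ hr
    rw [mul_assoc, siteUnit_mul_siteUnit, if_neg hr, mul_zero]
  · simp

theorem siteCoeff_mem_trivialAt_self (i : ι) (k l : κ) (X : Obs R ι κ) :
    siteCoeff i k l X ∈ trivialAt i :=
  mem_trivialAt.2 fun _ _ =>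
    (siteUnit_mul_siteCoeff i k l _ _ X).trans (siteCoeff_mul_siteUnit i k l _ _ X).symm

theorem siteCoeff_mem_trivialAt {i : ι} {X : Obs R ι κ} (hX : X ∈ trivialAt i) (j : ι) (k l : κ) :
    siteCoeff j k l X ∈ trivialAt i := by
  rcases eq_or_ne i j with rfl | h
  · exact siteCoeff_mem_trivialAt_self _ _ _ _
  · rw [siteCoeff_apply]
    exact sum_mem fun m _ =>
      mul_mem (mul_mem (siteUnit_mem_trivialAt h _ _) hX) (siteUnit_mem_trivialAt h _ _)

theorem sum_siteUnit_mul_siteCoeff (i : ι) (X : Obs R ι κ) :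
    ∑ k, ∑ l, siteUnit i k l * siteCoeff i k l X = X := by
  simp only [siteUnit_mul_siteCoeff, ← Finset.mul_sum, ← Finset.sum_mul, sum_siteUnit, mul_one,
    one_mul]

theorem siteCoeff_mul (i : ι) (k l : κ) (X Y : Obs R ι κ) :
    siteCoeff i k l (X * Y) = ∑ r, siteCoeff i k r X * siteCoeff i r l Y := by
  have expand (r : κ) : siteCoeff i k r X * siteCoeff i r l Y
      = ∑ m, siteUnit i m k * X * siteUnit i r r * Y * siteUnit i l m := by
    rw [siteCoeff_apply, Finset.sum_mul]
    refine Finset.sum_congr rfl fun m _ => ?_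
    rw [mul_assoc (_ * X), siteUnit_mul_siteCoeff]
    simp only [mul_assoc]
  simp only [expand]
  rw [Finset.sum_comm, siteCoeff_apply]
  simp only [← Finset.sum_mul, ← Finset.mul_sum, sum_siteUnit, one_mul, mul_assoc]

theorem siteCoeff_of_mem_trivialAt {i : ι} {X : Obs R ι κ} (hX : X ∈ trivialAt i) (k l : κ) :
    siteCoeff i k l X = if k = l then X else 0 := by
  have hcomm (m n : κ) : siteUnit i m n * X = X * siteUnit i m n := mem_trivialAt.1 hX m n
  simp only [siteCoeff_apply, hcomm, mul_assoc, siteUnit_mul_siteUnit]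
  split_ifs
  · rw [← Finset.mul_sum, sum_siteUnit, mul_one]
  · simp

theorem siteCoeff_siteUnit (i : ι) (k l m n : κ) :
    siteCoeff i k l (siteUnit i m n : Obs R ι κ) = if k = m ∧ l = n then 1 else 0 := by
  simp only [siteCoeff_apply, siteUnit_mul_siteUnit, ite_mul, zero_mul]
  by_cases hkm : k = m <;> by_cases hln : l = n <;> simp [hkm, hln, sum_siteUnit, Ne.symm]

theorem siteCoeff_mul_left {i : ι} {X : Obs R ι κ} (hX : X ∈ trivialAt i) (k l : κ)
    (Y : Obs R ι κ) : siteCoeff i k l (X * Y) = X * siteCoeff i k l Y := by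
  simp [siteCoeff_mul, siteCoeff_of_mem_trivialAt hX]

theorem siteCoeff_mul_right {i : ι} {Y : Obs R ι κ} (hY : Y ∈ trivialAt i) (k l : κ)
    (X : Obs R ι κ) : siteCoeff i k l (X * Y) = siteCoeff i k l X * Y := by
  simp [siteCoeff_mul, siteCoeff_of_mem_trivialAt hY]

theorem siteCoeff_comm {i j : ι} (h : i ≠ j) (k l m n : κ) (X : Obs R ι κ) :
    siteCoeff i k l (siteCoeff j m n X) = siteCoeff j m n (siteCoeff i k l X) := by
  simp only [siteCoeff_apply j, map_sum, siteCoeff_mul_right (siteUnit_mem_trivialAt h _ _),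
    siteCoeff_mul_left (siteUnit_mem_trivialAt h _ _)]

theorem siteCoeff_mem_localAlgebra {S : Finset ι} {X : Obs R ι κ} (hX : X ∈ localAlgebra S)
    (i : ι) (k l : κ) : siteCoeff i k l X ∈ localAlgebra (S.erase i) := by
  induction hX using Algebra.adjoin_induction generalizing k l with
  | mem x hx =>
    obtain ⟨j, hj, m, n, rfl⟩ := hx
    rcases eq_or_ne i j with rfl | h
    · rw [siteCoeff_siteUnit]
      split_ifs
      exacts [one_mem _, zero_mem _]
    · rw [siteCoeff_of_mem_trivialAt (siteUnit_mem_trivialAt h _ _)]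
      split_ifs
      exacts [siteUnit_mem_localAlgebra (Finset.mem_erase.2 ⟨h.symm, hj⟩) _ _, zero_mem _]
  | algebraMap r =>
    rw [siteCoeff_of_mem_trivialAt (algebraMap_mem _ r)]
    split_ifs
    exacts [algebraMap_mem _ r, zero_mem _]
  | add x y _ _ hx hy =>
    rw [map_add]
    exact add_mem (hx _ _) (hy _ _)
  | mul x y _ _ hx hy =>
    rw [siteCoeff_mul]
    exact sum_mem fun r _ => mul_mem (hx _ _) (hy _ _)

end Coefficients

end LocalAlgebra

section PartialTrace

variable {𝕜 ι κ : Type*} [Field 𝕜] [DecidableEq ι] [DecidableEq κ] [Fintype κ]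

/-- The normalized partial trace over the site `i`, tensored with the identity there. -/
noncomputable def siteTrace (i : ι) : Module.End 𝕜 (Obs 𝕜 ι κ) :=
  (Fintype.card κ : 𝕜)⁻¹ • ∑ k, siteCoeff i k k

theorem siteTrace_apply (i : ι) (X : Obs 𝕜 ι κ) :
    siteTrace i X = (Fintype.card κ : 𝕜)⁻¹ • ∑ k, siteCoeff i k k X := by
  simp [siteTrace, LinearMap.sum_apply]

theorem siteTrace_of_mem_trivialAt [CharZero 𝕜] [Nonempty κ] {i : ι} {X : Obs 𝕜 ι κ}
    (hX : X ∈ trivialAt i) : siteTrace i X = X := by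
  simp [siteTrace_apply, siteCoeff_of_mem_trivialAt hX, ← Nat.cast_smul_eq_nsmul 𝕜, smul_smul]

theorem siteTrace_mem_localAlgebra {S : Finset ι} {X : Obs 𝕜 ι κ} (hX : X ∈ localAlgebra S)
    (i : ι) : siteTrace i X ∈ localAlgebra (S.erase i) := by
  rw [siteTrace_apply]
  exact Subalgebra.smul_mem _ (sum_mem fun k _ => siteCoeff_mem_localAlgebra hX i k k) _

theorem siteTrace_mem_trivialAt_self (i : ι) (X : Obs 𝕜 ι κ) : siteTrace i X ∈ trivialAt i := by
  rw [siteTrace_apply]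
  exact Subalgebra.smul_mem _ (sum_mem fun k _ => siteCoeff_mem_trivialAt_self i k k X) _

theorem siteTrace_mem_trivialAt {i : ι} {X : Obs 𝕜 ι κ} (hX : X ∈ trivialAt i) (j : ι) :
    siteTrace j X ∈ trivialAt i := by
  rw [siteTrace_apply]
  exact Subalgebra.smul_mem _ (sum_mem fun k _ => siteCoeff_mem_trivialAt hX j k k) _

theorem siteTrace_siteTrace_self [CharZero 𝕜] [Nonempty κ] (i : ι) (X : Obs 𝕜 ι κ) :
    siteTrace i (siteTrace i X) = siteTrace i X :=
  siteTrace_of_mem_trivialAt (siteTrace_mem_trivialAt_self i X)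

theorem siteTrace_mul_left {i : ι} {X : Obs 𝕜 ι κ} (hX : X ∈ trivialAt i) (Y : Obs 𝕜 ι κ) :
    siteTrace i (X * Y) = X * siteTrace i Y := by
  simp [siteTrace_apply, siteCoeff_mul_left hX, Finset.mul_sum]

theorem siteTrace_mul_right {i : ι} {Y : Obs 𝕜 ι κ} (hY : Y ∈ trivialAt i) (X : Obs 𝕜 ι κ) :
    siteTrace i (X * Y) = siteTrace i X * Y := by
  simp [siteTrace_apply, siteCoeff_mul_right hY, Finset.sum_mul]

theorem siteTrace_lie_left {i : ι} {X : Obs 𝕜 ι κ} (hX : X ∈ trivialAt i) (Y : Obs 𝕜 ι κ) :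
    siteTrace i ⁅X, Y⁆ = ⁅X, siteTrace i Y⁆ := by
  simp [LieRing.of_associative_ring_bracket, siteTrace_mul_left hX, siteTrace_mul_right hX]

theorem siteTrace_lie_right {i : ι} {Y : Obs 𝕜 ι κ} (hY : Y ∈ trivialAt i) (X : Obs 𝕜 ι κ) :
    siteTrace i ⁅X, Y⁆ = ⁅siteTrace i X, Y⁆ := by
  simp [LieRing.of_associative_ring_bracket, siteTrace_mul_left hY, siteTrace_mul_right hY]

theorem siteTrace_comm (i j : ι) (X : Obs 𝕜 ι κ) :
    siteTrace i (siteTrace j X) = siteTrace j (siteTrace i X) := by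
  rcases eq_or_ne i j with rfl | h
  · rfl
  · simp only [siteTrace_apply, map_smul, map_sum, siteCoeff_comm h, ← Finset.smul_sum]
    rw [Finset.sum_comm]

theorem siteTrace_siteUnit_mul (i : ι) (k l : κ) (Y : Obs 𝕜 ι κ) :
    siteTrace i (siteUnit i k l * Y) = siteTrace i (Y * siteUnit i k l) := by
  simp [siteTrace_apply, siteCoeff_mul, siteCoeff_siteUnit, ite_and]

theorem pairwise_commute_siteTrace (S : Finset ι) :
    (S : Set ι).Pairwise (Function.onFun Commute (siteTrace : ι → Module.End 𝕜 (Obs 𝕜 ι κ))) :=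
  fun i _ j _ _ => LinearMap.ext (siteTrace_comm i j)

/-- The normalized partial trace over the sites of `S`, tensored with the identity there. -/
noncomputable def partialTrace (S : Finset ι) : Module.End 𝕜 (Obs 𝕜 ι κ) :=
  S.noncommProd siteTrace (pairwise_commute_siteTrace S)

@[simp]
theorem partialTrace_empty (X : Obs 𝕜 ι κ) : partialTrace ∅ X = X := by
  simp [partialTrace]

@[simp]
theorem partialTrace_singleton (i : ι) (X : Obs 𝕜 ι κ) : partialTrace {i} X = siteTrace i X := by
  simp [partialTrace]

theorem partialTrace_insert {S : Finset ι} {i : ι} (h : i ∉ S) (X : Obs 𝕜 ι κ) :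
    partialTrace (insert i S) X = siteTrace i (partialTrace S X) := by
  rw [partialTrace, Finset.noncommProd_insert_of_notMem _ _ _ _ h]
  rfl

theorem partialTrace_union {S T : Finset ι} (h : Disjoint S T) (X : Obs 𝕜 ι κ) :
    partialTrace (S ∪ T) X = partialTrace S (partialTrace T X) := by
  rw [partialTrace, Finset.noncommProd_union_of_disjoint h]
  rfl

theorem partialTrace_partialTrace_sdiff {S T : Finset ι} (h : S ⊆ T) (X : Obs 𝕜 ι κ) :
    partialTrace S (partialTrace (T \ S) X) = partialTrace T X := by
  rw [← partialTrace_union Finset.disjoint_sdiff, Finset.union_sdiff_of_subset h]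

theorem partialTrace_erase_siteTrace {S : Finset ι} {i : ι} (h : i ∈ S) (X : Obs 𝕜 ι κ) :
    partialTrace (S.erase i) (siteTrace i X) = partialTrace S X := by
  rw [← partialTrace_singleton, ← partialTrace_union (by simp), Finset.union_comm,
    ← Finset.insert_eq, Finset.insert_erase h]

theorem partialTrace_eq_zero {S : Finset ι} {i : ι} (h : i ∈ S) {X : Obs 𝕜 ι κ}
    (hX : siteTrace i X = 0) : partialTrace S X = 0 := by
  rw [← partialTrace_erase_siteTrace h, hX, map_zero]

theorem partialTrace_siteTrace (S : Finset ι) (i : ι) (X : Obs 𝕜 ι κ) :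
    partialTrace S (siteTrace i X) = siteTrace i (partialTrace S X) := by
  induction S using Finset.induction_on with
  | empty => simp
  | insert j S h ih => rw [partialTrace_insert h, partialTrace_insert h, ih, siteTrace_comm]

theorem partialTrace_mem_localAlgebra {T : Finset ι} {X : Obs 𝕜 ι κ} (hX : X ∈ localAlgebra T)
    (S : Finset ι) : partialTrace S X ∈ localAlgebra (T \ S) := by
  induction S using Finset.induction_on with
  | empty => simpa
  | insert i S hi ih =>
    rw [partialTrace_insert hi, Finset.sdiff_insert]
    exact siteTrace_mem_localAlgebra ih i

theorem partialTrace_of_mem_trivialAt [CharZero 𝕜] [Nonempty κ] {S : Finset ι} {X : Obs 𝕜 ι κ}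
    (hX : ∀ i ∈ S, X ∈ trivialAt i) : partialTrace S X = X := by
  induction S using Finset.induction_on with
  | empty => simp
  | insert j S hj ih =>
    rw [Finset.forall_mem_insert] at hX
    rw [partialTrace_insert hj, ih hX.2, siteTrace_of_mem_trivialAt hX.1]

theorem partialTrace_of_disjoint [CharZero 𝕜] [Nonempty κ] {S T : Finset ι} {X : Obs 𝕜 ι κ}
    (hX : X ∈ localAlgebra T) (h : Disjoint S T) : partialTrace S X = X :=
  partialTrace_of_mem_trivialAt (mem_trivialAt_of_disjoint hX h)

theorem partialTrace_mul_left {S : Finset ι} {X : Obs 𝕜 ι κ} (hX : ∀ i ∈ S, X ∈ trivialAt i)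
    (Y : Obs 𝕜 ι κ) : partialTrace S (X * Y) = X * partialTrace S Y := by
  induction S using Finset.induction_on with
  | empty => simp
  | insert j S hj ih =>
    rw [Finset.forall_mem_insert] at hX
    rw [partialTrace_insert hj, partialTrace_insert hj, ih hX.2, siteTrace_mul_left hX.1]

theorem partialTrace_mul_right {S : Finset ι} {Y : Obs 𝕜 ι κ} (hY : ∀ i ∈ S, Y ∈ trivialAt i)
    (X : Obs 𝕜 ι κ) : partialTrace S (X * Y) = partialTrace S X * Y := by
  induction S using Finset.induction_on with
  | empty => simp
  | insert j S hj ih =>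
    rw [Finset.forall_mem_insert] at hY
    rw [partialTrace_insert hj, partialTrace_insert hj, ih hY.2, siteTrace_mul_right hY.1]

theorem partialTrace_lie_left {S : Finset ι} {X : Obs 𝕜 ι κ} (hX : ∀ i ∈ S, X ∈ trivialAt i)
    (Y : Obs 𝕜 ι κ) : partialTrace S ⁅X, Y⁆ = ⁅X, partialTrace S Y⁆ := by
  simp [LieRing.of_associative_ring_bracket, partialTrace_mul_left hX, partialTrace_mul_right hX]

theorem partialTrace_mul_comm {S : Finset ι} {X : Obs 𝕜 ι κ} (hX : X ∈ localAlgebra S)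
    (Y : Obs 𝕜 ι κ) : partialTrace S (X * Y) = partialTrace S (Y * X) := by
  induction hX using Algebra.adjoin_induction generalizing Y with
  | mem x hx =>
    obtain ⟨j, hj, k, l, rfl⟩ := hx
    rw [← partialTrace_erase_siteTrace hj, siteTrace_siteUnit_mul, partialTrace_erase_siteTrace hj]
  | algebraMap r => rw [Algebra.commutes]
  | add x y _ _ hx hy => rw [add_mul, mul_add, map_add, map_add, hx, hy]
  | mul x y _ _ hx hy => rw [mul_assoc, hx, mul_assoc, hy, mul_assoc]

theorem partialTrace_lie_eq_zero {S T : Finset ι} {X : Obs 𝕜 ι κ} (hX : X ∈ localAlgebra S)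
    (h : S ⊆ T) (Y : Obs 𝕜 ι κ) : partialTrace T ⁅X, Y⁆ = 0 := by
  rw [LieRing.of_associative_ring_bracket, map_sub, partialTrace_mul_comm (localAlgebra_mono h hX),
    sub_self]

end PartialTrace

section Action

open Function

variable {R ι κ : Type*} [CommRing R] [DecidableEq ι] [DecidableEq κ]

theorem exists_mem_localAlgebra_apply_eq (S : Finset ι) (s t : ι → κ) :
    ∃ W ∈ (localAlgebra S : Subalgebra R (Obs R ι κ)), ∀ f x,
      W f x = if ∀ i ∈ S, x i = s i then f (S.piecewise t x) else 0 := by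
  induction S using Finset.induction_on with
  | empty => exact ⟨1, one_mem _, by simp⟩
  | insert i S hi ih =>
    obtain ⟨W, hW, hWf⟩ := ih
    refine ⟨siteUnit i (s i) (t i) * W,
      mul_mem (siteUnit_mem_localAlgebra (Finset.mem_insert_self _ _) _ _)
        (localAlgebra_mono (Finset.subset_insert _ _) hW), fun f x => ?_⟩
    have hcond : (∀ j ∈ S, update x i (t i) j = s j) ↔ ∀ j ∈ S, x j = s j := by
      refine forall₂_congr fun j hj => ?_
      rw [update_of_ne (fun h => hi (by rwa [← h]))]
    have hpiecewise : S.piecewise t (update x i (t i)) = (insert i S).piecewise t x := by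
      funext j
      simp only [Finset.piecewise, update_apply, Finset.mem_insert]
      grind
    rw [Module.End.mul_apply, siteUnit_apply, hWf]
    simp only [hcond, hpiecewise, Finset.forall_mem_insert, ite_and]

variable [Fintype κ]

/-- The action of a matrix on the sites of `S` as an operator acting trivially elsewhere. -/
def actOn (S : Finset ι) : Matrix (S → κ) (S → κ) R →ₐ[R] Obs R ι κ :=
  AlgHom.ofLinearMap
    { toFun X :=
        { toFun f x := ∑ t, X (S.restrict x) t * f (updateFinset x S t)
          map_add' f g := by ext x; simp [mul_add, Finset.sum_add_distrib]
          map_smul' c f := by ext x; simp [Finset.mul_sum, mul_left_comm] }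
      map_add' X Y := by
        refine LinearMap.ext fun f => funext fun x => ?_
        simp [add_mul, Finset.sum_add_distrib]
      map_smul' c X := by
        refine LinearMap.ext fun f => funext fun x => ?_
        simp [Finset.mul_sum, mul_assoc] }
    (by
      refine LinearMap.ext fun f => funext fun x => ?_
      simp [Matrix.one_apply])
    (by
      intro X Y
      refine LinearMap.ext fun f => funext fun x => ?_
      simp only [Matrix.mul_apply, LinearMap.coe_mk, AddHom.coe_mk, Module.End.mul_apply,
        restrict_updateFinset, updateFinset_updateFinset_of_subset Finset.Subset.rfl,
        Finset.sum_mul, Finset.mul_sum]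
      rw [Finset.sum_comm]
      simp only [mul_assoc])

theorem actOn_apply {S : Finset ι} (X : Matrix (S → κ) (S → κ) R) (f : (ι → κ) → R)
    (x : ι → κ) : actOn S X f x = ∑ t, X (S.restrict x) t * f (updateFinset x S t) := rfl

theorem actOn_lie {S : Finset ι} (X Y : Matrix (S → κ) (S → κ) R) :
    actOn S ⁅X, Y⁆ = ⁅actOn S X, actOn S Y⁆ := by
  simp [Ring.lie_def]

theorem actOn_injective [Nonempty κ] (S : Finset ι) :
    Injective (actOn S : Matrix (S → κ) (S → κ) R →ₐ[R] Obs R ι κ) := by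
  rw [injective_iff_map_eq_zero]
  intro X hX
  ext s t
  inhabit κ
  have h := congrFun (LinearMap.congr_fun hX (fun y => if S.restrict y = t then 1 else 0))
    (updateFinset (fun _ => default) S s)
  simp only [actOn_apply, updateFinset_updateFinset_of_subset Finset.Subset.rfl,
    restrict_updateFinset] at h
  simpa using h

theorem localAlgebra_le_range_actOn (S : Finset ι) :
    (localAlgebra S : Subalgebra R (Obs R ι κ)) ≤ (actOn S).range := by
  refine Algebra.adjoin_le ?_
  rintro _ ⟨i, hi, k, l, rfl⟩
  refine ⟨Matrix.of fun s t =>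
    if s ⟨i, hi⟩ = k ∧ t = update s ⟨i, hi⟩ l then 1 else 0, ?_⟩
  refine LinearMap.ext fun f => funext fun x => ?_
  have hupd : updateFinset x S (update (S.restrict x) ⟨i, hi⟩ l) = update x i l := by
    funext j
    simp only [updateFinset_def, update_apply, Finset.restrict_def]
    grind
  change actOn S _ f x = _
  rw [actOn_apply, siteUnit_apply]
  by_cases h : x i = k <;> simp [h, hupd]

theorem exists_actOn_eq {S : Finset ι} {X : Obs R ι κ} (hX : X ∈ localAlgebra S) :
    ∃ Y, actOn S Y = X := localAlgebra_le_range_actOn S hX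

theorem actOn_mem_localAlgebra [Nonempty κ] {S : Finset ι} (X : Matrix (S → κ) (S → κ) R) :
    actOn S X ∈ localAlgebra S := by
  inhabit κ
  rw [Matrix.matrix_eq_sum_single X, map_sum]
  refine sum_mem fun s _ => ?_
  rw [map_sum]
  refine sum_mem fun t _ => ?_
  rw [← mul_one (X s t), ← smul_eq_mul, ← Matrix.smul_single, map_smul]
  refine Subalgebra.smul_mem _ ?_ _
  obtain ⟨W, hW, hWf⟩ := exists_mem_localAlgebra_apply_eq (R := R) S
    (updateFinset (fun _ => default) S s) (updateFinset (fun _ => default) S t)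
  convert hW using 1
  refine LinearMap.ext fun f => funext fun x => ?_
  have hcond : (∀ i ∈ S, x i = updateFinset (π := fun _ => κ) (fun _ => default) S s i) ↔
      s = S.restrict x := by
    simp only [updateFinset_def, Finset.restrict_def, funext_iff, Subtype.forall]
    grind
  have hpiecewise :
      S.piecewise (updateFinset (fun _ => default) S t) x = updateFinset x S t := by
    funext i
    simp only [updateFinset_def, Finset.piecewise]
    grind
  simp [hWf, actOn_apply, hcond, hpiecewise, Matrix.single_apply, ite_and]

theorem siteCoeff_actOn {S : Finset ι} (a : S) (k l : κ) (X : Matrix (S → κ) (S → κ) R) :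
    siteCoeff a.1 k l (actOn S X) = actOn S (Matrix.of fun s t =>
      if s a = t a then X (update s a k) (update t a l) else 0) := by
  refine LinearMap.ext fun f => funext fun x => ?_
  have hres : S.restrict (update x a.1 k) = update (S.restrict x) a k := by
    funext b
    simp only [Finset.restrict_def, update_apply, Subtype.ext_iff]
  have hupd : ∀ t : S → κ, update (updateFinset (update x a.1 k) S t) a.1 (x a)
      = updateFinset x S (update t a (x a)) := by
    intro t
    funext i
    simp only [updateFinset_def, update_apply]
    grind
  simp only [siteCoeff_apply, LinearMap.sum_apply, Finset.sum_apply, Module.End.mul_apply,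
    siteUnit_apply, Finset.sum_ite_eq, Finset.mem_univ, if_true, actOn_apply, Matrix.of_apply,
    ite_mul, zero_mul, hres, hupd]
  have ha : ∀ t : S → κ, updateFinset (update x a.1 k) S t a.1 = t a := by simp [updateFinset_def]
  simp only [ha, mul_ite, mul_zero]
  rw [← Finset.sum_filter, ← Finset.sum_filter]
  refine Finset.sum_bij' (fun t _ => update t a (x a)) (fun t _ => update t a l)
    (fun t _ => Finset.mem_filter.2 ⟨Finset.mem_univ _, (update_self a (x a) t).symm⟩)
    (fun t _ => Finset.mem_filter.2 ⟨Finset.mem_univ _, update_self a l t⟩) ?_ ?_ ?_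
  · intro t ht
    simp [← (Finset.mem_filter.1 ht).2]
  · intro t ht
    have h : x a = t a := (Finset.mem_filter.1 ht).2
    simp [h]
  · intro t ht
    simp [← (Finset.mem_filter.1 ht).2]

end Action

theorem sum_powerset_neg_one_pow_card_sdiff {R M ι : Type*} [Ring R] [AddCommGroup M] [Module R M]
    [DecidableEq ι] (B : Finset ι) (f : Finset ι → M) :
    ∑ A ∈ B.powerset, ∑ C ∈ A.powerset, (-1 : R) ^ (A \ C).card • f C = f B := by
  induction B using Finset.induction_on generalizing f with
  | empty => simp
  | insert i B hi ih =>
    have hinsert : ∀ A ∈ B.powerset,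
        ∑ C ∈ (insert i A).powerset, (-1 : R) ^ (insert i A \ C).card • f C
          = ∑ C ∈ A.powerset, (-1 : R) ^ (A \ C).card • f (insert i C)
            - ∑ C ∈ A.powerset, (-1 : R) ^ (A \ C).card • f C := by
      intro A hA
      have hiA : i ∉ A := fun h => hi (Finset.mem_powerset.1 hA h)
      rw [Finset.sum_powerset_insert hiA, add_comm, sub_eq_add_neg, ← Finset.sum_neg_distrib]
      congr 1 <;> refine Finset.sum_congr rfl fun C hC => ?_
      · rw [Finset.insert_sdiff_insert, Finset.sdiff_insert_of_notMem hiA]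
      · have hiC : i ∉ C := fun h => hiA (Finset.mem_powerset.1 hC h)
        rw [Finset.insert_sdiff_of_notMem _ hiC,
          Finset.card_insert_of_notMem fun h => hiA (Finset.mem_sdiff.1 h).1, pow_succ, mul_neg_one,
          neg_smul]
    rw [Finset.sum_powerset_insert hi, Finset.sum_congr rfl hinsert, Finset.sum_sub_distrib, ih f,
      ih fun C => f (insert i C), add_sub_cancel]

section Components

variable {d : ℕ} {A B C : Finset ℤ}

theorem actOn_embed (h : A ⊆ B) (X : LocOp d A) : actOn B (embed h X) = actOn A X := by
  refine LinearMap.ext fun f => funext fun x => ?_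
  simp only [actOn_apply, embed, ite_mul, zero_mul]
  rw [← Finset.sum_filter]
  refine Finset.sum_bij' (fun t _ => Finset.restrict₂ (π := fun _ => Fin d) h t)
    (fun t _ => B.restrict (Function.updateFinset x A t)) (by simp) ?_ ?_ ?_ ?_
  · intro t _
    refine (Finset.mem_filter_univ _).2 fun i hi => ?_
    simp [Function.updateFinset_def, hi]
  · intro t ht
    have ht' : ∀ i : B, i.1 ∉ A → x i = t i := (Finset.mem_filter_univ _).1 ht
    funext b
    by_cases hb : b.1 ∈ A
    · simp [Function.updateFinset_def, hb]
    · simp [Function.updateFinset_def, hb, ht' b hb]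
  · intro t _
    funext a
    simp [Function.updateFinset_def]
  · intro t ht
    have ht' : ∀ i : B, i.1 ∉ A → x i = t i := (Finset.mem_filter_univ _).1 ht
    congr 2
    funext i
    simp only [Function.updateFinset_def, Finset.restrict₂]
    grind

theorem embed_reduce (hCA : C ⊆ A) (hAB : A ⊆ B) (Y : LocOp d B) :
    embed hAB (reduce A C Y) = reduce B C Y := by
  ext s t
  have hglue : ∀ w u : B → Fin d, glue C (fun a : A => w ⟨a.1, hAB a.2⟩) u = glue C w u := by
    intro w u
    funext b
    simp only [glue]
    grind
  simp only [embed, reduce, hglue, ← ite_and]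
  refine if_congr ⟨?_, ?_⟩ rfl rfl
  · rintro ⟨hB, hA⟩ i hi
    by_cases hiA : i.1 ∈ A
    · exact hA ⟨i.1, hiA⟩ hi
    · exact hB i hiA
  · exact fun h => ⟨fun i hi => h i fun hC => hi (hCA hC), fun i hi => h ⟨i.1, hAB i.2⟩ hi⟩

variable [NeZero d]

theorem reduce_self (Y : LocOp d B) : reduce B B Y = Y := by
  ext s t
  have hglue : ∀ w u : B → Fin d, glue B w u = w := by
    intro w u
    funext b
    simp [glue]
  have hd : (d : ℂ) ≠ 0 := Nat.cast_ne_zero.2 (NeZero.ne d)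
  simp [reduce, hglue, hd]

theorem sum_actOn_component (B : Finset ℤ) (Y : LocOp d B) :
    ∑ A ∈ B.powerset, actOn A (component A Y) = actOn B Y := by
  have hcomponent : ∀ A ∈ B.powerset, actOn A (component A Y)
      = ∑ C ∈ A.powerset, (-1 : ℂ) ^ (A \ C).card • actOn B (reduce B C Y) := by
    intro A hA
    rw [component, map_sum]
    refine Finset.sum_congr rfl fun C hC => ?_
    rw [map_smul, ← embed_reduce (Finset.mem_powerset.1 hC) (Finset.mem_powerset.1 hA),
      actOn_embed]
  rw [Finset.sum_congr rfl hcomponent,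
    sum_powerset_neg_one_pow_card_sdiff B fun C => actOn B (reduce B C Y), reduce_self]

theorem siteTrace_actOn_eq_zero_iff (a : A) (X : LocOp d A) :
    siteTrace a.1 (actOn A X) = 0 ↔ ∀ s t : A → Fin d,
      ∑ k, X (Function.update s a k) (Function.update t a k) = 0 := by
  have hd : (d : ℂ)⁻¹ ≠ 0 := inv_ne_zero (Nat.cast_ne_zero.2 (NeZero.ne d))
  rw [siteTrace_apply, Fintype.card_fin, smul_eq_zero_iff_right hd]
  simp only [siteCoeff_actOn, ← map_sum]
  rw [map_eq_zero_iff _ (actOn_injective A)]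
  constructor
  · intro h s t
    simpa [Matrix.sum_apply] using congrFun (congrFun h s) (Function.update t a (s a))
  · intro h
    ext s t
    by_cases hst : s a = t a <;> simp [Matrix.sum_apply, hst, h s t]

theorem isTraceless_iff_siteTrace (X : LocOp d A) :
    IsTraceless X ↔ ∀ a ∈ A, siteTrace a (actOn A X) = 0 := by
  simp only [IsTraceless, ← siteTrace_actOn_eq_zero_iff, Subtype.forall]

end Components

section Relabel

variable {R ι κ : Type*} [CommRing R]

/-- The automorphism of the operator algebra induced by a permutation of the sites. -/
def relabel (e : Equiv.Perm ι) : Obs R ι κ ≃ₐ[R] Obs R ι κ :=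
  (LinearEquiv.funCongrLeft R R (e.symm.arrowCongr (Equiv.refl κ))).conjAlgEquiv R

theorem relabel_apply (e : Equiv.Perm ι) (X : Obs R ι κ) (f : (ι → κ) → R) (c : ι → κ) :
    relabel e X f c = X (fun y => f (y ∘ e.symm)) (c ∘ e) := rfl

theorem relabel_lie (e : Equiv.Perm ι) (X Y : Obs R ι κ) :
    relabel e ⁅X, Y⁆ = ⁅relabel e X, relabel e Y⁆ := by
  simp [Ring.lie_def]

variable [DecidableEq ι] [DecidableEq κ]

theorem relabel_siteUnit (e : Equiv.Perm ι) (i : ι) (k l : κ) :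
    relabel e (siteUnit i k l : Obs R ι κ) = siteUnit (e i) k l := by
  refine LinearMap.ext fun f => funext fun c => ?_
  rw [relabel_apply, siteUnit_apply, siteUnit_apply, Function.update_comp_equiv]
  simp [Function.comp_assoc]

theorem relabel_mem_localAlgebra {S : Finset ι} {X : Obs R ι κ} (hX : X ∈ localAlgebra S)
    (e : Equiv.Perm ι) : relabel e X ∈ localAlgebra (S.map e.toEmbedding) := by
  induction hX using Algebra.adjoin_induction with
  | mem y hy =>
    obtain ⟨i, hi, k, l, rfl⟩ := hy
    rw [relabel_siteUnit]
    exact siteUnit_mem_localAlgebra (Finset.mem_map_of_mem _ hi) _ _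
  | algebraMap r =>
    rw [AlgEquiv.commutes]
    exact Subalgebra.algebraMap_mem _ _
  | add y z _ _ hy hz =>
    rw [map_add]
    exact add_mem hy hz
  | mul y z _ _ hy hz =>
    rw [map_mul]
    exact mul_mem hy hz

variable [Fintype κ]

theorem relabel_siteCoeff (e : Equiv.Perm ι) (i : ι) (k l : κ) (X : Obs R ι κ) :
    relabel e (siteCoeff i k l X) = siteCoeff (e i) k l (relabel e X) := by
  simp [siteCoeff_apply, relabel_siteUnit]

theorem relabel_actOn (e : Equiv.Perm ι) (A : Finset ι) (X : Matrix (A → κ) (A → κ) R) :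
    relabel e (actOn A X) = actOn (A.map e.toEmbedding) (Matrix.of fun s t =>
      X (fun a => s ⟨e a, Finset.mem_map_of_mem e.toEmbedding a.2⟩)
        (fun a => t ⟨e a, Finset.mem_map_of_mem e.toEmbedding a.2⟩)) := by
  refine LinearMap.ext fun f => funext fun c => ?_
  rw [relabel_apply, actOn_apply, actOn_apply]
  have he : ∀ a, a ∈ A ↔ e a ∈ A.map e.toEmbedding := by simp
  refine Fintype.sum_equiv ((e.subtypeEquiv he).arrowCongr (Equiv.refl κ)) _ _ fun t => ?_
  have hupd : Function.updateFinset (c ∘ e) A t ∘ e.symm = Function.updateFinset c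
      (A.map e.toEmbedding) ((e.subtypeEquiv he).arrowCongr (Equiv.refl κ) t) := by
    funext i
    simp [Function.updateFinset_def, Equiv.subtypeEquiv_symm]
  rw [hupd]
  simp [Finset.restrict_def]

theorem relabel_siteTrace {𝕜 : Type*} [Field 𝕜] (e : Equiv.Perm ι) (i : ι) (X : Obs 𝕜 ι κ) :
    relabel e (siteTrace i X) = siteTrace (e i) (relabel e X) := by
  simp [siteTrace_apply, relabel_siteCoeff]

theorem relabel_partialTrace {𝕜 : Type*} [Field 𝕜] (e : Equiv.Perm ι) (S : Finset ι)
    (X : Obs 𝕜 ι κ) :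
    relabel e (partialTrace S X) = partialTrace (S.map e.toEmbedding) (relabel e X) := by
  induction S using Finset.induction_on with
  | empty => simp
  | insert i S hi ih =>
    rw [Finset.map_insert, partialTrace_insert hi, relabel_siteTrace, ih,
      partialTrace_insert (by simpa using hi), Equiv.coe_toEmbedding]

end Relabel

theorem eq_of_sum_powerset_eq {ι M : Type*} [AddCancelCommMonoid M] {f g : Finset ι → M}
    {B : Finset ι} (h : ∀ A ⊆ B, ∑ C ∈ A.powerset, f C = ∑ C ∈ A.powerset, g C) : f B = g B := by
  classical
  induction B using Finset.strongInduction with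
  | H B ih =>
    have hB := h B Finset.Subset.rfl
    rw [← Finset.add_sum_erase _ f (Finset.mem_powerset_self B),
      ← Finset.add_sum_erase _ g (Finset.mem_powerset_self B),
      Finset.sum_congr rfl fun C hC => ih C ?_ fun A hA => h A ?_] at hB
    · exact add_right_cancel hB
    all_goals
      have hC' := Finset.mem_erase.1 hC
      have hCB := Finset.mem_powerset.1 hC'.2
    · exact hCB.ssubset_of_ne hC'.1
    · exact hA.trans hCB

theorem partialTrace_sum_powerset {𝕜 ι κ : Type*} [Field 𝕜] [CharZero 𝕜] [DecidableEq ι]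
    [DecidableEq κ] [Fintype κ] [Nonempty κ] {f : Finset ι → Obs 𝕜 ι κ} {B : Finset ι}
    (hf : ∀ A ⊆ B, f A ∈ localAlgebra A) (h0 : ∀ A ⊆ B, ∀ a ∈ A, siteTrace a (f A) = 0)
    (S : Finset ι) :
    partialTrace S (∑ A ∈ B.powerset, f A) = ∑ A ∈ (B \ S).powerset, f A := by
  rw [map_sum]
  symm
  refine Finset.sum_subset_zero_on_sdiff (Finset.powerset_mono.2 Finset.sdiff_subset) ?_ ?_
  · intro A hA
    simp only [Finset.mem_sdiff, Finset.mem_powerset] at hA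
    obtain ⟨a, ha, haS⟩ := Finset.not_subset.1 hA.2
    have haS' : a ∈ S := by
      by_contra h
      exact haS (Finset.mem_sdiff.2 ⟨hA.1 ha, h⟩)
    exact partialTrace_eq_zero haS' (h0 A hA.1 a ha)
  · intro A hA
    have hA' := Finset.mem_powerset.1 hA
    exact (partialTrace_of_disjoint (hf A (hA'.trans Finset.sdiff_subset))
      (Finset.disjoint_sdiff.mono_right hA')).symm

section Formal

variable {d : ℕ}

/-- The term `Φ(A)` as an element of the common operator algebra. -/
def summand (A : Finset ℤ) : FormalOp d →ₗ[ℂ] Obs ℂ ℤ (Fin d) where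
  toFun Φ := actOn A (Φ.1 A)
  map_add' _ _ := map_add (actOn A) _ _
  map_smul' c Φ := map_smul (actOn A) c (Φ.1 A)

theorem summand_apply (A : Finset ℤ) (Φ : FormalOp d) : summand A Φ = actOn A (Φ.1 A) := rfl

/-- The sum of the terms of a formal operator supported in `B`, that is, its restriction to `B` as
an element of the common operator algebra. -/
def partialSum (B : Finset ℤ) : FormalOp d →ₗ[ℂ] Obs ℂ ℤ (Fin d) := ∑ A ∈ B.powerset, summand A

theorem partialSum_apply (B : Finset ℤ) (Φ : FormalOp d) :
    partialSum B Φ = ∑ A ∈ B.powerset, summand A Φ := LinearMap.sum_apply _ _ _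

theorem actOn_restrict (Φ : FormalOp d) (B : Finset ℤ) :
    actOn B (restrict Φ B) = partialSum B Φ := by
  rw [restrict, map_sum, partialSum_apply, ← Finset.sum_attach B.powerset]
  exact Finset.sum_congr rfl fun A _ => actOn_embed _ _

/-- The formal operators of range at most `n`. -/
def rangeLE (n : ℕ) : Submodule ℂ (FormalOp d) where
  carrier := {Φ | ∀ A, summand A Φ ≠ 0 → ∀ a ∈ A, ∀ b ∈ A, b - a < n}
  zero_mem' A hA := absurd (map_zero (summand A)) hA
  add_mem' := by
    intro Φ Ψ hΦ hΨ A hA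
    by_cases h : summand A Φ = 0
    · exact hΨ A fun h' => hA (by rw [map_add, h, h', add_zero])
    · exact hΦ A h
  smul_mem' c Φ hΦ A hA := hΦ A fun h => hA (by rw [map_smul, h, smul_zero])

theorem mem_rangeLE {n : ℕ} {Φ : FormalOp d} :
    Φ ∈ rangeLE n ↔ ∀ A, summand A Φ ≠ 0 → ∀ a ∈ A, ∀ b ∈ A, b - a < n := Iff.rfl

theorem rangeLE_mono {m n : ℕ} (h : m ≤ n) : (rangeLE m : Submodule ℂ (FormalOp d)) ≤ rangeLE n :=
  fun _ hΦ A hA a ha b hb => (hΦ A hA a ha b hb).trans_le (by exact_mod_cast h)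

variable [NeZero d]

theorem summand_mem_localAlgebra (Φ : FormalOp d) (A : Finset ℤ) : summand A Φ ∈ localAlgebra A :=
  actOn_mem_localAlgebra _

theorem siteTrace_summand (Φ : FormalOp d) {A : Finset ℤ} {a : ℤ} (ha : a ∈ A) :
    siteTrace a (summand A Φ) = 0 := (isTraceless_iff_siteTrace _).1 (Φ.2 A) a ha

theorem summand_eq_zero_iff {Φ : FormalOp d} {A : Finset ℤ} : summand A Φ = 0 ↔ Φ.1 A = 0 :=
  map_eq_zero_iff (actOn A) (actOn_injective A)

theorem ext_summand {Φ Ψ : FormalOp d} (h : ∀ A, summand A Φ = summand A Ψ) : Φ = Ψ :=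
  Subtype.ext (funext fun A => actOn_injective A (h A))

theorem ext_partialSum {Φ Ψ : FormalOp d} (h : ∀ B, partialSum B Φ = partialSum B Ψ) : Φ = Ψ :=
  ext_summand fun _ => eq_of_sum_powerset_eq (f := fun A => summand A Φ)
    (g := fun A => summand A Ψ) fun A _ => by simpa only [partialSum_apply] using h A

theorem exists_summand_eq (f : Finset ℤ → Obs ℂ ℤ (Fin d)) (hf : ∀ A, f A ∈ localAlgebra A)
    (h0 : ∀ A, ∀ a ∈ A, siteTrace a (f A) = 0) : ∃ Φ : FormalOp d, ∀ A, summand A Φ = f A := by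
  choose g hg using fun A => exists_actOn_eq (hf A)
  refine ⟨⟨g, fun A => (isTraceless_iff_siteTrace _).2 fun a ha => ?_⟩, hg⟩
  rw [hg, h0 A a ha]

theorem partialSum_mem_localAlgebra (Φ : FormalOp d) (B : Finset ℤ) :
    partialSum B Φ ∈ localAlgebra B := by
  rw [partialSum_apply]
  exact sum_mem fun A hA => localAlgebra_mono (Finset.mem_powerset.1 hA)
    (summand_mem_localAlgebra Φ A)

theorem partialTrace_partialSum (Φ : FormalOp d) (B S : Finset ℤ) :
    partialTrace S (partialSum B Φ) = partialSum (B \ S) Φ := by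
  rw [partialSum_apply, partialSum_apply, partialTrace_sum_powerset
    (fun A _ => summand_mem_localAlgebra Φ A) (fun _ _ _ ha => siteTrace_summand Φ ha)]

theorem siteTrace_partialSum (Φ : FormalOp d) (B : Finset ℤ) (i : ℤ) :
    siteTrace i (partialSum B Φ) = partialSum (B.erase i) Φ := by
  rw [← partialTrace_singleton, partialTrace_partialSum, Finset.sdiff_singleton_eq_erase]

theorem setRange_le_iff {A : Finset ℤ} {n : ℕ} :
    setRange A ≤ n ↔ ∀ a ∈ A, ∀ b ∈ A, b - a < n := by
  unfold setRange
  split_ifs with h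
  · constructor
    · intro hn a ha b hb
      have hmin := A.min'_le a ha
      have hmax := A.le_max' b hb
      omega
    · intro hA
      have hlt := hA _ (A.min'_mem h) _ (A.max'_mem h)
      omega
  · simp [Finset.not_nonempty_iff_eq_empty.1 h]

theorem opRange_le_iff {Φ : FormalOp d} {n : ℕ} : opRange Φ ≤ n ↔ Φ ∈ rangeLE n := by
  simp only [opRange, iSup_le_iff, Nat.cast_le, setRange_le_iff, mem_rangeLE, Ne,
    summand_eq_zero_iff]

theorem mem_rangeLE_toNat {Φ : FormalOp d} (h : opRange Φ < ⊤) : Φ ∈ rangeLE (opRange Φ).toNat :=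
  opRange_le_iff.1 (ENat.natCast_toNat h.ne).ge

end Formal

section Commutator

variable {d : ℕ}

theorem mem_nbhd {A : Finset ℤ} {n : ℕ} {c : ℤ} :
    c ∈ nbhd A n ↔ ∃ a ∈ A, a - n ≤ c ∧ c ≤ a + n := by
  simp only [nbhd, Finset.mem_biUnion, Finset.mem_Icc]

theorem nbhd_mono {A B : Finset ℤ} {m n : ℕ} (h : A ⊆ B) (hmn : m ≤ n) : nbhd A m ⊆ nbhd B n := by
  intro c hc
  obtain ⟨a, ha, h1, h2⟩ := mem_nbhd.1 hc
  exact mem_nbhd.2 ⟨a, h ha, by omega, by omega⟩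

theorem subset_nbhd_of_mem_rangeLE {Φ : FormalOp d} {r : ℕ} (hΦ : Φ ∈ rangeLE r) {C D : Finset ℤ}
    (h0 : summand C Φ ≠ 0) (hCD : ¬ Disjoint C D) : C ⊆ nbhd D r := by
  obtain ⟨c, hc, hcD⟩ := Finset.not_disjoint_iff.1 hCD
  intro x hx
  have hxc := hΦ C h0 x hx c hc
  have hcx := hΦ C h0 c hc x hx
  exact mem_nbhd.2 ⟨c, hcD, by omega, by omega⟩

theorem partialSum_eq_add_sum_sdiff (Φ : FormalOp d) {N B : Finset ℤ} (h : N ⊆ B) :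
    partialSum B Φ = partialSum N Φ + ∑ C ∈ B.powerset \ N.powerset, summand C Φ := by
  rw [partialSum_apply, partialSum_apply, ← Finset.sum_sdiff (Finset.powerset_mono.2 h), add_comm]

variable [NeZero d]

theorem partialTrace_summand_lie_eq_zero (Φ : FormalOp d) {B C D : Finset ℤ} (hC : C ⊆ B)
    (hCD : Disjoint C D) (Y : Obs ℂ ℤ (Fin d)) : partialTrace (B \ D) ⁅summand C Φ, Y⁆ = 0 :=
  partialTrace_lie_eq_zero (summand_mem_localAlgebra Φ C) (Finset.subset_sdiff.2 ⟨hC, hCD⟩) Y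

theorem partialTrace_lie_partialSum {Φ : FormalOp d} {r : ℕ} (hΦ : Φ ∈ rangeLE r)
    {D N B : Finset ℤ} (hN : nbhd D r ⊆ N) (hB : N ⊆ B) (Y : Obs ℂ ℤ (Fin d)) :
    partialTrace (B \ D) ⁅partialSum B Φ, Y⁆
      = partialTrace (N \ D) ⁅partialSum N Φ, partialTrace (B \ N) Y⁆ := by
  have hDN : D ⊆ N := (subset_nbhd D r).trans hN
  have hshrink : partialTrace (B \ D) ⁅partialSum B Φ, Y⁆
      = partialTrace (B \ D) ⁅partialSum N Φ, Y⁆ := by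
    rw [partialSum_eq_add_sum_sdiff Φ hB, add_lie, map_add, sum_lie, map_sum,
      Finset.sum_eq_zero, add_zero]
    intro C hC
    simp only [Finset.mem_sdiff, Finset.mem_powerset] at hC
    by_cases h0 : summand C Φ = 0
    · rw [h0, zero_lie, map_zero]
    · refine partialTrace_summand_lie_eq_zero Φ hC.1 ?_ Y
      by_contra hCD
      exact hC.2 ((subset_nbhd_of_mem_rangeLE hΦ h0 hCD).trans hN)
  have hunion : B \ D = (N \ D) ∪ (B \ N) := by
    rw [Finset.union_comm, Finset.sdiff_union_sdiff_cancel hB hDN]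
  rw [hshrink, hunion, partialTrace_union (Finset.disjoint_sdiff.mono_left Finset.sdiff_subset),
    partialTrace_lie_left]
  exact mem_trivialAt_of_disjoint (partialSum_mem_localAlgebra Φ N) Finset.sdiff_disjoint

theorem partialTrace_actOn {D B : Finset ℤ} (Y : LocOp d B) (h : D ⊆ B) :
    partialTrace (B \ D) (actOn B Y) = ∑ A ∈ D.powerset, actOn A (component A Y) := by
  rw [← sum_actOn_component, partialTrace_sum_powerset, Finset.sdiff_sdiff_eq_self h]
  · exact fun _ _ => actOn_mem_localAlgebra _
  · exact fun A hA => (isTraceless_iff_siteTrace _).1 (component_isTraceless hA Y)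

theorem partialTrace_lie_partialSum_partialSum {Φ Ψ : FormalOp d} {r : ℕ} (hΦ : Φ ∈ rangeLE r)
    {D N B : Finset ℤ} (hN : nbhd D r ⊆ N) (hB : N ⊆ B) :
    partialTrace (B \ D) ⁅partialSum B Φ, partialSum B Ψ⁆
      = partialTrace (N \ D) ⁅partialSum N Φ, partialSum N Ψ⁆ := by
  rw [partialTrace_lie_partialSum hΦ hN hB, partialTrace_partialSum, Finset.sdiff_sdiff_eq_self hB]

theorem actOn_component_lie_restrict {Φ Ψ : FormalOp d} {r : ℕ} (hΦ : Φ ∈ rangeLE r)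
    {A N B : Finset ℤ} (hN : nbhd A r ⊆ N) (hB : N ⊆ B) :
    actOn A (component A ⁅restrict Φ N, restrict Ψ N⁆)
      = actOn A (component A ⁅restrict Φ B, restrict Ψ B⁆) := by
  refine eq_of_sum_powerset_eq
    (f := fun A => actOn A (component A ⁅restrict Φ N, restrict Ψ N⁆))
    (g := fun A => actOn A (component A ⁅restrict Φ B, restrict Ψ B⁆)) fun D hD => ?_
  have hDN : nbhd D r ⊆ N := (nbhd_mono hD le_rfl).trans hN
  have hD' := (subset_nbhd D r).trans hDN
  simp only [← partialTrace_actOn _ hD', ← partialTrace_actOn _ (hD'.trans hB), actOn_lie,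
    actOn_restrict, partialTrace_lie_partialSum_partialSum hΦ hDN hB]

theorem partialSum_comm {Φ Ψ : FormalOp d} {r : ℕ} (hΦ : Φ ∈ rangeLE r) {D B : Finset ℤ}
    (hB : nbhd D r ⊆ B) :
    partialSum D (comm Φ Ψ) = partialTrace (B \ D) ⁅partialSum B Φ, partialSum B Ψ⁆ := by
  have hr : opRange Φ ≤ r := opRange_le_iff.2 hΦ
  have hlocal : opRange Φ < ⊤ := hr.trans_lt (ENat.natCast_lt_top r)
  have hr' : (opRange Φ).toNat ≤ r := ENat.toNat_le_of_le_natCast hr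
  rw [← actOn_restrict Φ, ← actOn_restrict Ψ, ← actOn_lie,
    partialTrace_actOn _ ((subset_nbhd D r).trans hB), partialSum_apply]
  refine Finset.sum_congr rfl fun A hA => ?_
  exact actOn_component_lie_restrict (mem_rangeLE_toNat hlocal) le_rfl
    ((nbhd_mono (Finset.mem_powerset.1 hA) hr').trans hB)

theorem partialSum_comm_comm {Φ Ψ Θ : FormalOp d} {r s : ℕ} (hΦ : Φ ∈ rangeLE r)
    (hΨ : Ψ ∈ rangeLE s) {D B : Finset ℤ} (hB : nbhd (nbhd D r) s ⊆ B) :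
    partialSum D (comm Φ (comm Ψ Θ))
      = partialTrace (B \ D) ⁅partialSum B Φ, ⁅partialSum B Ψ, partialSum B Θ⁆⁆ := by
  rw [partialSum_comm hΦ le_rfl, partialSum_comm hΨ hB,
    partialTrace_lie_partialSum hΦ le_rfl ((subset_nbhd _ s).trans hB)]

theorem comm_antisymm {Φ Ψ : FormalOp d} {r s : ℕ} (hΦ : Φ ∈ rangeLE r) (hΨ : Ψ ∈ rangeLE s) :
    comm Φ Ψ = -comm Ψ Φ := by
  refine ext_partialSum fun D => ?_
  rw [map_neg, partialSum_comm hΦ (nbhd_mono le_rfl (le_max_left r s)),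
    partialSum_comm hΨ (nbhd_mono le_rfl (le_max_right r s)), ← map_neg, lie_skew]

theorem comm_smul_right {Φ : FormalOp d} {r : ℕ} (hΦ : Φ ∈ rangeLE r) (c : ℂ) (Ψ : FormalOp d) :
    comm Φ (c • Ψ) = c • comm Φ Ψ := by
  refine ext_partialSum fun D => ?_
  rw [map_smul, partialSum_comm hΦ le_rfl, partialSum_comm hΦ le_rfl, map_smul, lie_smul, map_smul]

theorem comm_zero_right {Φ : FormalOp d} {r : ℕ} (hΦ : Φ ∈ rangeLE r) : comm Φ 0 = 0 := by
  simpa using comm_smul_right hΦ 0 0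

theorem comm_sub_right {Φ : FormalOp d} {r : ℕ} (hΦ : Φ ∈ rangeLE r) (Ψ Θ : FormalOp d) :
    comm Φ (Ψ - Θ) = comm Φ Ψ - comm Φ Θ := by
  refine ext_partialSum fun D => ?_
  simp only [map_sub, partialSum_comm hΦ le_rfl, lie_sub]

theorem comm_self {Φ : FormalOp d} {r : ℕ} (hΦ : Φ ∈ rangeLE r) : comm Φ Φ = 0 := by
  refine ext_partialSum fun D => ?_
  rw [partialSum_comm hΦ le_rfl, lie_self, map_zero, map_zero]

end Commutator

section Endpoints

variable {𝕜 ι κ : Type*} [Field 𝕜] [DecidableEq ι] [DecidableEq κ] [Fintype κ]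

/-- The projection onto the operators that are traceless at both sites `i` and `j`. -/
noncomputable def endsProj (i j : ι) : Module.End 𝕜 (Obs 𝕜 ι κ) :=
  (1 - siteTrace i) * (1 - siteTrace j)

theorem endsProj_apply (i j : ι) (X : Obs 𝕜 ι κ) :
    endsProj i j X = X - siteTrace j X - siteTrace i (X - siteTrace j X) := rfl

theorem endsProj_comm (i j : ι) (X : Obs 𝕜 ι κ) : endsProj i j X = endsProj j i X := by
  simp only [endsProj_apply, map_sub, siteTrace_comm i j]
  abel

theorem endsProj_of_siteTrace_eq_zero {i j : ι} {X : Obs 𝕜 ι κ} (hi : siteTrace i X = 0)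
    (hj : siteTrace j X = 0) : endsProj i j X = X := by
  rw [endsProj_apply, hj, sub_zero, hi, sub_zero]

theorem partialTrace_endsProj (S : Finset ι) (i j : ι) (X : Obs 𝕜 ι κ) :
    partialTrace S (endsProj i j X) = endsProj i j (partialTrace S X) := by
  simp only [endsProj_apply, map_sub, partialTrace_siteTrace]

theorem endsProj_mem_localAlgebra {S : Finset ι} {X : Obs 𝕜 ι κ} (hX : X ∈ localAlgebra S)
    (i j : ι) : endsProj i j X ∈ localAlgebra S := by
  have htrace : ∀ k {Y : Obs 𝕜 ι κ}, Y ∈ localAlgebra S → siteTrace k Y ∈ localAlgebra S :=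
    fun k _ hY => localAlgebra_mono (Finset.erase_subset k S) (siteTrace_mem_localAlgebra hY k)
  rw [endsProj_apply]
  exact sub_mem (sub_mem hX (htrace _ hX)) (htrace _ (sub_mem hX (htrace _ hX)))

theorem endsProj_lie {i p q : ι} {b Z : Obs 𝕜 ι κ} (hb : b ∈ localAlgebra {p, q})
    (hbq : siteTrace q b = 0) (hi : b ∈ trivialAt i) (hZ : Z ∈ trivialAt q) :
    endsProj i q ⁅b, Z⁆ = ⁅b, endsProj i p Z⁆ := by
  have hcomm : ∀ W ∈ trivialAt q, ⁅b, siteTrace p W⁆ = 0 := fun W hW =>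
    lie_eq_zero_of_mem_trivialAt hb fun k hk => by
      rcases Finset.mem_insert.1 hk with rfl | hk
      · exact siteTrace_mem_trivialAt_self _ _
      · rw [Finset.mem_singleton.1 hk]
        exact siteTrace_mem_trivialAt hW p
  have hq : siteTrace q ⁅b, Z⁆ = 0 := by rw [siteTrace_lie_right hZ, hbq, zero_lie]
  rw [endsProj_apply, endsProj_apply, hq, sub_zero, siteTrace_lie_left hi, map_sub,
    siteTrace_comm i p, lie_sub, lie_sub, lie_sub, hcomm Z hZ,
    hcomm _ (siteTrace_mem_trivialAt hZ i), sub_zero, sub_zero]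

variable [CharZero 𝕜] [Nonempty κ]

theorem endsProj_of_mem_trivialAt_right {i j : ι} {X : Obs 𝕜 ι κ} (h : X ∈ trivialAt j) :
    endsProj i j X = 0 := by
  rw [endsProj_apply, siteTrace_of_mem_trivialAt h, sub_self, map_zero, sub_zero]

theorem endsProj_of_mem_trivialAt_left {i j : ι} {X : Obs 𝕜 ι κ} (h : X ∈ trivialAt i) :
    endsProj i j X = 0 := by
  rw [endsProj_comm, endsProj_of_mem_trivialAt_right h]

theorem endsProj_of_mem_localAlgebra {i j : ι} {S : Finset ι} {X : Obs 𝕜 ι κ}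
    (hX : X ∈ localAlgebra S) (h : ¬ (i ∈ S ∧ j ∈ S)) : endsProj i j X = 0 := by
  rcases not_and_or.1 h with h | h
  · exact endsProj_of_mem_trivialAt_left (localAlgebra_le_trivialAt h hX)
  · exact endsProj_of_mem_trivialAt_right (localAlgebra_le_trivialAt h hX)

theorem siteTrace_endsProj_left (i j : ι) (X : Obs 𝕜 ι κ) : siteTrace i (endsProj i j X) = 0 := by
  rw [endsProj_apply, map_sub, siteTrace_siteTrace_self, sub_self]

theorem siteTrace_endsProj_right (i j : ι) (X : Obs 𝕜 ι κ) : siteTrace j (endsProj i j X) = 0 := by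
  rw [endsProj_comm, siteTrace_endsProj_left]

end Endpoints

section Extremal

variable {d : ℕ}

/-- The sum of the components of `Φ` whose extreme sites are `i` and `j`. -/
noncomputable def extremalPart (i j : ℤ) : FormalOp d →ₗ[ℂ] Obs ℂ ℤ (Fin d) :=
  endsProj i j ∘ₗ partialSum (Finset.Icc i j)

theorem extremalPart_apply (i j : ℤ) (Φ : FormalOp d) :
    extremalPart i j Φ = endsProj i j (partialSum (Finset.Icc i j) Φ) := rfl

variable [NeZero d]

theorem endsProj_summand (Φ : FormalOp d) (i j : ℤ) (A : Finset ℤ) :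
    endsProj i j (summand A Φ) = if i ∈ A ∧ j ∈ A then summand A Φ else 0 := by
  split_ifs with h
  · exact endsProj_of_siteTrace_eq_zero (siteTrace_summand Φ h.1) (siteTrace_summand Φ h.2)
  · exact endsProj_of_mem_localAlgebra (summand_mem_localAlgebra Φ A) h

theorem extremalPart_eq_sum (i j : ℤ) (Φ : FormalOp d) :
    extremalPart i j Φ
      = ∑ A ∈ (Finset.Icc i j).powerset, if i ∈ A ∧ j ∈ A then summand A Φ else 0 := by
  simp only [extremalPart_apply, partialSum_apply, map_sum, endsProj_summand]

theorem summand_eq_zero_of_extremalPart {Φ : FormalOp d} {i j : ℤ} (h : extremalPart i j Φ = 0)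
    {A : Finset ℤ} (hA : A ⊆ Finset.Icc i j) (hi : i ∈ A) (hj : j ∈ A) : summand A Φ = 0 := by
  have hA0 := eq_of_sum_powerset_eq (B := A) (g := 0)
    (f := fun A => if i ∈ A ∧ j ∈ A then summand A Φ else 0) fun C hC => by
      have htrace := congrArg (partialTrace (Finset.Icc i j \ C)) h
      rw [map_zero, extremalPart_eq_sum, partialTrace_sum_powerset,
        Finset.sdiff_sdiff_eq_self (hC.trans hA)] at htrace
      · exact htrace.trans Finset.sum_const_zero.symm
      · intro A _
        split_ifs
        exacts [summand_mem_localAlgebra Φ A, zero_mem _]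
      · intro A _ a ha
        split_ifs
        exacts [siteTrace_summand Φ ha, map_zero _]
  simpa [hi, hj] using hA0

theorem mem_rangeLE_of_extremalPart {Φ : FormalOp d} {n : ℕ}
    (h : ∀ i j : ℤ, i + n ≤ j → extremalPart i j Φ = 0) : Φ ∈ rangeLE n := by
  intro A hA a ha b hb
  by_contra hab
  have hne : A.Nonempty := ⟨a, ha⟩
  refine hA (summand_eq_zero_of_extremalPart (h (A.min' hne) (A.max' hne) ?_) (fun x hx => ?_)
    (A.min'_mem hne) (A.max'_mem hne))
  · have hmin := A.min'_le a ha
    have hmax := A.le_max' b hb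
    omega
  · exact Finset.mem_Icc.2 ⟨A.min'_le x hx, A.le_max' x hx⟩

theorem extremalPart_eq_zero {Φ : FormalOp d} {n : ℕ} (hΦ : Φ ∈ rangeLE n) {i j : ℤ}
    (h : i + n ≤ j) : extremalPart i j Φ = 0 := by
  rw [extremalPart_eq_sum]
  refine Finset.sum_eq_zero fun A _ => ?_
  split_ifs with hA
  · by_contra h0
    have hlt := hΦ A h0 i hA.1 j hA.2
    omega
  · rfl

theorem lie_summand_mem_localAlgebra (Φ Ψ : FormalOp d) (A C : Finset ℤ) :
    ⁅summand A Φ, summand C Ψ⁆ ∈ localAlgebra (A ∪ C) :=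
  lie_mem_subalgebra (localAlgebra_mono Finset.subset_union_left (summand_mem_localAlgebra Φ A))
    (localAlgebra_mono Finset.subset_union_right (summand_mem_localAlgebra Ψ C))

theorem comm_mem_rangeLE {Φ Ψ : FormalOp d} {r s n : ℕ} (hΦ : Φ ∈ rangeLE r) (hΨ : Ψ ∈ rangeLE s)
    (h : r + s ≤ n + 1) : comm Φ Ψ ∈ rangeLE n := by
  refine mem_rangeLE_of_extremalPart fun i j hij => ?_
  rw [extremalPart_apply, partialSum_comm hΦ le_rfl, ← partialTrace_endsProj, partialSum_apply,
    partialSum_apply, sum_lie_sum, map_sum, Finset.sum_eq_zero, map_zero]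
  intro A _
  rw [map_sum]
  refine Finset.sum_eq_zero fun C _ => ?_
  by_cases hA : summand A Φ = 0
  · rw [hA, zero_lie, map_zero]
  by_cases hC : summand C Ψ = 0
  · rw [hC, lie_zero, map_zero]
  by_cases hdisj : Disjoint A C
  · rw [lie_eq_zero_of_disjoint (summand_mem_localAlgebra _ _) (summand_mem_localAlgebra _ _) hdisj,
      map_zero]
  obtain ⟨c, hcA, hcC⟩ := Finset.not_disjoint_iff.1 hdisj
  refine endsProj_of_mem_localAlgebra (lie_summand_mem_localAlgebra Φ Ψ A C) ?_
  rintro ⟨hi, hj⟩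
  have hcr := hΦ A hA c hcA c hcA
  have hcs := hΨ C hC c hcC c hcC
  rcases Finset.mem_union.1 hi with hi | hi <;> rcases Finset.mem_union.1 hj with hj | hj
  · have := hΦ A hA i hi j hj
    omega
  · have := hΦ A hA i hi c hcA
    have := hΨ C hC c hcC j hj
    omega
  · have := hΦ A hA c hcA j hj
    have := hΨ C hC i hi c hcC
    omega
  · have := hΨ C hC i hi j hj
    omega

theorem comm_jacobi {Φ Ψ Θ : FormalOp d} {r s t : ℕ} (hΦ : Φ ∈ rangeLE r) (hΨ : Ψ ∈ rangeLE s)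
    (hΘ : Θ ∈ rangeLE t) :
    comm Φ (comm Ψ Θ) = comm (comm Φ Ψ) Θ + comm Ψ (comm Φ Θ) := by
  have hΦ' : Φ ∈ rangeLE (r + s + t) := rangeLE_mono (by omega) hΦ
  have hΨ' : Ψ ∈ rangeLE (r + s + t) := rangeLE_mono (by omega) hΨ
  have hΘ' : Θ ∈ rangeLE (r + s + t) := rangeLE_mono (by omega) hΘ
  rw [comm_antisymm (comm_mem_rangeLE hΦ' hΨ' (Nat.le_succ_of_le (Nat.le_succ _))) hΘ']
  refine ext_partialSum fun D => ?_
  rw [map_add, map_neg, partialSum_comm_comm hΦ' hΨ' le_rfl, partialSum_comm_comm hΘ' hΦ' le_rfl,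
    partialSum_comm_comm hΨ' hΦ' le_rfl, leibniz_lie, map_add, ← lie_skew, map_neg]

end Extremal

section Bonds

variable {d : ℕ}

/-- The two-site term of `H` on the sites `i, i + 1`. -/
noncomputable def bond (H : FormalOp d) (i : ℤ) : Obs ℂ ℤ (Fin d) := summand {i, i + 1} H

/-- The one-site term of `H` at `i`. -/
noncomputable def potential (H : FormalOp d) (i : ℤ) : Obs ℂ ℤ (Fin d) := summand {i} H

variable [NeZero d] (H : FormalOp d) {i j k : ℤ}

theorem bond_mem_localAlgebra (i : ℤ) : bond H i ∈ localAlgebra {i, i + 1} :=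
  summand_mem_localAlgebra _ _

theorem potential_mem_localAlgebra (i : ℤ) : potential H i ∈ localAlgebra {i} :=
  summand_mem_localAlgebra _ _

theorem siteTrace_bond_left (i : ℤ) : siteTrace i (bond H i) = 0 :=
  siteTrace_summand H (Finset.mem_insert_self _ _)

theorem siteTrace_bond_right (i : ℤ) : siteTrace (i + 1) (bond H i) = 0 :=
  siteTrace_summand H (Finset.mem_insert_of_mem (Finset.mem_singleton_self _))

theorem bond_mem_trivialAt (h : k < i ∨ i + 1 < k) : bond H i ∈ trivialAt k :=
  localAlgebra_le_trivialAt (by simp only [Finset.mem_insert, Finset.mem_singleton]; omega)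
    (bond_mem_localAlgebra H i)

theorem bond_lie_bond_eq_zero (h : i + 1 < j) : ⁅bond H i, bond H j⁆ = 0 :=
  lie_eq_zero_of_mem_trivialAt (bond_mem_localAlgebra H i) fun k hk => bond_mem_trivialAt H (by
    simp only [Finset.mem_insert, Finset.mem_singleton] at hk
    omega)

theorem potential_lie_bond_eq_zero (h : i < j ∨ j + 1 < i) : ⁅potential H i, bond H j⁆ = 0 :=
  lie_eq_zero_of_mem_trivialAt (potential_mem_localAlgebra H i) fun k hk =>
    bond_mem_trivialAt H (by rwa [Finset.mem_singleton.1 hk])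

variable {Z : Obs ℂ ℤ (Fin d)}

theorem bond_right_lie_endsProj (hij : i < j) (hZ : Z ∈ trivialAt (j + 1)) :
    ⁅bond H j, endsProj i j Z⁆ = endsProj i (j + 1) ⁅bond H j, Z⁆ :=
  (endsProj_lie (bond_mem_localAlgebra H j) (siteTrace_bond_right H j)
    (bond_mem_trivialAt H (.inl hij)) hZ).symm

theorem bond_left_lie_endsProj (hij : i + 1 < j) (hZ : Z ∈ trivialAt i) :
    ⁅bond H i, endsProj (i + 1) j Z⁆ = endsProj i j ⁅bond H i, Z⁆ := by
  rw [endsProj_comm, endsProj_comm i, endsProj_lie (Finset.pair_comm i (i + 1) ▸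
    bond_mem_localAlgebra H i) (siteTrace_bond_left H i) (bond_mem_trivialAt H (.inr hij)) hZ]

end Bonds

section RangeTwo

variable {d : ℕ} {Φ Ψ : FormalOp d} {i j : ℤ}

theorem partialSum_insert (hΦ : Φ ∈ rangeLE 2) {S : Finset ℤ} {a b : ℤ} (ha : a ∉ S) (hb : b ∈ S)
    (h : ∀ x ∈ S, x - a < 2 → a - x < 2 → x = b) :
    partialSum (insert a S) Φ = partialSum S Φ + (summand {a} Φ + summand {a, b} Φ) := by
  have hne : (∅ : Finset ℤ) ≠ {b} := (Finset.singleton_ne_empty b).symm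
  have hsub : ({∅, {b}} : Finset (Finset ℤ)) ⊆ S.powerset := by
    simp [Finset.insert_subset_iff, hb]
  rw [partialSum_apply, Finset.sum_powerset_insert ha, ← partialSum_apply,
    ← Finset.sum_subset hsub, Finset.sum_pair hne, insert_empty_eq]
  intro A hA hA'
  by_contra h0
  refine hA' ?_
  have hAb : A ⊆ {b} := fun x hx => Finset.mem_singleton.2 <|
    h x (Finset.mem_powerset.1 hA hx)
      (hΦ _ h0 a (Finset.mem_insert_self _ _) x (Finset.mem_insert_of_mem hx))
      (hΦ _ h0 x (Finset.mem_insert_of_mem hx) a (Finset.mem_insert_self _ _))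
  rwa [Finset.mem_insert, Finset.mem_singleton, ← Finset.subset_singleton_iff]

theorem partialSum_Icc_succ (hΦ : Φ ∈ rangeLE 2) (hij : i ≤ j) :
    partialSum (Finset.Icc i (j + 1)) Φ
      = partialSum (Finset.Icc i j) Φ + (potential Φ (j + 1) + bond Φ j) := by
  have hIcc : Finset.Icc i (j + 1) = insert (j + 1) (Finset.Icc i j) := by
    ext x
    simp only [Finset.mem_Icc, Finset.mem_insert]
    omega
  rw [hIcc, partialSum_insert hΦ (b := j), Finset.pair_comm, potential, bond]
  · simp only [Finset.mem_Icc]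
    omega
  · exact Finset.right_mem_Icc.2 hij
  · intro x hx
    rw [Finset.mem_Icc] at hx
    omega

theorem partialSum_Icc_pred (hΦ : Φ ∈ rangeLE 2) (hij : i < j) :
    partialSum (Finset.Icc i j) Φ
      = partialSum (Finset.Icc (i + 1) j) Φ + (potential Φ i + bond Φ i) := by
  have hIcc : Finset.Icc i j = insert i (Finset.Icc (i + 1) j) := by
    ext x
    simp only [Finset.mem_Icc, Finset.mem_insert]
    omega
  rw [hIcc, partialSum_insert hΦ (b := i + 1), potential, bond]
  · simp only [Finset.mem_Icc]
    omega
  · exact Finset.left_mem_Icc.2 hij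
  · intro x hx
    rw [Finset.mem_Icc] at hx
    omega

variable [NeZero d]

theorem endsProj_lie_of_mem_trivialAt_right (hΦ : Φ ∈ rangeLE 2) (hij : i < j)
    {X : Obs ℂ ℤ (Fin d)} (hX : X ∈ trivialAt (j + 1)) :
    endsProj i (j + 1) ⁅partialSum (Finset.Icc i (j + 1)) Φ, X⁆ = ⁅bond Φ j, endsProj i j X⁆ := by
  have hbulk : partialSum (Finset.Icc i j) Φ ∈ trivialAt (j + 1) :=
    localAlgebra_le_trivialAt (by simp) (partialSum_mem_localAlgebra Φ _)
  have hpot : ⁅potential Φ (j + 1), X⁆ = 0 :=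
    lie_eq_zero_of_mem_trivialAt (potential_mem_localAlgebra Φ _)
      fun k hk => by rwa [Finset.mem_singleton.1 hk]
  rw [partialSum_Icc_succ hΦ hij.le, add_lie, add_lie, map_add, hpot, zero_add,
    endsProj_of_mem_trivialAt_right (lie_mem_subalgebra hbulk hX), zero_add,
    bond_right_lie_endsProj Φ hij hX]

theorem endsProj_lie_of_mem_trivialAt_left (hΦ : Φ ∈ rangeLE 2) (hij : i + 1 < j)
    {X : Obs ℂ ℤ (Fin d)} (hX : X ∈ trivialAt i) :
    endsProj i j ⁅partialSum (Finset.Icc i j) Φ, X⁆ = ⁅bond Φ i, endsProj (i + 1) j X⁆ := by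
  have hbulk : partialSum (Finset.Icc (i + 1) j) Φ ∈ trivialAt i :=
    localAlgebra_le_trivialAt (by simp) (partialSum_mem_localAlgebra Φ _)
  have hpot : ⁅potential Φ i, X⁆ = 0 :=
    lie_eq_zero_of_mem_trivialAt (potential_mem_localAlgebra Φ _)
      fun k hk => by rwa [Finset.mem_singleton.1 hk]
  rw [partialSum_Icc_pred hΦ (by omega), add_lie, add_lie, map_add, hpot, zero_add,
    endsProj_of_mem_trivialAt_left (lie_mem_subalgebra hbulk hX), zero_add,
    bond_left_lie_endsProj Φ hij hX]

theorem endsProj_lie_partialSum (hΦ : Φ ∈ rangeLE 2) (hij : i < j) (X : Obs ℂ ℤ (Fin d)) :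
    endsProj i (j + 1) ⁅partialSum (Finset.Icc i (j + 1)) Φ, X⁆
      = ⁅bond Φ j, endsProj i j (siteTrace (j + 1) X)⁆
        + ⁅bond Φ i, endsProj (i + 1) (j + 1) (siteTrace i X)⁆
        + endsProj i (j + 1) ⁅partialSum (Finset.Icc i (j + 1)) Φ, endsProj i (j + 1) X⁆ := by
  have hsplit : X = siteTrace (j + 1) X + siteTrace i X - siteTrace i (siteTrace (j + 1) X)
      + endsProj i (j + 1) X := by
    rw [endsProj_apply, map_sub]
    abel
  have htrace := siteTrace_mem_trivialAt_self (j + 1) X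
  conv_lhs => rw [hsplit]
  rw [lie_add, lie_sub, lie_add, map_add, map_sub, map_add,
    endsProj_lie_of_mem_trivialAt_right hΦ hij htrace,
    endsProj_lie_of_mem_trivialAt_left hΦ (by omega) (siteTrace_mem_trivialAt_self i X),
    endsProj_lie_of_mem_trivialAt_left hΦ (by omega) (siteTrace_mem_trivialAt_self i _),
    endsProj_of_mem_trivialAt_right (siteTrace_mem_trivialAt htrace i), lie_zero, sub_zero]

theorem endsProj_partialTrace_summand_lie_eq_zero {k : ℕ} (hΦ : Φ ∈ rangeLE 2)
    (hΨ : Ψ ∈ rangeLE k) (hij : i < j) (hk : i + k ≤ j + 1) {B C C' : Finset ℤ} (hCB : C ⊆ B)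
    (hCD : ¬ C ⊆ Finset.Icc i j) :
    endsProj i j (partialTrace (B \ Finset.Icc i j) ⁅summand C Φ, summand C' Ψ⁆) = 0 := by
  obtain ⟨c, hcC, hcD⟩ := Finset.not_subset.1 hCD
  by_cases hcC' : c ∈ C'
  · by_cases h0 : summand C Φ = 0
    · rw [h0, zero_lie, map_zero, map_zero]
    by_cases h0' : summand C' Ψ = 0
    · rw [h0', lie_zero, map_zero, map_zero]
    rw [← partialTrace_endsProj,
      endsProj_of_mem_localAlgebra (lie_summand_mem_localAlgebra Φ Ψ C C'), map_zero]
    have hwidth : ∀ a ∈ C ∪ C', c - a < j + 1 - i ∧ a - c < j + 1 - i := by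
      intro a ha
      rcases Finset.mem_union.1 ha with ha | ha
      · have h1 := hΦ C h0 a ha c hcC
        have h2 := hΦ C h0 c hcC a ha
        omega
      · have h1 := hΨ C' h0' a ha c hcC'
        have h2 := hΨ C' h0' c hcC' a ha
        omega
    rintro ⟨hi, hj⟩
    have hci := hwidth i hi
    have hcj := hwidth j hj
    rw [Finset.mem_Icc] at hcD
    omega
  · rw [partialTrace_eq_zero (Finset.mem_sdiff.2 ⟨hCB hcC, hcD⟩), map_zero]
    rw [siteTrace_lie_right (localAlgebra_le_trivialAt hcC' (summand_mem_localAlgebra Ψ C')),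
      siteTrace_summand Φ hcC, zero_lie]

theorem extremalPart_comm {k : ℕ} (hΦ : Φ ∈ rangeLE 2) (hΨ : Ψ ∈ rangeLE k) (hij : i < j)
    (hk : i + k ≤ j + 1) :
    extremalPart i j (comm Φ Ψ)
      = endsProj i j ⁅partialSum (Finset.Icc i j) Φ, partialSum (Finset.Icc i j) Ψ⁆ := by
  set D := Finset.Icc i j
  set B := nbhd D 2
  have hDB : D ⊆ B := subset_nbhd D 2
  have hbulk : partialTrace (B \ D) ⁅partialSum D Φ, partialSum B Ψ⁆
      = ⁅partialSum D Φ, partialSum D Ψ⁆ := by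
    rw [partialTrace_lie_left (mem_trivialAt_of_disjoint (partialSum_mem_localAlgebra Φ D)
      Finset.sdiff_disjoint), partialTrace_partialSum, Finset.sdiff_sdiff_eq_self hDB]
  rw [extremalPart_apply, partialSum_comm hΦ le_rfl, partialSum_eq_add_sum_sdiff Φ hDB, add_lie,
    map_add, map_add, hbulk, partialSum_apply B, sum_lie_sum, map_sum, map_sum,
    Finset.sum_eq_zero, add_zero]
  intro C hC
  rw [Finset.mem_sdiff, Finset.mem_powerset, Finset.mem_powerset] at hC
  rw [map_sum, map_sum]
  exact Finset.sum_eq_zero fun C' _ =>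
    endsProj_partialTrace_summand_lie_eq_zero hΦ hΨ hij hk hC.1 hC.2

theorem extremalPart_comm_succ {k : ℕ} (hΦ : Φ ∈ rangeLE 2) (hΨ : Ψ ∈ rangeLE k) (hij : i < j)
    (hk : i + k ≤ j + 2) :
    extremalPart i (j + 1) (comm Φ Ψ)
      = ⁅bond Φ j, extremalPart i j Ψ⁆ + ⁅bond Φ i, extremalPart (i + 1) (j + 1) Ψ⁆
        + endsProj i (j + 1)
            ⁅partialSum (Finset.Icc i (j + 1)) Φ, extremalPart i (j + 1) Ψ⁆ := by
  have hright : (Finset.Icc i (j + 1)).erase (j + 1) = Finset.Icc i j := by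
    ext x
    simp only [Finset.mem_erase, Finset.mem_Icc]
    omega
  have hleft : (Finset.Icc i (j + 1)).erase i = Finset.Icc (i + 1) (j + 1) := by
    ext x
    simp only [Finset.mem_erase, Finset.mem_Icc]
    omega
  rw [extremalPart_comm hΦ hΨ (by omega) (by omega), endsProj_lie_partialSum hΦ hij,
    siteTrace_partialSum, siteTrace_partialSum, hright, hleft]
  simp only [extremalPart_apply]

theorem extremalPart_comm_succ_of_le {k : ℕ} (hΦ : Φ ∈ rangeLE 2) (hΨ : Ψ ∈ rangeLE k)
    (hij : i < j) (hk : i + k ≤ j + 1) :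
    extremalPart i (j + 1) (comm Φ Ψ)
      = ⁅bond Φ j, extremalPart i j Ψ⁆ + ⁅bond Φ i, extremalPart (i + 1) (j + 1) Ψ⁆ := by
  rw [extremalPart_comm_succ hΦ hΨ hij (by omega), extremalPart_eq_zero hΨ hk, lie_zero, map_zero,
    add_zero]

theorem extremalPart_succ (Φ : FormalOp d) (i : ℤ) : extremalPart i (i + 1) Φ = bond Φ i := by
  have hIcc : Finset.Icc i (i + 1) = {i, i + 1} := by
    ext x
    simp only [Finset.mem_Icc, Finset.mem_insert, Finset.mem_singleton]
    omega
  rw [extremalPart_eq_sum, hIcc, Finset.sum_eq_single {i, i + 1}]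
  · simp [bond]
  · intro A hA hne
    refine if_neg fun h => hne (Finset.Subset.antisymm (Finset.mem_powerset.1 hA) ?_)
    simp only [Finset.insert_subset_iff, Finset.singleton_subset_iff, h.1, h.2, and_self]
  · exact fun h => absurd (Finset.mem_powerset_self _) h

end RangeTwo

section PartialInverse

variable {𝕜 ι κ : Type*} [Field 𝕜] [DecidableEq ι] [DecidableEq κ]

theorem localAlgebra_empty : (localAlgebra ∅ : Subalgebra 𝕜 (Obs 𝕜 ι κ)) = ⊥ := by
  simp [localAlgebra]

variable [Fintype κ] {p q : ι} {Λ : Module.End 𝕜 (Obs 𝕜 ι κ)}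

/-- The extension of a linear map `Λ` from the operators on the sites `p, q` to all operators that
is linear over the operators acting trivially at `p` and `q`. -/
def extendLinear (p q : ι) (Λ : Module.End 𝕜 (Obs 𝕜 ι κ)) : Module.End 𝕜 (Obs 𝕜 ι κ) :=
  ∑ k, ∑ l, ∑ k', ∑ l', LinearMap.mulLeft 𝕜 (Λ (siteUnit p k l * siteUnit q k' l')) ∘ₗ
    siteCoeff p k l ∘ₗ siteCoeff q k' l'

theorem extendLinear_apply (p q : ι) (Λ : Module.End 𝕜 (Obs 𝕜 ι κ)) (Y : Obs 𝕜 ι κ) :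
    extendLinear p q Λ Y = ∑ k, ∑ l, ∑ k', ∑ l',
      Λ (siteUnit p k l * siteUnit q k' l') * siteCoeff p k l (siteCoeff q k' l' Y) := by
  simp [extendLinear, LinearMap.sum_apply]

theorem extendLinear_mul_right {W : Obs 𝕜 ι κ} (hp : W ∈ trivialAt p) (hq : W ∈ trivialAt q)
    (Y : Obs 𝕜 ι κ) : extendLinear p q Λ (Y * W) = extendLinear p q Λ Y * W := by
  simp only [extendLinear_apply, siteCoeff_mul_right hq, siteCoeff_mul_right hp, Finset.sum_mul,
    mul_assoc]

theorem extendLinear_mul_left (hΛ : ∀ X, Λ X ∈ localAlgebra {p}) {W : Obs 𝕜 ι κ}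
    (hp : W ∈ trivialAt p) (hq : W ∈ trivialAt q) (Y : Obs 𝕜 ι κ) :
    extendLinear p q Λ (W * Y) = W * extendLinear p q Λ Y := by
  have hcomm (X : Obs 𝕜 ι κ) : Commute (Λ X) W :=
    commute_of_mem_trivialAt (hΛ X) (by simpa using hp)
  simp only [extendLinear_apply, siteCoeff_mul_left hq, siteCoeff_mul_left hp, Finset.mul_sum,
    ← mul_assoc, (hcomm _).eq]

theorem extendLinear_lie (hΛ : ∀ X, Λ X ∈ localAlgebra {p}) {W : Obs 𝕜 ι κ}
    (hp : W ∈ trivialAt p) (hq : W ∈ trivialAt q) (Y : Obs 𝕜 ι κ) :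
    extendLinear p q Λ ⁅W, Y⁆ = ⁅W, extendLinear p q Λ Y⁆ := by
  simp only [LieRing.of_associative_ring_bracket, map_sub, extendLinear_mul_left hΛ hp hq,
    extendLinear_mul_right hp hq]

theorem siteTrace_extendLinear (hΛ : ∀ X, Λ X ∈ localAlgebra {p}) {r : ι} (hp : p ≠ r)
    (hq : q ≠ r) (Y : Obs 𝕜 ι κ) :
    siteTrace r (extendLinear p q Λ Y) = extendLinear p q Λ (siteTrace r Y) := by
  have hunitp (k l : κ) : (siteUnit r k l : Obs 𝕜 ι κ) ∈ trivialAt p :=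
    siteUnit_mem_trivialAt hp k l
  have hunitq (k l : κ) : (siteUnit r k l : Obs 𝕜 ι κ) ∈ trivialAt q :=
    siteUnit_mem_trivialAt hq k l
  simp only [siteTrace_apply, siteCoeff_apply, map_smul, map_sum,
    extendLinear_mul_right (hunitp _ _) (hunitq _ _),
    extendLinear_mul_left hΛ (hunitp _ _) (hunitq _ _)]

theorem siteTrace_extendLinear_eq_zero (hΛ : ∀ X, siteTrace p (Λ X) = 0) (Y : Obs 𝕜 ι κ) :
    siteTrace p (extendLinear p q Λ Y) = 0 := by
  simp only [extendLinear_apply, map_sum,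
    siteTrace_mul_right (siteCoeff_mem_trivialAt_self p _ _ _), hΛ, zero_mul, Finset.sum_const_zero]

theorem extendLinear_mem_localAlgebra (hpq : p ≠ q) (hΛ : ∀ X, Λ X ∈ localAlgebra {p})
    {S : Finset ι} (hp : p ∈ S) {Y : Obs 𝕜 ι κ} (hY : Y ∈ localAlgebra S) :
    extendLinear p q Λ Y ∈ localAlgebra (S.erase q) := by
  have hsub : {p} ⊆ S.erase q := by simpa using ⟨hpq, hp⟩
  rw [extendLinear_apply]
  exact sum_mem fun k _ => sum_mem fun l _ => sum_mem fun k' _ => sum_mem fun l' _ =>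
    mul_mem (localAlgebra_mono hsub (hΛ _)) (localAlgebra_mono (Finset.erase_subset _ _)
      (siteCoeff_mem_localAlgebra (siteCoeff_mem_localAlgebra hY q k' l') p k l))

theorem exists_siteCoeff_siteCoeff_eq {X : Obs 𝕜 ι κ} (hX : X ∈ localAlgebra {p, q})
    (k l k' l' : κ) :
    ∃ c : 𝕜, siteCoeff p k l (siteCoeff q k' l' X) = algebraMap 𝕜 (Obs 𝕜 ι κ) c := by
  have hmem := siteCoeff_mem_localAlgebra (siteCoeff_mem_localAlgebra hX q k' l') p k l
  have herase : (({p, q} : Finset ι).erase q).erase p = ∅ := by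
    grind
  rw [herase, localAlgebra_empty] at hmem
  obtain ⟨c, hc⟩ := Algebra.mem_bot.1 hmem
  exact ⟨c, hc.symm⟩

theorem extendLinear_of_mem (hpq : p ≠ q) {X : Obs 𝕜 ι κ} (hX : X ∈ localAlgebra {p, q}) :
    extendLinear p q Λ X = Λ X := by
  choose c hc using exists_siteCoeff_siteCoeff_eq hX
  have hterm (k l k' l' : κ) : c k l k' l' • (siteUnit p k l * siteUnit q k' l' : Obs 𝕜 ι κ)
      = siteUnit p k l * siteCoeff p k l (siteUnit q k' l' * siteCoeff q k' l' X) := by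
    rw [siteCoeff_mul_left (siteUnit_mem_trivialAt hpq _ _), hc, ← mul_assoc, ← Algebra.commutes,
      Algebra.smul_def]
  have hsum : X = ∑ k, ∑ l, ∑ k', ∑ l', c k l k' l' • (siteUnit p k l * siteUnit q k' l') := by
    simp only [hterm, ← Finset.mul_sum, ← map_sum, sum_siteUnit_mul_siteCoeff]
  conv_rhs => rw [hsum]
  simp only [extendLinear_apply, hc, map_sum, map_smul]
  simp only [Algebra.smul_def, Algebra.commutes]

theorem exists_leftInverse_lie {b : Obs 𝕜 ι κ}
    (hinj : ∀ a : Obs 𝕜 ι κ, a ∈ localAlgebra {p} → siteTrace p a = 0 → ⁅a, b⁆ = 0 → a = 0) :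
    ∃ Λ : Module.End 𝕜 (Obs 𝕜 ι κ), (∀ X, Λ X ∈ localAlgebra {p}) ∧ (∀ X, siteTrace p (Λ X) = 0) ∧
      ∀ a ∈ localAlgebra {p}, siteTrace p a = 0 → Λ ⁅a, b⁆ = a := by
  let V : Submodule 𝕜 (Obs 𝕜 ι κ) :=
    Subalgebra.toSubmodule (localAlgebra {p}) ⊓ LinearMap.ker (siteTrace p)
  let T : V →ₗ[𝕜] Obs 𝕜 ι κ :=
    { toFun a := ⁅(a : Obs 𝕜 ι κ), b⁆
      map_add' := fun x y => add_lie _ _ _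
      map_smul' := fun c x => smul_lie _ _ _ }
  have hT : LinearMap.ker T = ⊥ := by
    rw [LinearMap.ker_eq_bot']
    exact fun a h => Subtype.ext (hinj a a.2.1 a.2.2 h)
  obtain ⟨Λ, hΛ⟩ := T.exists_leftInverse_of_injective hT
  exact ⟨V.subtype ∘ₗ Λ, fun X => (Λ X).2.1, fun X => (Λ X).2.2, fun a ha ha' =>
    congrArg Subtype.val (LinearMap.congr_fun hΛ ⟨a, ha, ha'⟩)⟩

theorem sum_traceless_siteUnit_mul_siteCoeff {Z : Obs 𝕜 ι κ} (hZ : siteTrace p Z = 0) :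
    ∑ k, ∑ l, (siteUnit p k l - siteTrace p (siteUnit p k l)) * siteCoeff p k l Z = Z := by
  have htrace : ∑ k, ∑ l, siteTrace p (siteUnit p k l) * siteCoeff p k l Z = 0 := by
    rw [← hZ]
    conv_rhs => rw [← sum_siteUnit_mul_siteCoeff p Z]
    simp only [map_sum, siteTrace_mul_right (siteCoeff_mem_trivialAt_self p _ _ _)]
  simp only [sub_mul, Finset.sum_sub_distrib, sum_siteUnit_mul_siteCoeff, htrace, sub_zero]

variable [CharZero 𝕜] [Nonempty κ]

theorem extendLinear_lie_self (hpq : p ≠ q) {b : Obs 𝕜 ι κ} (hb : b ∈ localAlgebra {p, q})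
    (hΛb : ∀ a ∈ localAlgebra {p}, siteTrace p a = 0 → Λ ⁅a, b⁆ = a) {Z : Obs 𝕜 ι κ}
    (hq : Z ∈ trivialAt q) (hp : siteTrace p Z = 0) : extendLinear p q Λ ⁅Z, b⁆ = Z := by
  set e : κ → κ → Obs 𝕜 ι κ := fun k l => siteUnit p k l - siteTrace p (siteUnit p k l) with he
  have hunit (k l : κ) : (siteUnit p k l : Obs 𝕜 ι κ) ∈ localAlgebra {p} :=
    siteUnit_mem_localAlgebra (Finset.mem_singleton_self p) k l
  have hemem (k l : κ) : e k l ∈ localAlgebra {p} :=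
    sub_mem (hunit k l) (localAlgebra_mono (Finset.erase_subset _ _)
      (siteTrace_mem_localAlgebra (hunit k l) p))
  have hetrace (k l : κ) : siteTrace p (e k l) = 0 := by
    rw [he, map_sub, siteTrace_siteTrace_self, sub_self]
  have hcomm (k l : κ) : Commute (siteCoeff p k l Z) b :=
    (commute_of_mem_trivialAt hb fun i hi => by
      rcases Finset.mem_insert.1 hi with rfl | hi
      · exact siteCoeff_mem_trivialAt_self _ _ _ _
      · rw [Finset.mem_singleton.1 hi]
        exact siteCoeff_mem_trivialAt hq _ _ _).symm
  have hlie (k l : κ) : ⁅e k l * siteCoeff p k l Z, b⁆ = ⁅e k l, b⁆ * siteCoeff p k l Z := by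
    simp only [LieRing.of_associative_ring_bracket, sub_mul, mul_assoc, (hcomm k l).eq]
  conv_lhs => rw [← sum_traceless_siteUnit_mul_siteCoeff hp]
  conv_rhs => rw [← sum_traceless_siteUnit_mul_siteCoeff hp]
  simp only [sum_lie, map_sum]
  refine Finset.sum_congr rfl fun k _ => Finset.sum_congr rfl fun l _ => ?_
  rw [hlie, extendLinear_mul_right (siteCoeff_mem_trivialAt_self _ _ _ _)
    (siteCoeff_mem_trivialAt hq _ _ _), extendLinear_of_mem hpq, hΛb _ (hemem k l) (hetrace k l)]
  exact lie_mem_subalgebra (localAlgebra_mono (by simp) (hemem k l)) hb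

theorem eq_zero_of_lie_eq_zero (hpq : p ≠ q) {b : Obs 𝕜 ι κ} (hb : b ∈ localAlgebra {p, q})
    (hinj : ∀ a : Obs 𝕜 ι κ, a ∈ localAlgebra {p} → siteTrace p a = 0 → ⁅a, b⁆ = 0 → a = 0)
    {Z : Obs 𝕜 ι κ} (hq : Z ∈ trivialAt q) (hp : siteTrace p Z = 0) (h : ⁅Z, b⁆ = 0) : Z = 0 := by
  obtain ⟨Λ, -, -, hΛ⟩ := exists_leftInverse_lie hinj
  rw [← extendLinear_lie_self hpq hb hΛ hq hp, h, map_zero]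

end PartialInverse

section SpanningOps

variable {d : ℕ} {i j : ℤ} {Z : Obs ℂ ℤ (Fin d)}

/-- The operators on the interval from `i` to `j` that are traceless at both of its ends. -/
noncomputable def spanningOps (i j : ℤ) : Submodule ℂ (Obs ℂ ℤ (Fin d)) :=
  Subalgebra.toSubmodule (localAlgebra (Finset.Icc i j)) ⊓ LinearMap.ker (siteTrace i) ⊓
    LinearMap.ker (siteTrace j)

theorem mem_spanningOps : Z ∈ spanningOps i j ↔
    Z ∈ localAlgebra (Finset.Icc i j) ∧ siteTrace i Z = 0 ∧ siteTrace j Z = 0 := and_assoc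

theorem mem_trivialAt_of_mem_spanningOps {k : ℤ} (hZ : Z ∈ spanningOps i j) (h : k < i ∨ j < k) :
    Z ∈ trivialAt k :=
  localAlgebra_le_trivialAt (by rw [Finset.mem_Icc]; omega) (mem_spanningOps.1 hZ).1

/-- The families assigning to each `i` an operator on `i, …, i + n + 1` that is traceless at both
ends of this interval. -/
noncomputable def spanningFamilies (n : ℕ) : Submodule ℂ (ℤ → Obs ℂ ℤ (Fin d)) :=
  Submodule.pi Set.univ fun i => spanningOps i (i + n + 1)

theorem mem_spanningFamilies {n : ℕ} {ψ : ℤ → Obs ℂ ℤ (Fin d)} :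
    ψ ∈ spanningFamilies n ↔ ∀ i, ψ i ∈ spanningOps i (i + n + 1) := by
  simp [spanningFamilies, Submodule.mem_pi]

variable [NeZero d]

theorem endsProj_mem_spanningOps {X : Obs ℂ ℤ (Fin d)} (hX : X ∈ localAlgebra (Finset.Icc i j)) :
    endsProj i j X ∈ spanningOps i j :=
  mem_spanningOps.2 ⟨endsProj_mem_localAlgebra hX i j, siteTrace_endsProj_left i j X,
    siteTrace_endsProj_right i j X⟩

theorem extremalPart_mem_spanningOps (Φ : FormalOp d) (i j : ℤ) :
    extremalPart i j Φ ∈ spanningOps i j := by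
  rw [extremalPart_apply]
  exact endsProj_mem_spanningOps (partialSum_mem_localAlgebra Φ _)

theorem bond_mem_spanningOps (H : FormalOp d) (i : ℤ) : bond H i ∈ spanningOps i (i + 1) :=
  extremalPart_succ H i ▸ extremalPart_mem_spanningOps H i (i + 1)

variable {H : FormalOp d}

theorem lie_bond_mem_spanningOps (hZ : Z ∈ spanningOps i j) (hij : i < j) :
    ⁅Z, bond H j⁆ ∈ spanningOps i (j + 1) := by
  obtain ⟨hmem, hi, -⟩ := mem_spanningOps.1 hZ
  have hbond := (mem_spanningOps.1 (bond_mem_spanningOps H j)).1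
  refine mem_spanningOps.2 ⟨lie_mem_subalgebra (localAlgebra_mono ?_ hmem)
    (localAlgebra_mono ?_ hbond), ?_, ?_⟩
  · exact Finset.Icc_subset_Icc_right (by omega)
  · exact Finset.Icc_subset_Icc_left hij.le
  · rw [siteTrace_lie_right (bond_mem_trivialAt H (.inl hij)), hi, zero_lie]
  · rw [siteTrace_lie_left (mem_trivialAt_of_mem_spanningOps hZ (.inr (by omega))),
      siteTrace_bond_right, lie_zero]

theorem bond_lie_mem_spanningOps (hZ : Z ∈ spanningOps (i + 1) j) (hij : i + 1 < j) :
    ⁅bond H i, Z⁆ ∈ spanningOps i j := by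
  obtain ⟨hmem, -, hj⟩ := mem_spanningOps.1 hZ
  have hbond := (mem_spanningOps.1 (bond_mem_spanningOps H i)).1
  refine mem_spanningOps.2 ⟨lie_mem_subalgebra (localAlgebra_mono ?_ hbond)
    (localAlgebra_mono ?_ hmem), ?_, ?_⟩
  · exact Finset.Icc_subset_Icc_right hij.le
  · exact Finset.Icc_subset_Icc_left (by omega)
  · rw [siteTrace_lie_right (mem_trivialAt_of_mem_spanningOps hZ (.inl (by omega))),
      siteTrace_bond_left, zero_lie]
  · rw [siteTrace_lie_left (bond_mem_trivialAt H (.inr hij)), hj, lie_zero]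

variable {n : ℕ} {ψ θ : ℤ → Obs ℂ ℤ (Fin d)}

theorem lie_bond_mem_spanningFamilies (hψ : ψ ∈ spanningFamilies n) :
    (fun i => ⁅ψ i, bond H (i + n + 1)⁆) ∈ spanningFamilies (n + 1) := by
  rw [mem_spanningFamilies] at hψ ⊢
  intro i
  have h := lie_bond_mem_spanningOps (H := H) (hψ i) (by omega)
  rwa [show i + n + 1 + 1 = i + (n + 1 : ℕ) + 1 by push_cast; ring] at h

theorem bond_lie_mem_spanningFamilies (hψ : ψ ∈ spanningFamilies n) :
    (fun i => ⁅bond H i, ψ (i + 1)⁆) ∈ spanningFamilies (n + 1) := by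
  rw [mem_spanningFamilies] at hψ ⊢
  intro i
  have h := bond_lie_mem_spanningOps (H := H) (hψ (i + 1)) (by omega)
  rwa [show i + 1 + n + 1 = i + (n + 1 : ℕ) + 1 by push_cast; ring] at h

end SpanningOps

section Peeling

variable {d : ℕ}

/-- The nested commutators `⁅h i, ⁅h (i + 1), …, h (i + n)⁆⁆` of the bonds `h i` of `H`. -/
noncomputable def nest (H : FormalOp d) : ℕ → ℤ → Obs ℂ ℤ (Fin d)
  | 0, i => bond H i
  | n + 1, i => ⁅bond H i, nest H n (i + 1)⁆

theorem nest_succ (H : FormalOp d) (n : ℕ) (i : ℤ) :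
    nest H (n + 1) i = ⁅bond H i, nest H n (i + 1)⁆ := rfl

/-- No traceless one-site operator commutes with a bond that touches its site: condition (i) for
all bonds, in terms of operators on the whole chain. -/
def InjectiveBonds (H : FormalOp d) : Prop :=
  ∀ i, (∀ a : Obs ℂ ℤ (Fin d), a ∈ localAlgebra {i + 1} → siteTrace (i + 1) a = 0 →
      ⁅a, bond H i⁆ = 0 → a = 0) ∧
    ∀ a : Obs ℂ ℤ (Fin d), a ∈ localAlgebra {i} → siteTrace i a = 0 → ⁅a, bond H i⁆ = 0 → a = 0

variable [NeZero d] {H : FormalOp d}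

theorem InjectiveBonds.eq_zero_left (hH : InjectiveBonds H) {i : ℤ} {Z : Obs ℂ ℤ (Fin d)}
    (hi : Z ∈ trivialAt i) (htrace : siteTrace (i + 1) Z = 0) (h : ⁅bond H i, Z⁆ = 0) : Z = 0 :=
  eq_zero_of_lie_eq_zero (p := i + 1) (q := i) (by omega)
    (Finset.pair_comm i (i + 1) ▸ bond_mem_localAlgebra H i) (hH i).1 hi htrace
    (by rw [← lie_skew, h, neg_zero])

theorem InjectiveBonds.eq_zero_right (hH : InjectiveBonds H) {i : ℤ} {Z : Obs ℂ ℤ (Fin d)}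
    (hi : Z ∈ trivialAt (i + 1)) (htrace : siteTrace i Z = 0) (h : ⁅Z, bond H i⁆ = 0) : Z = 0 :=
  eq_zero_of_lie_eq_zero (p := i) (q := i + 1) (by omega) (bond_mem_localAlgebra H i) (hH i).2 hi
    htrace h

theorem InjectiveBonds.peel (hH : InjectiveBonds H) {i j : ℤ} (hij : i + 1 < j)
    {ψ θ : Obs ℂ ℤ (Fin d)} (hψ : ψ ∈ spanningOps i j) (hθ : θ ∈ spanningOps (i + 1) (j + 1))
    (h : ⁅bond H i, θ⁆ = ⁅ψ, bond H j⁆) :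
    ∃ ω ∈ spanningOps (i + 1) j, ψ = ⁅bond H i, ω⁆ ∧ θ = ⁅ω, bond H j⁆ := by
  obtain ⟨hθmem, hθi, -⟩ := mem_spanningOps.1 hθ
  obtain ⟨Λ, hΛ, hΛj, hΛb⟩ := exists_leftInverse_lie (p := j) (hH j).2
  set ω := extendLinear j (j + 1) Λ θ with hω
  have hωmem : ω ∈ spanningOps (i + 1) j := by
    refine mem_spanningOps.2 ⟨localAlgebra_mono ?_ (extendLinear_mem_localAlgebra (by omega) hΛ
      (Finset.mem_Icc.2 ⟨hij.le, by omega⟩) hθmem), ?_, siteTrace_extendLinear_eq_zero hΛj θ⟩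
    · intro x
      simp only [Finset.mem_erase, Finset.mem_Icc]
      omega
    · rw [siteTrace_extendLinear hΛ (by omega) (by omega), hθi, map_zero]
  have hψω : ψ = ⁅bond H i, ω⁆ := by
    rw [hω, ← extendLinear_lie hΛ (bond_mem_trivialAt H (by omega))
      (bond_mem_trivialAt H (by omega)), h, extendLinear_lie_self (by omega)
      (bond_mem_localAlgebra H j) hΛb (mem_trivialAt_of_mem_spanningOps hψ (.inr (by omega)))
      (mem_spanningOps.1 hψ).2.2]
  have hωj := lie_bond_mem_spanningOps (H := H) hωmem hij
  have hdiff := sub_mem hθ hωj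
  refine ⟨ω, hωmem, hψω, sub_eq_zero.1 <| hH.eq_zero_left (i := i)
    (mem_trivialAt_of_mem_spanningOps hdiff (.inl (by omega))) (mem_spanningOps.1 hdiff).2.1 ?_⟩
  rw [lie_sub, h, sub_eq_zero, leibniz_lie (bond H i), ← hψω, bond_lie_bond_eq_zero H hij,
    lie_zero, add_zero]

theorem InjectiveBonds.peel_family (hH : InjectiveBonds H) {n : ℕ} {ψ θ : ℤ → Obs ℂ ℤ (Fin d)}
    (hψ : ψ ∈ spanningFamilies (n + 1)) (hθ : θ ∈ spanningFamilies (n + 1))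
    (h : ∀ i, ⁅bond H i, θ (i + 1)⁆ = ⁅ψ i, bond H (i + n + 2)⁆) :
    ∃ ω ∈ spanningFamilies n, (∀ i, ψ i = ⁅bond H i, ω (i + 1)⁆) ∧
      ∀ i, θ i = ⁅ω i, bond H (i + n + 1)⁆ := by
  rw [mem_spanningFamilies] at hψ hθ
  have hpeel (i : ℤ) : ∃ ω ∈ spanningOps i (i + n + 1), ψ (i - 1) = ⁅bond H (i - 1), ω⁆ ∧
      θ i = ⁅ω, bond H (i + n + 1)⁆ := by
    have hψi := hψ (i - 1)
    have hθi := hθ i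
    have hi := h (i - 1)
    rw [show i - 1 + (n + 1 : ℕ) + 1 = i + n + 1 by push_cast; ring] at hψi
    rw [show i + (n + 1 : ℕ) + 1 = i + n + 1 + 1 by push_cast; ring] at hθi
    rw [show i - 1 + n + 2 = i + n + 1 by ring, sub_add_cancel] at hi
    simpa only [sub_add_cancel] using
      hH.peel (i := i - 1) (by omega) hψi (by rwa [sub_add_cancel]) hi
  choose ω hω hψω hθω using hpeel
  exact ⟨ω, mem_spanningFamilies.2 hω, fun i => by simpa using hψω (i + 1), hθω⟩

theorem nest_succ_right (H : FormalOp d) (n : ℕ) (i : ℤ) :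
    nest H (n + 1) i = ⁅nest H n i, bond H (i + n + 1)⁆ := by
  induction n generalizing i with
  | zero => simp [nest]
  | succ n ih =>
    rw [nest_succ, ih (i + 1), nest_succ, leibniz_lie, bond_lie_bond_eq_zero H (by omega),
      lie_zero, add_zero, show i + 1 + n + 1 = i + (n + 1 : ℕ) + 1 by push_cast; ring]

theorem bond_mem_spanningFamilies (H : FormalOp d) : bond H ∈ spanningFamilies 0 :=
  mem_spanningFamilies.2 fun i => by simpa using bond_mem_spanningOps H i

theorem nest_mem_spanningFamilies (H : FormalOp d) (n : ℕ) : nest H n ∈ spanningFamilies n := by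
  induction n with
  | zero => exact bond_mem_spanningFamilies H
  | succ n ih => exact bond_lie_mem_spanningFamilies ih

/-- Condition (ii) in terms of operators on the whole chain: a family of two-site operators whose
commutators with the bonds match is a multiple of the family of bonds. -/
def UniqueBonds (H : FormalOp d) : Prop :=
  ∀ ψ ∈ spanningFamilies 0, (∀ i, ⁅bond H i, ψ (i + 1)⁆ = ⁅ψ i, bond H (i + 1)⁆) →
    ∃ α : ℂ, ∀ i, ψ i = α • bond H i

theorem eq_smul_nest (hinj : InjectiveBonds H) (huniq : UniqueBonds H) {n : ℕ}
    {ψ : ℤ → Obs ℂ ℤ (Fin d)} (hψ : ψ ∈ spanningFamilies n)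
    (h : ∀ i, ⁅bond H i, ψ (i + 1)⁆ = ⁅ψ i, bond H (i + n + 1)⁆) :
    ∃ α : ℂ, ∀ i, ψ i = α • nest H n i := by
  induction n generalizing ψ with
  | zero => exact huniq ψ hψ (by simpa using h)
  | succ n ih =>
    obtain ⟨ω, hω, hψl, hψr⟩ := hinj.peel_family hψ hψ fun i => by
      rw [h i, show i + (n + 1 : ℕ) + 1 = i + n + 2 by push_cast; ring]
    obtain ⟨α, hα⟩ := ih hω fun i => by rw [← hψl, ← hψr]
    exact ⟨α, fun i => by rw [hψl, hα, lie_smul, nest_succ]⟩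

end Peeling

section LieIdentities

variable {L : Type*} [LieRing L]

theorem lie_lie_right_of_lie_eq_zero {x z : L} (h : ⁅x, z⁆ = 0) (y : L) :
    ⁅x, ⁅y, z⁆⁆ = ⁅⁅x, y⁆, z⁆ := by
  rw [leibniz_lie, h, lie_zero, add_zero]

theorem lie_lie_left_of_lie_eq_zero {x y : L} (h : ⁅x, y⁆ = 0) (z : L) :
    ⁅x, ⁅y, z⁆⁆ = ⁅y, ⁅x, z⁆⁆ := by
  rw [leibniz_lie, h, zero_lie, zero_add]

theorem add_add_lie_lie_lie {M a b l r c : L} (har : ⁅a, r⁆ = 0) (hbl : ⁅b, l⁆ = 0)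
    (hlr : ⁅l, r⁆ = 0) (hM : ⁅⁅M, l⁆, r⁆ = 0) :
    ⁅M + a + b, ⁅l, ⁅c, r⁆⁆⁆
      = ⁅⁅M + a, ⁅l, c⁆⁆, r⁆ + ⁅l, ⁅M + b, ⁅c, r⁆⁆⁆ - ⁅l, ⁅⁅M, c⁆, r⁆⁆ := by
  have ha : ⁅a, ⁅l, ⁅c, r⁆⁆⁆ = ⁅⁅a, ⁅l, c⁆⁆, r⁆ := by
    rw [lie_lie_right_of_lie_eq_zero hlr, lie_lie_right_of_lie_eq_zero har]
  have hb : ⁅b, ⁅l, ⁅c, r⁆⁆⁆ = ⁅l, ⁅b, ⁅c, r⁆⁆⁆ := lie_lie_left_of_lie_eq_zero hbl _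
  have hMlcr : ⁅M, ⁅l, ⁅c, r⁆⁆⁆ = ⁅⁅⁅M, l⁆, c⁆, r⁆ + ⁅l, ⁅M, ⁅c, r⁆⁆⁆ := by
    rw [leibniz_lie, lie_lie_right_of_lie_eq_zero hM]
  have hMlc : ⁅⁅M, ⁅l, c⁆⁆, r⁆ = ⁅⁅⁅M, l⁆, c⁆, r⁆ + ⁅l, ⁅⁅M, c⁆, r⁆⁆ := by
    rw [leibniz_lie M l c, add_lie, ← lie_lie_right_of_lie_eq_zero hlr]
  rw [add_lie, add_lie, add_lie M a, add_lie, hMlc, add_lie M b, lie_add, ha, hb, hMlcr]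
  abel

/-- The potential of the next-to-leading equation on four sites: for bonds `x`, `y` on adjacent
pairs of sites and one-site terms `u`, `v`, `w` on these three sites, the element whose commutators
with the neighbouring bonds appear in `two_nsmul_lie_three_bonds`. -/
def threeSitePotential (x y u v w : L) : L :=
  ⁅x, ⁅x, y⁆⁆ + 2 • ⁅y, ⁅x, y⁆⁆ + ⁅⁅u + v, x⁆, y⁆ + 2 • ⁅x, ⁅v + w, y⁆⁆

theorem two_nsmul_lie_three_bonds {x₁ x₂ x₃ v₁ v₂ v₃ v₄ : L} (h13 : ⁅x₁, x₃⁆ = 0)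
    (h12' : ⁅v₁, x₂⁆ = 0) (h13' : ⁅v₁, x₃⁆ = 0) (h23' : ⁅v₂, x₃⁆ = 0) (h31' : ⁅v₃, x₁⁆ = 0)
    (h41' : ⁅v₄, x₁⁆ = 0) (h42' : ⁅v₄, x₂⁆ = 0) :
    2 • ⁅x₁ + x₂ + x₃ + v₁ + v₂ + v₃ + v₄, ⁅x₁, ⁅x₂, x₃⁆⁆⁆
      = 3 • ⁅⁅x₁ + x₂ + v₁ + v₂ + v₃, ⁅x₁, x₂⁆⁆, x₃⁆
        + (⁅x₁, threeSitePotential x₂ x₃ v₂ v₃ v₄⁆ - ⁅threeSitePotential x₁ x₂ v₁ v₂ v₃, x₃⁆) := by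
  have hassoc : ∀ y, ⁅x₁, ⁅y, x₃⁆⁆ = ⁅⁅x₁, y⁆, x₃⁆ := lie_lie_right_of_lie_eq_zero h13
  have hx₃ : ⁅x₁, ⁅x₃, ⁅x₂, x₃⁆⁆⁆ = ⁅x₃, ⁅⁅x₁, x₂⁆, x₃⁆⁆ := by
    rw [lie_lie_left_of_lie_eq_zero h13, hassoc]
  have hx₂ : ⁅x₁, ⁅x₂, ⁅x₂, x₃⁆⁆⁆ = ⁅⁅x₁, x₂⁆, ⁅x₂, x₃⁆⁆ + ⁅x₂, ⁅⁅x₁, x₂⁆, x₃⁆⁆ := by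
    rw [leibniz_lie, hassoc]
  have hx₂' : ⁅⁅x₂, ⁅x₁, x₂⁆⁆, x₃⁆ = ⁅x₂, ⁅⁅x₁, x₂⁆, x₃⁆⁆ - ⁅⁅x₁, x₂⁆, ⁅x₂, x₃⁆⁆ :=
    lie_lie _ _ _
  have hv₁ : ⁅v₁, ⁅x₁, x₂⁆⁆ = ⁅⁅v₁, x₁⁆, x₂⁆ := lie_lie_right_of_lie_eq_zero h12' _
  have hv₁' : ⁅v₁, ⁅⁅x₁, x₂⁆, x₃⁆⁆ = ⁅⁅⁅v₁, x₁⁆, x₂⁆, x₃⁆ := by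
    rw [lie_lie_right_of_lie_eq_zero h13', hv₁]
  have hv₂ : ⁅v₂, ⁅x₁, x₂⁆⁆ = ⁅⁅v₂, x₁⁆, x₂⁆ + ⁅x₁, ⁅v₂, x₂⁆⁆ := leibniz_lie _ _ _
  have hv₂' : ⁅v₂, ⁅⁅x₁, x₂⁆, x₃⁆⁆ = ⁅⁅⁅v₂, x₁⁆, x₂⁆, x₃⁆ + ⁅⁅x₁, ⁅v₂, x₂⁆⁆, x₃⁆ := by
    rw [lie_lie_right_of_lie_eq_zero h23', hv₂, add_lie]
  have hv₃ : ⁅v₃, ⁅x₁, x₂⁆⁆ = ⁅x₁, ⁅v₃, x₂⁆⁆ := lie_lie_left_of_lie_eq_zero h31' _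
  have hv₃' : ⁅v₃, ⁅⁅x₁, x₂⁆, x₃⁆⁆ = ⁅⁅x₁, ⁅v₃, x₂⁆⁆, x₃⁆ + ⁅x₁, ⁅x₂, ⁅v₃, x₃⁆⁆⁆ := by
    rw [← hassoc, lie_lie_left_of_lie_eq_zero h31', leibniz_lie v₃, lie_add, hassoc]
  have hv₄ : ⁅v₄, ⁅⁅x₁, x₂⁆, x₃⁆⁆ = ⁅x₁, ⁅x₂, ⁅v₄, x₃⁆⁆⁆ := by
    rw [← hassoc, lie_lie_left_of_lie_eq_zero h41', lie_lie_left_of_lie_eq_zero h42']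
  simp only [threeSitePotential, add_lie, lie_add, lie_nsmul, nsmul_lie, hassoc, hv₁, hv₁', hv₂,
    hv₂', hv₃, hv₃', hv₄, hx₂, hx₂', hx₃, smul_add, smul_sub]
  abel

end LieIdentities

section NextToLeading

variable {d : ℕ}

/-- For a family `χ` of operators on `i, …, i + n + 1`, the part of the commutator of the bonds with
`∑ i, χ i` that reaches from `i` to `i + n + 2`. -/
noncomputable def bondLie (H : FormalOp d) (n : ℕ) :
    (ℤ → Obs ℂ ℤ (Fin d)) →ₗ[ℂ] (ℤ → Obs ℂ ℤ (Fin d)) where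
  toFun χ i := ⁅bond H i, χ (i + 1)⁆ - ⁅χ i, bond H (i + n + 1)⁆
  map_add' χ χ' := by
    ext1 i
    simp only [Pi.add_apply, lie_add, add_lie]
    abel
  map_smul' c χ := by
    ext1 i
    simp only [Pi.smul_apply, lie_smul, smul_lie, smul_sub, RingHom.id_apply]

theorem bondLie_apply (H : FormalOp d) (n : ℕ) (χ : ℤ → Obs ℂ ℤ (Fin d)) (i : ℤ) :
    bondLie H n χ i = ⁅bond H i, χ (i + 1)⁆ - ⁅χ i, bond H (i + n + 1)⁆ := rfl

/-- The part of the commutator of `H` with the nested commutator `nest H n i` that lives on the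
same interval and is traceless at its ends: the source term of the next-to-leading equation. -/
noncomputable def nestSource (H : FormalOp d) (n : ℕ) (i : ℤ) : Obs ℂ ℤ (Fin d) :=
  endsProj i (i + n + 1) ⁅partialSum (Finset.Icc i (i + n + 1)) H, nest H n i⁆

variable [NeZero d] {H : FormalOp d} {i j : ℤ}

theorem nestSource_mem_spanningFamilies (H : FormalOp d) (n : ℕ) :
    nestSource H n ∈ spanningFamilies n :=
  mem_spanningFamilies.2 fun i => endsProj_mem_spanningOps <|
    lie_mem_subalgebra (partialSum_mem_localAlgebra H _)
      (mem_spanningOps.1 (mem_spanningFamilies.1 (nest_mem_spanningFamilies H n) i)).1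

theorem endsProj_lie_bond_right {Z : Obs ℂ ℤ (Fin d)} (H : FormalOp d) (hij : i < j)
    (hZ : Z ∈ trivialAt (j + 1)) :
    ⁅endsProj i j Z, bond H j⁆ = endsProj i (j + 1) ⁅Z, bond H j⁆ := by
  rw [← lie_skew, ← lie_skew Z, map_neg, bond_right_lie_endsProj H hij hZ]

theorem lie_lie_partialSum_bond_bond_eq_zero (hH : H ∈ rangeLE 2) (hij : i + 2 < j) :
    ⁅⁅partialSum (Finset.Icc (i + 1) j) H, bond H i⁆, bond H j⁆ = 0 := by
  have hfar : ⁅partialSum (Finset.Icc (i + 1 + 1) j) H, bond H i⁆ = 0 :=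
    lie_eq_zero_of_mem_trivialAt (partialSum_mem_localAlgebra H _) fun k hk =>
      bond_mem_trivialAt H (.inr (by rw [Finset.mem_Icc] at hk; omega))
  have hlr : ⁅bond H i, bond H j⁆ = 0 := bond_lie_bond_eq_zero H (by omega)
  rw [partialSum_Icc_pred hH (by omega), add_lie, hfar, zero_add, lie_lie, hlr, lie_zero, zero_sub,
    add_lie, potential_lie_bond_eq_zero H (.inl (by omega)), bond_lie_bond_eq_zero H (by omega),
    add_zero, lie_zero, neg_zero]

theorem endsProj_lie_partialSum_lie_lie (hH : H ∈ rangeLE 2) (hij : i + 2 < j)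
    {c : Obs ℂ ℤ (Fin d)} (hc : c ∈ localAlgebra (Finset.Icc (i + 1) j)) :
    endsProj i (j + 1) ⁅partialSum (Finset.Icc i (j + 1)) H, ⁅bond H i, ⁅c, bond H j⁆⁆⁆
      = ⁅endsProj i j ⁅partialSum (Finset.Icc i j) H, ⁅bond H i, c⁆⁆, bond H j⁆
        + ⁅bond H i,
            endsProj (i + 1) (j + 1) ⁅partialSum (Finset.Icc (i + 1) (j + 1)) H, ⁅c, bond H j⁆⁆⁆
        - ⁅bond H i, ⁅endsProj (i + 1) j ⁅partialSum (Finset.Icc (i + 1) j) H, c⁆, bond H j⁆⁆ := by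
  have htrivial {a b k : ℤ} (hk : k ∉ Finset.Icc a b) :
      partialSum (Finset.Icc a b) H ∈ trivialAt k :=
    localAlgebra_le_trivialAt hk (partialSum_mem_localAlgebra H _)
  have hci : c ∈ trivialAt i := localAlgebra_le_trivialAt (by simp) hc
  have hcj : c ∈ trivialAt (j + 1) := localAlgebra_le_trivialAt (by simp) hc
  have hbi : bond H i ∈ trivialAt (j + 1) := bond_mem_trivialAt H (.inr (by omega))
  have hbj : bond H j ∈ trivialAt i := bond_mem_trivialAt H (.inl (by omega))
  have hlr : ⁅bond H i, bond H j⁆ = 0 := bond_lie_bond_eq_zero H (by omega)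
  have hrl : ⁅bond H j, bond H i⁆ = 0 := by rw [← lie_skew, hlr, neg_zero]
  have hbulk : ⁅partialSum (Finset.Icc (i + 1) j) H, c⁆ ∈ trivialAt (j + 1) :=
    lie_mem_subalgebra (htrivial (by simp)) hcj
  have hleft : ⁅partialSum (Finset.Icc i j) H, ⁅bond H i, c⁆⁆ ∈ trivialAt (j + 1) :=
    lie_mem_subalgebra (htrivial (by simp)) (lie_mem_subalgebra hbi hcj)
  have hright : ⁅partialSum (Finset.Icc (i + 1) (j + 1)) H, ⁅c, bond H j⁆⁆ ∈ trivialAt i :=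
    lie_mem_subalgebra (htrivial (by simp)) (lie_mem_subalgebra hci hbj)
  have hbulk' : ⁅⁅partialSum (Finset.Icc (i + 1) j) H, c⁆, bond H j⁆ ∈ trivialAt i :=
    lie_mem_subalgebra (lie_mem_subalgebra (htrivial (by simp)) hci) hbj
  have har : ⁅potential H i + bond H i, bond H j⁆ = 0 := by
    rw [add_lie, potential_lie_bond_eq_zero H (.inl (by omega)), hlr, add_zero]
  have hbl : ⁅potential H (j + 1) + bond H j, bond H i⁆ = 0 := by
    rw [add_lie, potential_lie_bond_eq_zero H (.inr (by omega)), hrl, add_zero]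
  rw [endsProj_lie_bond_right H (by omega) hleft, endsProj_lie_bond_right H (by omega) hbulk,
    bond_left_lie_endsProj H (by omega) hright, bond_left_lie_endsProj H (by omega) hbulk',
    ← map_add, ← map_sub, partialSum_Icc_succ hH (show i ≤ j by omega),
    partialSum_Icc_pred hH (show i < j by omega), partialSum_Icc_succ hH (show i + 1 ≤ j by omega),
    add_add_lie_lie_lie har hbl hlr (lie_lie_partialSum_bond_bond_eq_zero hH hij)]

theorem nestSource_add_three (hH : H ∈ rangeLE 2) (n : ℕ) (i : ℤ) :
    nestSource H (n + 3) i
      = ⁅nestSource H (n + 2) i, bond H (i + n + 3)⁆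
        + ⁅bond H i, nestSource H (n + 2) (i + 1)⁆
        - ⁅bond H i, ⁅nestSource H (n + 1) (i + 1), bond H (i + n + 3)⁆⁆ := by
  have hend : i + (n + 3 : ℕ) + 1 = i + n + 3 + 1 := by push_cast; ring
  have hend_left : i + (n + 2 : ℕ) + 1 = i + n + 3 := by push_cast; ring
  have hend_right : i + 1 + (n + 2 : ℕ) + 1 = i + n + 3 + 1 := by push_cast; ring
  have hend_bulk : i + 1 + (n + 1 : ℕ) + 1 = i + n + 3 := by push_cast; ring
  have hc := (mem_spanningOps.1
    (mem_spanningFamilies.1 (nest_mem_spanningFamilies H (n + 1)) (i + 1))).1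
  rw [hend_bulk] at hc
  have hright : nest H (n + 2) (i + 1) = ⁅nest H (n + 1) (i + 1), bond H (i + n + 3)⁆ := by
    rw [nest_succ_right, hend_bulk]
  simp only [nestSource, hend, hend_left, hend_right, hend_bulk]
  rw [nest_succ H (n + 2), hright, endsProj_lie_partialSum_lie_lie hH (by omega) hc,
    ← nest_succ H (n + 1)]

end NextToLeading

section Descent

variable {d : ℕ}

/-- The three-site operators that reduce the next-to-leading equation on four sites to the one on
three sites. -/
noncomputable def threeSiteFamily (H : FormalOp d) (i : ℤ) : Obs ℂ ℤ (Fin d) :=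
  threeSitePotential (bond H i) (bond H (i + 1)) (potential H i) (potential H (i + 1))
    (potential H (i + 2))

theorem partialSum_Icc_self (H : FormalOp d) (i : ℤ) :
    partialSum (Finset.Icc i i) H = summand ∅ H + potential H i := by
  rw [Finset.Icc_self, partialSum_apply, show ({i} : Finset ℤ).powerset = {∅, {i}} from rfl,
    Finset.sum_pair (Finset.singleton_ne_empty i).symm, potential]

variable [NeZero d] {H : FormalOp d}

theorem threeSiteFamily_mem_localAlgebra (H : FormalOp d) (i : ℤ) :
    threeSiteFamily H i ∈ localAlgebra (Finset.Icc i (i + 2)) := by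
  have hbond {k : ℤ} (hk : i ≤ k) (hk' : k + 1 ≤ i + 2) :
      bond H k ∈ localAlgebra (Finset.Icc i (i + 2)) :=
    localAlgebra_mono (Finset.Icc_subset_Icc hk hk')
      (mem_spanningOps.1 (bond_mem_spanningOps H k)).1
  have hpot {k : ℤ} (hk : i ≤ k) (hk' : k ≤ i + 2) :
      potential H k ∈ localAlgebra (Finset.Icc i (i + 2)) :=
    localAlgebra_mono (by simp [hk, hk']) (potential_mem_localAlgebra H k)
  have hx := hbond le_rfl (by omega)
  have hy := hbond (k := i + 1) (by omega) (by omega)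
  have hxy := lie_mem_subalgebra hx hy
  have huv := add_mem (hpot le_rfl (by omega)) (hpot (k := i + 1) (by omega) (by omega))
  have hvw := add_mem (hpot (k := i + 1) (by omega) (by omega)) (hpot (by omega) le_rfl)
  exact add_mem (add_mem (add_mem (lie_mem_subalgebra hx hxy)
    (nsmul_mem (lie_mem_subalgebra hy hxy) 2)) (lie_mem_subalgebra (lie_mem_subalgebra huv hx) hy))
    (nsmul_mem (lie_mem_subalgebra hx (lie_mem_subalgebra hvw hy)) 2)

theorem summand_empty_lie (H : FormalOp d) (X : Obs ℂ ℤ (Fin d)) : ⁅summand ∅ H, X⁆ = 0 :=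
  lie_eq_zero_of_mem_trivialAt (summand_mem_localAlgebra H ∅) (by simp)

theorem partialSum_Icc_three_lie (hH : H ∈ rangeLE 2) (i : ℤ) (X : Obs ℂ ℤ (Fin d)) :
    ⁅partialSum (Finset.Icc i (i + 2)) H, X⁆
      = ⁅bond H i + bond H (i + 1) + potential H i + potential H (i + 1) + potential H (i + 2),
          X⁆ := by
  rw [show i + 2 = i + 1 + 1 by ring, partialSum_Icc_succ hH (by omega),
    partialSum_Icc_succ hH le_rfl, partialSum_Icc_self]
  simp only [add_lie, summand_empty_lie]
  abel

theorem partialSum_Icc_four_lie (hH : H ∈ rangeLE 2) (i : ℤ) (X : Obs ℂ ℤ (Fin d)) :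
    ⁅partialSum (Finset.Icc i (i + 2 + 1)) H, X⁆
      = ⁅bond H i + bond H (i + 1) + bond H (i + 2) + potential H i + potential H (i + 1)
          + potential H (i + 2) + potential H (i + 2 + 1), X⁆ := by
  rw [partialSum_Icc_succ hH (by omega), add_lie, partialSum_Icc_three_lie hH]
  simp only [add_lie]
  abel

theorem nestSource_one_lie_bond (hH : H ∈ rangeLE 2) (i : ℤ) :
    ⁅nestSource H 1 i, bond H (i + 2)⁆ = endsProj i (i + 2 + 1)
      ⁅⁅bond H i + bond H (i + 1) + potential H i + potential H (i + 1) + potential H (i + 2),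
        ⁅bond H i, bond H (i + 1)⁆⁆, bond H (i + 2)⁆ := by
  have hnest := (mem_spanningOps.1
    (mem_spanningFamilies.1 (nest_mem_spanningFamilies H 1) i)).1
  rw [show i + (1 : ℕ) + 1 = i + 2 by push_cast; ring] at hnest
  have hlie := localAlgebra_le_trivialAt (i := i + 2 + 1) (by simp)
    (lie_mem_subalgebra (partialSum_mem_localAlgebra H (Finset.Icc i (i + 2))) hnest)
  rw [nestSource, show i + (1 : ℕ) + 1 = i + 2 by push_cast; ring,
    endsProj_lie_bond_right H (by omega) hlie, partialSum_Icc_three_lie hH, nest_succ]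
  rfl

theorem nestSource_two (hH : H ∈ rangeLE 2) (i : ℤ) :
    nestSource H 2 i = endsProj i (i + 2 + 1)
      ⁅bond H i + bond H (i + 1) + bond H (i + 2) + potential H i + potential H (i + 1)
        + potential H (i + 2) + potential H (i + 2 + 1),
        ⁅bond H i, ⁅bond H (i + 1), bond H (i + 2)⁆⁆⁆ := by
  rw [nestSource, show i + (2 : ℕ) + 1 = i + 2 + 1 by push_cast; ring,
    partialSum_Icc_four_lie hH, nest_succ, nest_succ, show i + 1 + 1 = i + 2 by ring]
  rfl

theorem bondLie_one_endsProj {K : ℤ → Obs ℂ ℤ (Fin d)} (H : FormalOp d)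
    (hK : ∀ i, K i ∈ localAlgebra (Finset.Icc i (i + 2))) (i : ℤ) :
    bondLie H 1 (fun i => endsProj i (i + 2) (K i)) i
      = endsProj i (i + 2 + 1) (⁅bond H i, K (i + 1)⁆ - ⁅K i, bond H (i + 2)⁆) := by
  rw [bondLie_apply, show i + (1 : ℕ) + 1 = i + 2 by push_cast; ring,
    show i + 1 + 2 = i + 2 + 1 by ring,
    bond_left_lie_endsProj H (by omega) (localAlgebra_le_trivialAt (by simp) (hK (i + 1))),
    endsProj_lie_bond_right H (by omega) (localAlgebra_le_trivialAt (by simp) (hK i)), map_sub]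

theorem exists_nestSource_two (hH : H ∈ rangeLE 2) :
    ∃ κ ∈ spanningFamilies 1, ∀ i,
      2 • nestSource H 2 i = 3 • ⁅nestSource H 1 i, bond H (i + 2)⁆ + bondLie H 1 κ i := by
  refine ⟨fun i => endsProj i (i + 2) (threeSiteFamily H i), mem_spanningFamilies.2 fun i => ?_,
    fun i => ?_⟩
  · rw [show i + (1 : ℕ) + 1 = i + 2 by push_cast; ring]
    exact endsProj_mem_spanningOps (threeSiteFamily_mem_localAlgebra H i)
  · have hpot {k l : ℤ} (h : k < l ∨ l + 1 < k) := potential_lie_bond_eq_zero H h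
    rw [nestSource_two hH, nestSource_one_lie_bond hH,
      bondLie_one_endsProj H (threeSiteFamily_mem_localAlgebra H), ← map_nsmul, ← map_nsmul,
      ← map_add, two_nsmul_lie_three_bonds (bond_lie_bond_eq_zero H (by omega)) (hpot (by omega))
        (hpot (by omega)) (hpot (by omega)) (hpot (by omega)) (hpot (by omega)) (hpot (by omega))]
    simp only [threeSiteFamily, show i + 1 + 1 = i + 2 by ring, show i + 1 + 2 = i + 2 + 1 by ring]

theorem InjectiveBonds.exists_bondLie_eq (hH : InjectiveBonds H) {n : ℕ}
    {χ ν : ℤ → Obs ℂ ℤ (Fin d)} (hχ : χ ∈ spanningFamilies (n + 1))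
    (hν : ν ∈ spanningFamilies (n + 1))
    (h : ∀ i, bondLie H (n + 1) χ i = ⁅ν i, bond H (i + n + 2)⁆) :
    ∃ ω ∈ spanningFamilies n, bondLie H n ω = ν := by
  obtain ⟨ω, hω, hl, hr⟩ := hH.peel_family (add_mem hχ hν) hχ fun i => by
    rw [Pi.add_apply, add_lie, ← h, bondLie_apply,
      show i + (n + 1 : ℕ) + 1 = i + n + 2 by push_cast; ring, add_sub_cancel]
  exact ⟨ω, hω, funext fun i => by
    rw [bondLie_apply, ← hl, ← hr, Pi.add_apply, add_sub_cancel_left]⟩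

theorem InjectiveBonds.exists_bondLie_zero_eq_of_one (hinj : InjectiveBonds H) (hH : H ∈ rangeLE 2)
    {a b : ℂ} {χ : ℤ → Obs ℂ ℤ (Fin d)} (hχ : χ ∈ spanningFamilies 1)
    (h : ∀ i, bondLie H 1 χ i
      = a • nestSource H 2 i + b • ⁅nestSource H 1 i, bond H (i + 2)⁆) :
    ∃ ω ∈ spanningFamilies 0, bondLie H 0 ω = ((3 * a + 2 * b) / 2) • nestSource H 1 := by
  obtain ⟨κ, hκ, hκ_eq⟩ := exists_nestSource_two hH
  refine hinj.exists_bondLie_eq (n := 0) (sub_mem hχ (Submodule.smul_mem _ (a / 2) hκ))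
    (Submodule.smul_mem _ _ (nestSource_mem_spanningFamilies H 1)) fun i => ?_
  have hκi : bondLie H 1 κ i = 2 • nestSource H 2 i - 3 • ⁅nestSource H 1 i, bond H (i + 2)⁆ := by
    rw [hκ_eq, add_sub_cancel_left]
  rw [zero_add, map_sub, map_smul, Pi.sub_apply, Pi.smul_apply, Pi.smul_apply, h, hκi, smul_lie,
    Nat.cast_zero, add_zero]
  module

theorem InjectiveBonds.exists_bondLie_eq_of_add_two (hinj : InjectiveBonds H) (hH : H ∈ rangeLE 2)
    {n : ℕ} {a b : ℂ} {χ : ℤ → Obs ℂ ℤ (Fin d)} (hχ : χ ∈ spanningFamilies (n + 2))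
    (h : ∀ i, bondLie H (n + 2) χ i
      = a • nestSource H (n + 3) i + b • ⁅nestSource H (n + 2) i, bond H (i + n + 3)⁆) :
    ∃ ω ∈ spanningFamilies (n + 1), ∀ i, bondLie H (n + 1) ω i
      = (2 * a + b) • nestSource H (n + 2) i
        + (-a) • ⁅nestSource H (n + 1) i, bond H (i + n + 2)⁆ := by
  set μ : ℤ → Obs ℂ ℤ (Fin d) :=
    nestSource H (n + 2) - fun i => ⁅nestSource H (n + 1) i, bond H (i + (n + 1 : ℕ) + 1)⁆
  have hμ_apply (i : ℤ) :
      μ i = nestSource H (n + 2) i - ⁅nestSource H (n + 1) i, bond H (i + n + 2)⁆ := by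
    simp only [μ, Pi.sub_apply, show i + (n + 1 : ℕ) + 1 = i + n + 2 by push_cast; ring]
  have hμ : μ ∈ spanningFamilies (n + 2) := sub_mem (nestSource_mem_spanningFamilies H _)
    (lie_bond_mem_spanningFamilies (nestSource_mem_spanningFamilies H (n + 1)))
  have hμ_lie (i : ℤ) : ⁅bond H i, μ (i + 1)⁆
      = nestSource H (n + 3) i - ⁅nestSource H (n + 2) i, bond H (i + n + 3)⁆ := by
    rw [hμ_apply, lie_sub, nestSource_add_three hH, show i + 1 + n + 2 = i + n + 3 by ring]
    abel
  obtain ⟨ω, hω, hωeq⟩ := hinj.exists_bondLie_eq (n := n + 1)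
    (sub_mem hχ (Submodule.smul_mem _ a hμ))
    (add_mem (Submodule.smul_mem _ (a + b) (nestSource_mem_spanningFamilies H (n + 2)))
      (Submodule.smul_mem _ a hμ)) fun i => by
    rw [map_sub, map_smul, Pi.sub_apply, Pi.smul_apply, h, bondLie_apply, hμ_lie,
      show i + (n + 2 : ℕ) + 1 = i + n + 3 by push_cast; ring,
      show i + (n + 1 : ℕ) + 2 = i + n + 3 by push_cast; ring]
    simp only [Pi.add_apply, Pi.smul_apply, add_lie, smul_lie]
    module
  refine ⟨ω, hω, fun i => ?_⟩
  rw [hωeq, Pi.add_apply, Pi.smul_apply, Pi.smul_apply, hμ_apply]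
  module

theorem InjectiveBonds.exists_bondLie_zero_eq (hinj : InjectiveBonds H) (hH : H ∈ rangeLE 2)
    {n : ℕ} {a b : ℂ} {χ : ℤ → Obs ℂ ℤ (Fin d)} (hχ : χ ∈ spanningFamilies (n + 1))
    (h : ∀ i, bondLie H (n + 1) χ i
      = a • nestSource H (n + 2) i + b • ⁅nestSource H (n + 1) i, bond H (i + n + 2)⁆) :
    ∃ ω ∈ spanningFamilies 0,
      bondLie H 0 ω = (((n + 3) * a + (n + 2) * b) / 2) • nestSource H 1 := by
  induction n generalizing a b χ with
  | zero => simpa using hinj.exists_bondLie_zero_eq_of_one hH hχ (by simpa using h)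
  | succ n ih =>
    obtain ⟨ω, hω, hωeq⟩ := hinj.exists_bondLie_eq_of_add_two hH hχ fun i => by
      rw [h i, show i + (n + 1 : ℕ) + 2 = i + n + 3 by push_cast; ring]
    obtain ⟨ω', hω', hω'eq⟩ := ih hω hωeq
    refine ⟨ω', hω', hω'eq.trans (congrArg (· • nestSource H 1) ?_)⟩
    push_cast
    ring

end Descent

section Translation

/-- The translate of a set of sites by `x`. -/
def translateSet (x : ℤ) (A : Finset ℤ) : Finset ℤ := A.map (Equiv.addRight x).toEmbedding

theorem mem_translateSet {x i : ℤ} {A : Finset ℤ} : i ∈ translateSet x A ↔ i - x ∈ A := by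
  simp [translateSet, Finset.mem_map_equiv, sub_eq_add_neg]

theorem translateSet_neg_translateSet (x : ℤ) (A : Finset ℤ) :
    translateSet (-x) (translateSet x A) = A := by
  ext i
  simp [mem_translateSet]

theorem translateSet_translateSet_neg (x : ℤ) (A : Finset ℤ) :
    translateSet x (translateSet (-x) A) = A := by
  ext i
  simp [mem_translateSet]

theorem translateSet_Icc (x a b : ℤ) :
    translateSet x (Finset.Icc a b) = Finset.Icc (a + x) (b + x) := by
  ext i
  simp only [mem_translateSet, Finset.mem_Icc]
  omega

theorem nbhd_subset_translateSet (x : ℤ) (D : Finset ℤ) (r : ℕ) :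
    nbhd D r ⊆ translateSet x (nbhd (translateSet (-x) D) r) := by
  intro c hc
  obtain ⟨a, ha, hac, hca⟩ := mem_nbhd.1 hc
  exact mem_translateSet.2
    (mem_nbhd.2 ⟨a - x, mem_translateSet.2 (by simpa using ha), by omega, by omega⟩)

/-- The translation of the operators on the chain by `x` sites. -/
def translate {d : ℕ} (x : ℤ) : Obs ℂ ℤ (Fin d) ≃ₐ[ℂ] Obs ℂ ℤ (Fin d) :=
  relabel (Equiv.addRight x)

variable {d : ℕ}

theorem translate_lie (x : ℤ) (X Y : Obs ℂ ℤ (Fin d)) :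
    translate x ⁅X, Y⁆ = ⁅translate x X, translate x Y⁆ := relabel_lie _ _ _

theorem translate_mem_localAlgebra {S : Finset ℤ} {X : Obs ℂ ℤ (Fin d)} (hX : X ∈ localAlgebra S)
    (x : ℤ) : translate x X ∈ localAlgebra (translateSet x S) := relabel_mem_localAlgebra hX _

theorem translate_siteTrace (x i : ℤ) (X : Obs ℂ ℤ (Fin d)) :
    translate x (siteTrace i X) = siteTrace (i + x) (translate x X) := relabel_siteTrace _ _ _

theorem translate_partialTrace (x : ℤ) (S : Finset ℤ) (X : Obs ℂ ℤ (Fin d)) :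
    translate x (partialTrace S X) = partialTrace (translateSet x S) (translate x X) :=
  relabel_partialTrace _ _ _

variable [NeZero d]

theorem exists_translateOp (x : ℤ) (Φ : FormalOp d) :
    ∃ Ψ : FormalOp d, ∀ A, summand A Ψ = translate x (summand (translateSet (-x) A) Φ) := by
  refine exists_summand_eq _ (fun A => ?_) fun A a ha => ?_
  · have h := translate_mem_localAlgebra (summand_mem_localAlgebra Φ (translateSet (-x) A)) x
    rwa [translateSet_translateSet_neg] at h
  · have h := translate_siteTrace x (a - x) (summand (translateSet (-x) A) Φ)
    rw [siteTrace_summand Φ (mem_translateSet.2 (by simpa using ha)), map_zero,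
      sub_add_cancel] at h
    exact h.symm

/-- The translate of a formal operator by `x` sites. -/
noncomputable def translateOp (x : ℤ) (Φ : FormalOp d) : FormalOp d :=
  (exists_translateOp x Φ).choose

theorem summand_translateOp (x : ℤ) (Φ : FormalOp d) (A : Finset ℤ) :
    summand A (translateOp x Φ) = translate x (summand (translateSet (-x) A) Φ) :=
  (exists_translateOp x Φ).choose_spec A

theorem isTranslationInvariant_iff_summand {Φ : FormalOp d} :
    IsTranslationInvariant Φ ↔
      ∀ A x, summand (translateSet x A) Φ = translate x (summand A Φ) := by
  refine forall₂_congr fun A x => ?_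
  rw [summand_apply, summand_apply, translate, relabel_actOn]
  exact ⟨fun h => congrArg _ (Matrix.ext h),
    fun h s t => congrFun (congrFun (actOn_injective _ h) s) t⟩

theorem isTranslationInvariant_iff {Φ : FormalOp d} :
    IsTranslationInvariant Φ ↔ ∀ x, translateOp x Φ = Φ := by
  rw [isTranslationInvariant_iff_summand]
  constructor
  · intro h x
    refine ext_summand fun A => ?_
    rw [summand_translateOp, ← h, translateSet_translateSet_neg]
  · intro h A x
    conv_lhs => rw [← h x]
    rw [summand_translateOp, translateSet_neg_translateSet]

theorem partialSum_translateOp (x : ℤ) (Φ : FormalOp d) (B : Finset ℤ) :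
    partialSum B (translateOp x Φ) = translate x (partialSum (translateSet (-x) B) Φ) := by
  rw [partialSum_apply, partialSum_apply, map_sum]
  refine Finset.sum_bij' (fun A _ => translateSet (-x) A) (fun A _ => translateSet x A)
    (fun A hA => ?_) (fun A hA => ?_) (fun A _ => translateSet_translateSet_neg x A)
    (fun A _ => translateSet_neg_translateSet x A) (fun A _ => summand_translateOp x Φ A)
  · exact Finset.mem_powerset.2 (Finset.map_subset_map.2 (Finset.mem_powerset.1 hA))
  · rw [← translateSet_translateSet_neg x B]
    exact Finset.mem_powerset.2 (Finset.map_subset_map.2 (Finset.mem_powerset.1 hA))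

theorem IsTranslationInvariant.partialSum_translateSet {Φ : FormalOp d}
    (hΦ : IsTranslationInvariant Φ) (x : ℤ) (B : Finset ℤ) :
    partialSum (translateSet x B) Φ = translate x (partialSum B Φ) := by
  conv_lhs => rw [← isTranslationInvariant_iff.1 hΦ x]
  rw [partialSum_translateOp, translateSet_neg_translateSet]

theorem translateOp_mem_rangeLE {Φ : FormalOp d} {n : ℕ} (hΦ : Φ ∈ rangeLE n) (x : ℤ) :
    translateOp x Φ ∈ rangeLE n := by
  intro A hA a ha b hb
  rw [summand_translateOp] at hA
  have h := hΦ (translateSet (-x) A) (fun h => hA (by rw [h, map_zero])) (a - x)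
    (mem_translateSet.2 (by simpa using ha)) (b - x) (mem_translateSet.2 (by simpa using hb))
  omega

theorem comm_translateOp {Φ : FormalOp d} {r : ℕ} (hΦ : Φ ∈ rangeLE r) (x : ℤ) (Ψ : FormalOp d) :
    comm (translateOp x Φ) (translateOp x Ψ) = translateOp x (comm Φ Ψ) := by
  refine ext_partialSum fun D => ?_
  have hsdiff : translateSet x (nbhd (translateSet (-x) D) r \ translateSet (-x) D)
      = translateSet x (nbhd (translateSet (-x) D) r) \ D := by
    ext i
    simp [mem_translateSet]
  rw [partialSum_comm (translateOp_mem_rangeLE hΦ x) (nbhd_subset_translateSet x D r),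
    partialSum_translateOp, partialSum_translateOp, partialSum_translateOp,
    partialSum_comm hΦ subset_rfl, translate_partialTrace, translate_lie,
    translateSet_neg_translateSet, hsdiff]

theorem IsTranslationInvariant.comm {Φ Ψ : FormalOp d} {r : ℕ} (hr : Φ ∈ rangeLE r)
    (hΦ : IsTranslationInvariant Φ) (hΨ : IsTranslationInvariant Ψ) :
    IsTranslationInvariant (comm Φ Ψ) := by
  rw [isTranslationInvariant_iff] at *
  intro x
  rw [← comm_translateOp hr, hΦ x, hΨ x]

end Translation

section Adjoint

variable {d : ℕ}

/-- The adjoint of a formal operator. -/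
def adjoint (Φ : FormalOp d) : FormalOp d :=
  ⟨fun A => (Φ.1 A).conjTranspose, fun A a s t => by
    simpa only [Matrix.conjTranspose_apply, star_sum, star_zero] using
      congrArg star (Φ.2 A a t s)⟩

theorem opRange_adjoint (Φ : FormalOp d) : opRange (adjoint Φ) = opRange Φ := by
  simp [opRange, adjoint, Matrix.conjTranspose_eq_zero]

theorem IsTranslationInvariant.adjoint {Φ : FormalOp d} (hΦ : IsTranslationInvariant Φ) :
    IsTranslationInvariant (adjoint Φ) := fun A x s t => congrArg star (hΦ A x t s)

theorem restrict_adjoint (Φ : FormalOp d) (B : Finset ℤ) :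
    restrict (adjoint Φ) B = (restrict Φ B).conjTranspose := by
  rw [restrict, restrict, Matrix.conjTranspose_sum]
  refine Finset.sum_congr rfl fun A _ => ?_
  ext s t
  simp only [embed, adjoint, Matrix.conjTranspose_apply, eq_comm (a := s _)]
  split_ifs <;> simp

theorem component_conjTranspose {B : Finset ℤ} (A : Finset ℤ) (Y : LocOp d B) :
    component A Y.conjTranspose = (component A Y).conjTranspose := by
  have hreduce (C : Finset ℤ) : reduce A C Y.conjTranspose = (reduce A C Y).conjTranspose := by
    ext s t
    simp only [reduce, Matrix.conjTranspose_apply, eq_comm (a := s _)]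
    split_ifs <;> simp
  simp [component, Matrix.conjTranspose_sum, Matrix.conjTranspose_smul, hreduce]

theorem component_neg {B : Finset ℤ} (A : Finset ℤ) (Y : LocOp d B) :
    component A (-Y) = -component A Y := by
  have hreduce (C : Finset ℤ) : reduce A C (-Y) = -reduce A C Y := by
    ext s t
    simp only [reduce, Matrix.neg_apply]
    split_ifs <;> simp
  simp only [component, hreduce, smul_neg, Finset.sum_neg_distrib]

theorem comm_adjoint {H : FormalOp d} (hH : IsSelfAdjointOp H) (Ψ : FormalOp d) :
    comm H (adjoint Ψ) = -adjoint (comm H Ψ) := by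
  refine Subtype.ext (funext fun A => ?_)
  have hrestrict (B : Finset ℤ) : (restrict H B).conjTranspose = restrict H B := by
    rw [← restrict_adjoint]
    exact congrArg (restrict · B) (Subtype.ext (funext fun A => hH A))
  change component A _ = -(component A _).conjTranspose
  rw [← component_conjTranspose, ← component_neg, restrict_adjoint]
  congr 1
  rw [Ring.lie_def, Ring.lie_def, Matrix.conjTranspose_sub, Matrix.conjTranspose_mul,
    Matrix.conjTranspose_mul, hrestrict, neg_sub]

theorem adjoint_mem_rangeLE [NeZero d] {Φ : FormalOp d} {n : ℕ} (hΦ : Φ ∈ rangeLE n) :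
    adjoint Φ ∈ rangeLE n :=
  opRange_le_iff.1 ((opRange_adjoint Φ).trans_le (opRange_le_iff.2 hΦ))

end Adjoint

variable {d : ℕ}

theorem partialTrace_mul_lie_antisymm {H X Y : Obs ℂ ℤ (Fin d)} {Λ : Finset ℤ}
    (hH : H ∈ localAlgebra Λ) (hY : Y ∈ localAlgebra Λ) :
    partialTrace Λ (X * ⁅H, Y⁆) = -partialTrace Λ (Y * ⁅H, X⁆) := by
  have hcyclic := partialTrace_mul_comm hH (X * Y)
  have hswap := partialTrace_mul_comm hY (H * X)
  have hswap' := partialTrace_mul_comm hY (X * H)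
  simp only [Ring.lie_def, mul_sub, map_sub, ← mul_assoc] at hcyclic hswap hswap' ⊢
  rw [hswap, hswap', hcyclic, neg_sub]

theorem translate_partialTrace_self {S : Finset ℤ} {X : Obs ℂ ℤ (Fin d)} (hX : X ∈ localAlgebra S)
    (x : ℤ) : translate x (partialTrace S X) = partialTrace S X := by
  have hmem := partialTrace_mem_localAlgebra hX S
  rw [Finset.sdiff_self, localAlgebra_empty] at hmem
  obtain ⟨c, hc⟩ := Algebra.mem_bot.1 hmem
  rw [← hc, AlgEquiv.commutes]

variable [NeZero d]

section CommutatorForm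

theorem partialTrace_mul_lie_of_subset (H : FormalOp d) {S Λ : Finset ℤ} {X Y : Obs ℂ ℤ (Fin d)}
    (hX : X ∈ localAlgebra S) (hY : Y ∈ localAlgebra S) (h : S ⊆ Λ) :
    partialTrace Λ (X * ⁅partialSum Λ H, Y⁆) = partialTrace S (X * ⁅partialSum S H, Y⁆) := by
  have hXout := mem_trivialAt_of_disjoint hX (Finset.sdiff_disjoint : Disjoint (Λ \ S) S)
  have hYout := mem_trivialAt_of_disjoint hY (Finset.sdiff_disjoint : Disjoint (Λ \ S) S)
  rw [← partialTrace_partialTrace_sdiff h, partialTrace_mul_left hXout, ← lie_skew, map_neg,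
    partialTrace_lie_left hYout, partialTrace_partialSum, Finset.sdiff_sdiff_eq_self h, lie_skew]

theorem partialTrace_translate_mul_lie {H : FormalOp d} (hH : IsTranslationInvariant H) (x : ℤ)
    {S Λ : Finset ℤ} {X Y : Obs ℂ ℤ (Fin d)} (hX : X ∈ localAlgebra S) (hY : Y ∈ localAlgebra S)
    (hS : S ⊆ Λ) (hxS : translateSet x S ⊆ Λ) :
    partialTrace Λ (translate x X * ⁅partialSum Λ H, translate x Y⁆)
      = partialTrace Λ (X * ⁅partialSum Λ H, Y⁆) := by
  have hmem : X * ⁅partialSum S H, Y⁆ ∈ localAlgebra S :=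
    mul_mem hX (lie_mem_subalgebra (partialSum_mem_localAlgebra H S) hY)
  rw [partialTrace_mul_lie_of_subset H hX hY hS, partialTrace_mul_lie_of_subset H
    (translate_mem_localAlgebra hX x) (translate_mem_localAlgebra hY x) hxS,
    ← translate_partialTrace_self hmem x, translate_partialTrace,
    map_mul (translate x), translate_lie,
    hH.partialSum_translateSet]

theorem partialTrace_mul_lie_partialSum {H : FormalOp d} {r : ℕ} (hH : H ∈ rangeLE r)
    (Φ : FormalOp d) {B D N Λ : Finset ℤ} {X : Obs ℂ ℤ (Fin d)} (hX : X ∈ localAlgebra D)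
    (hN : nbhd D r ⊆ N) (hNΛ : N ⊆ Λ) (hB : B ⊆ Λ) :
    partialTrace Λ (X * ⁅partialSum Λ H, partialSum B Φ⁆)
      = partialTrace D (X * partialTrace (N \ D) ⁅partialSum N H, partialSum (B ∩ N) Φ⁆) := by
  have hDΛ : D ⊆ Λ := ((subset_nbhd D r).trans hN).trans hNΛ
  have hinter : B \ (Λ \ N) = B ∩ N := by grind
  rw [← partialTrace_partialTrace_sdiff hDΛ,
    partialTrace_mul_left (mem_trivialAt_of_disjoint hX Finset.sdiff_disjoint),
    partialTrace_lie_partialSum hH hN hNΛ, partialTrace_partialSum, hinter]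

end CommutatorForm

section LowestSite

/-- The sum of the terms of `Φ` whose lowest site is `c`, for `Φ` of range at most `r`. -/
noncomputable def lowestPart (r : ℕ) (Φ : FormalOp d) (c : ℤ) : Obs ℂ ℤ (Fin d) :=
  partialSum (Finset.Icc c (c + r)) Φ - partialSum (Finset.Icc (c + 1) (c + r)) Φ

theorem lowestPart_mem_localAlgebra (r : ℕ) (Φ : FormalOp d) (c : ℤ) :
    lowestPart r Φ c ∈ localAlgebra (Finset.Icc c (c + r)) :=
  sub_mem (partialSum_mem_localAlgebra _ _) (localAlgebra_mono
    (Finset.Icc_subset_Icc_left (by omega)) (partialSum_mem_localAlgebra _ _))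

theorem partialSum_Icc_sub (Φ : FormalOp d) (c L : ℤ) :
    partialSum (Finset.Icc c L) Φ - partialSum (Finset.Icc (c + 1) L) Φ
      = ∑ A ∈ (Finset.Icc c L).powerset with c ∈ A, summand A Φ := by
  have herase : (Finset.Icc c L).erase c = Finset.Icc (c + 1) L := by
    rw [Finset.Icc_erase_left, ← Finset.Icc_add_one_left_eq_Ioc]
  rw [← herase, ← siteTrace_partialSum, partialSum_apply, map_sum, ← Finset.sum_sub_distrib,
    Finset.sum_filter]
  refine Finset.sum_congr rfl fun A _ => ?_
  split_ifs with h
  · rw [siteTrace_summand Φ h, sub_zero]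
  · rw [siteTrace_of_mem_trivialAt (localAlgebra_le_trivialAt h (summand_mem_localAlgebra Φ A)),
      sub_self]

theorem lowestPart_eq {r : ℕ} {Φ : FormalOp d} (hΦ : Φ ∈ rangeLE r) {c L : ℤ} (h : c + r ≤ L) :
    lowestPart r Φ c
      = partialSum (Finset.Icc c L) Φ - partialSum (Finset.Icc (c + 1) L) Φ := by
  rw [lowestPart, partialSum_Icc_sub, partialSum_Icc_sub]
  refine Finset.sum_subset (Finset.filter_subset_filter _ (Finset.powerset_mono.2
    (Finset.Icc_subset_Icc le_rfl h))) fun A hA hA' => ?_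
  by_contra h0
  rw [Finset.mem_filter, Finset.mem_powerset] at hA hA'
  refine hA' ⟨fun x hx => ?_, hA.2⟩
  have hxc := hΦ A h0 c hA.2 x hx
  have hx' := Finset.mem_Icc.1 (hA.1 hx)
  exact Finset.mem_Icc.2 (by omega)

theorem sum_lowestPart {r : ℕ} {Φ : FormalOp d} (hΦ : Φ ∈ rangeLE r) (c L : ℤ) (n : ℕ)
    (h : c + n + r ≤ L) : ∑ k ∈ Finset.range n, lowestPart r Φ (c + k)
      = partialSum (Finset.Icc c L) Φ - partialSum (Finset.Icc (c + n) L) Φ := by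
  have hstep : ∀ k ∈ Finset.range n, lowestPart r Φ (c + k)
      = partialSum (Finset.Icc (c + (k : ℕ)) L) Φ
        - partialSum (Finset.Icc (c + (k + 1 : ℕ)) L) Φ := by
    intro k hk
    have hkn := Finset.mem_range.1 hk
    rw [lowestPart_eq hΦ (L := L) (by omega), Nat.cast_succ, add_assoc]
  rw [Finset.sum_congr rfl hstep,
    Finset.sum_range_sub' fun k : ℕ => partialSum (Finset.Icc (c + k) L) Φ, Nat.cast_zero, add_zero]

theorem IsTranslationInvariant.translate_lowestPart {Φ : FormalOp d}
    (hΦ : IsTranslationInvariant Φ) (r : ℕ) (c x : ℤ) :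
    translate x (lowestPart r Φ c) = lowestPart r Φ (c + x) := by
  rw [lowestPart, lowestPart, map_sub, ← hΦ.partialSum_translateSet, ← hΦ.partialSum_translateSet,
    translateSet_Icc, translateSet_Icc, add_right_comm c r x, add_right_comm c 1 x]

theorem nbhd_Icc_subset {a b a' b' : ℤ} {r : ℕ} (ha : a' + r ≤ a) (hb : b + r ≤ b') :
    nbhd (Finset.Icc a b) r ⊆ Finset.Icc a' b' := by
  intro c hc
  obtain ⟨x, hx, hxc, hcx⟩ := mem_nbhd.1 hc
  rw [Finset.mem_Icc] at hx ⊢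
  omega

theorem sum_partialTrace_mul_lie_lowestPart {H Φ : FormalOp d} {r : ℕ} (hH : H ∈ rangeLE r)
    (hΦ : Φ ∈ rangeLE r) {a b c l L : ℤ} {n : ℕ} {X : Obs ℂ ℤ (Fin d)}
    (hX : X ∈ localAlgebra (Finset.Icc a b)) (hlc : l ≤ c) (hca : c + r ≤ a) (hbn : b + r < c + n)
    (hnL : c + n + r ≤ L) :
    ∑ k ∈ Finset.range n,
        partialTrace (Finset.Icc l L) (X * ⁅partialSum (Finset.Icc l L) H, lowestPart r Φ (c + k)⁆)
      = partialTrace (Finset.Icc a b) (X * partialSum (Finset.Icc a b) (comm H Φ)) := by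
  have hN : nbhd (Finset.Icc a b) r ⊆ Finset.Icc c (c + n - 1) :=
    nbhd_Icc_subset hca (by omega)
  have hinside : Finset.Icc c L ∩ Finset.Icc c (c + n - 1) = Finset.Icc c (c + n - 1) :=
    Finset.inter_eq_right.2 (Finset.Icc_subset_Icc_right (by omega))
  have houtside : Finset.Icc (c + n) L ∩ Finset.Icc c (c + n - 1) = ∅ := by
    ext x
    simp only [Finset.mem_inter, Finset.mem_Icc, Finset.notMem_empty, iff_false]
    omega
  have hscalar (Y : Obs ℂ ℤ (Fin d)) : ⁅Y, partialSum ∅ Φ⁆ = 0 := by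
    rw [← lie_skew, lie_eq_zero_of_mem_trivialAt (partialSum_mem_localAlgebra Φ ∅) (by simp),
      neg_zero]
  rw [← map_sum, ← Finset.mul_sum, ← lie_sum, sum_lowestPart hΦ c L n hnL, lie_sub, mul_sub,
    map_sub]
  rw [partialTrace_mul_lie_partialSum hH Φ hX hN (Finset.Icc_subset_Icc hlc (by omega))
      (Finset.Icc_subset_Icc_left hlc),
    partialTrace_mul_lie_partialSum hH Φ hX hN (Finset.Icc_subset_Icc hlc (by omega))
      (Finset.Icc_subset_Icc_left (by omega)), hinside, houtside, hscalar, map_zero, mul_zero,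
    map_zero, sub_zero, ← partialSum_comm hH hN]

/-- The form `(X, Y) ↦ tr (X [H, Y])` is antisymmetric and translation invariant, so the pairings of
the part of `P` at the site `0` with all parts of `Q` add up to minus the pairings of the part of
`Q` at `0` with all parts of `P`. -/
theorem partialTrace_lowestPart_mul_comm {H P Q : FormalOp d} {r : ℕ} (hH : H ∈ rangeLE r)
    (hP : P ∈ rangeLE r) (hQ : Q ∈ rangeLE r) (hHt : IsTranslationInvariant H)
    (hPt : IsTranslationInvariant P) (hQt : IsTranslationInvariant Q) :
    partialTrace (Finset.Icc 0 (r : ℤ))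
        (lowestPart r P 0 * partialSum (Finset.Icc 0 (r : ℤ)) (comm H Q))
      = -partialTrace (Finset.Icc 0 (r : ℤ))
        (lowestPart r Q 0 * partialSum (Finset.Icc 0 (r : ℤ)) (comm H P)) := by
  have hmem (Φ : FormalOp d) : lowestPart r Φ 0 ∈ localAlgebra (Finset.Icc 0 (r : ℤ)) := by
    simpa only [zero_add] using lowestPart_mem_localAlgebra r Φ 0
  have hsum {Φ Ψ : FormalOp d} (hΨ : Ψ ∈ rangeLE r) := sum_partialTrace_mul_lie_lowestPart hH hΨ
    (hmem Φ) (c := -(2 * r)) (l := -(5 * r)) (L := 5 * r + 1) (n := 4 * r + 1) (by omega)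
    (by omega) (by push_cast; omega) (by push_cast; omega)
  rw [← hsum hQ, ← hsum hP, ← Finset.sum_range_reflect, ← Finset.sum_neg_distrib]
  refine Finset.sum_congr rfl fun k hk => ?_
  have hk' := Finset.mem_range.1 hk
  set x : ℤ := -(2 * r) + k
  have hreflect : -(2 * r : ℤ) + (4 * r + 1 - 1 - k : ℕ) = -x := by omega
  have hlocal {Φ : FormalOp d} {c : ℤ} (hc : -(2 * r) ≤ c ∧ c ≤ 2 * r) :
      lowestPart r Φ c ∈ localAlgebra (Finset.Icc (-(2 * r : ℤ)) (3 * r)) :=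
    localAlgebra_mono (Finset.Icc_subset_Icc hc.1 (by omega)) (lowestPart_mem_localAlgebra r Φ c)
  rw [hreflect, ← partialTrace_translate_mul_lie hHt x (hlocal (by omega)) (hlocal (by omega)),
    hPt.translate_lowestPart, hQt.translate_lowestPart, neg_add_cancel, zero_add,
    partialTrace_mul_lie_antisymm (partialSum_mem_localAlgebra H _)
      (localAlgebra_mono ?_ (hmem Q))]
  · exact Finset.Icc_subset_Icc (by omega) (by omega)
  · exact Finset.Icc_subset_Icc (by omega) (by omega)
  · rw [translateSet_Icc]
    exact Finset.Icc_subset_Icc (by omega) (by omega)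

end LowestSite

section Positivity

theorem partialTrace_actOn_self {A : Finset ℤ} (Z : LocOp d A) :
    partialTrace A (actOn A Z)
      = (((d : ℂ) ^ A.card)⁻¹ * Z.trace) • (1 : Obs ℂ ℤ (Fin d)) := by
  have h := partialTrace_actOn Z (Finset.empty_subset A)
  rw [Finset.sdiff_empty, Finset.powerset_empty, Finset.sum_singleton] at h
  rw [h, ← map_one (actOn ∅), ← map_smul]
  congr 1
  ext s t
  obtain rfl : s = t := Subsingleton.elim _ _
  have hglue (u : A → Fin d) : glue ∅ s u = u := by
    funext b
    simp [glue]
  simp [component, reduce, hglue, Matrix.trace]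

open scoped ComplexOrder in
theorem summand_eq_zero_of_sum_partialTrace_eq_zero {Φ : FormalOp d} {F : Finset (Finset ℤ)}
    (h : ∑ A ∈ F, partialTrace A (summand A (adjoint Φ) * summand A Φ) = 0) {A : Finset ℤ}
    (hA : A ∈ F) : summand A Φ = 0 := by
  have htrace (A : Finset ℤ) : partialTrace A (summand A (adjoint Φ) * summand A Φ)
      = (((d : ℂ) ^ A.card)⁻¹ * ((Φ.1 A).conjTranspose * Φ.1 A).trace)
        • (1 : Obs ℂ ℤ (Fin d)) := by
    rw [summand_apply, summand_apply, ← map_mul, partialTrace_actOn_self]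
    rfl
  have hpos (A : Finset ℤ) : (0 : ℂ) < ((d : ℂ) ^ A.card)⁻¹ :=
    inv_pos.2 (pow_pos (by exact_mod_cast NeZero.pos d) _)
  simp only [htrace, ← Finset.sum_smul] at h
  have hsum := (smul_eq_zero.1 h).resolve_right one_ne_zero
  rw [Finset.sum_eq_zero_iff_of_nonneg fun A _ => mul_nonneg (hpos A).le
    (Matrix.posSemidef_conjTranspose_mul_self _).trace_nonneg] at hsum
  exact summand_eq_zero_iff.2 (Matrix.trace_conjTranspose_mul_self_eq_zero_iff.1
    ((mul_eq_zero.1 (hsum A hA)).resolve_left (hpos A).ne'))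

theorem partialTrace_summand_mul_partialSum (Φ Ψ : FormalOp d) {A D : Finset ℤ} (hA : A ⊆ D) :
    partialTrace D (summand A Φ * partialSum D Ψ)
      = partialTrace A (summand A Φ * summand A Ψ) := by
  rw [← partialTrace_partialTrace_sdiff hA, partialTrace_mul_left (mem_trivialAt_of_disjoint
    (summand_mem_localAlgebra Φ A) Finset.sdiff_disjoint), partialTrace_partialSum,
    Finset.sdiff_sdiff_eq_self hA, partialSum_apply, Finset.mul_sum, map_sum]
  refine Finset.sum_eq_single_of_mem A (Finset.mem_powerset_self A) fun C hC hne => ?_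
  obtain ⟨a, haA, haC⟩ := Finset.not_subset.1 fun h =>
    hne (Finset.Subset.antisymm (Finset.mem_powerset.1 hC) h)
  refine partialTrace_eq_zero haA ?_
  rw [siteTrace_mul_right (localAlgebra_le_trivialAt haC (summand_mem_localAlgebra Ψ C)),
    siteTrace_summand Φ haA, zero_mul]

theorem summand_empty_comm {Φ Ψ : FormalOp d} {r : ℕ} (hΦ : Φ ∈ rangeLE r) :
    summand ∅ (comm Φ Ψ) = 0 := by
  have h : partialSum ∅ (comm Φ Ψ) = summand ∅ (comm Φ Ψ) := by simp [partialSum_apply]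
  rw [← h, partialSum_comm hΦ le_rfl, Finset.sdiff_empty,
    partialTrace_lie_eq_zero (partialSum_mem_localAlgebra _ _) le_rfl]

theorem IsTranslationInvariant.eq_zero_of_summand {Φ : FormalOp d} {r : ℕ} (hΦ : Φ ∈ rangeLE r)
    (hΦt : IsTranslationInvariant Φ) (hempty : summand ∅ Φ = 0)
    (h : ∀ A ⊆ Finset.Icc 0 (r : ℤ), 0 ∈ A → summand A Φ = 0) : Φ = 0 := by
  refine ext_summand fun A => ?_
  rw [map_zero]
  by_contra hA
  rcases A.eq_empty_or_nonempty with rfl | hne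
  · exact hA hempty
  · have hsub : translateSet (-A.min' hne) A ⊆ Finset.Icc 0 (r : ℤ) := by
      intro x hx
      rw [mem_translateSet, sub_neg_eq_add] at hx
      have hlt := hΦ A hA _ (A.min'_mem hne) _ hx
      have hle := A.min'_le _ hx
      exact Finset.mem_Icc.2 (by omega)
    have htranslate := isTranslationInvariant_iff_summand.1 hΦt A (-A.min' hne)
    rw [h _ hsub (mem_translateSet.2 (by simpa using A.min'_mem hne))] at htranslate
    exact hA ((map_eq_zero_iff _ (translate _).injective).1 htranslate.symm)

/-- The trace density of `[H, Q]† [H, Q]` equals that of `-[H, [H, Q]†] Q`, and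
`[H, [H, Q]†] = -[H, [H, Q]]†` as `H` is self-adjoint. -/
theorem comm_eq_zero_of_comm_comm {H Q : FormalOp d} {r s : ℕ} (hHr : H ∈ rangeLE r)
    (hQs : Q ∈ rangeLE s) (hHsa : IsSelfAdjointOp H) (hHt : IsTranslationInvariant H)
    (hQt : IsTranslationInvariant Q) (h : comm H (comm H Q) = 0) : comm H Q = 0 := by
  have hYR : comm H Q ∈ rangeLE (r + s) := comm_mem_rangeLE hHr hQs (by omega)
  have hYt : IsTranslationInvariant (comm H Q) := hHt.comm hHr hQt
  have hadj : comm H (adjoint (comm H Q)) = 0 := by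
    rw [comm_adjoint hHsa, h, neg_eq_zero]
    exact Subtype.ext (funext fun A => Matrix.conjTranspose_zero)
  have hzero := partialTrace_lowestPart_mul_comm (rangeLE_mono (Nat.le_add_right r s) hHr)
    (adjoint_mem_rangeLE hYR) (rangeLE_mono (Nat.le_add_left s r) hQs) hHt hYt.adjoint hQt
  rw [hadj, map_zero, mul_zero, map_zero, neg_zero, lowestPart, partialSum_Icc_sub, Finset.sum_mul,
    map_sum, zero_add] at hzero
  refine hYt.eq_zero_of_summand hYR (summand_empty_comm hHr) fun A hA h0 =>
    summand_eq_zero_of_sum_partialTrace_eq_zero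
      (F := {C ∈ (Finset.Icc 0 ((r + s : ℕ) : ℤ)).powerset | 0 ∈ C}) ?_
      (Finset.mem_filter.2 ⟨Finset.mem_powerset.2 hA, h0⟩)
  rw [← hzero]
  exact Finset.sum_congr rfl fun C hC => (partialTrace_summand_mul_partialSum _ _
    (Finset.mem_powerset.1 (Finset.mem_filter.1 hC).1)).symm

end Positivity

section NearestNeighbour

variable {d : ℕ}

theorem pair_injective : Function.Injective fun i : ℤ => ({i, i + 1} : Finset ℤ) := by
  intro i j (h : ({i, i + 1} : Finset ℤ) = {j, j + 1})
  have hi : i ∈ ({j, j + 1} : Finset ℤ) := h ▸ by simp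
  have hj : j ∈ ({i, i + 1} : Finset ℤ) := h ▸ by simp
  simp only [Finset.mem_insert, Finset.mem_singleton] at hi hj
  omega

theorem mem_spanningFamilies_zero {ψ : ℤ → Obs ℂ ℤ (Fin d)} :
    ψ ∈ spanningFamilies 0 ↔
      ∀ i : ℤ, ψ i ∈ localAlgebra {i, i + 1} ∧
        ∀ s ∈ ({i, i + 1} : Finset ℤ), siteTrace s (ψ i) = 0 := by
  have hIcc (i : ℤ) : Finset.Icc i (i + 1) = {i, i + 1} := by
    ext x; simp only [Finset.mem_Icc, Finset.mem_insert, Finset.mem_singleton]; omega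
  simp [mem_spanningFamilies, mem_spanningOps, hIcc]

variable [NeZero d] {H : FormalOp d}

theorem IsNearestNeighbour.mem_rangeLE (hH : IsNearestNeighbour H) : H ∈ rangeLE 2 := by
  intro A hA a ha b hb
  obtain ⟨i, rfl | rfl⟩ := hH A (mt summand_eq_zero_iff.2 hA) <;>
  · simp only [Finset.mem_insert, Finset.mem_singleton] at ha hb
    push_cast
    omega

theorem IsNearestNeighbour.summand_empty (hH : IsNearestNeighbour H) : summand ∅ H = 0 := by
  by_contra h
  obtain ⟨i, hi | hi⟩ := hH ∅ (mt summand_eq_zero_iff.2 h)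
  · exact Finset.insert_ne_empty _ _ hi.symm
  · exact Finset.singleton_ne_empty _ hi.symm

theorem eq_zero_of_lie_bond (hHt : IsTranslationInvariant H) {p : ℤ}
    (hp : ({p} : Finset ℤ) ⊆ {1, 2})
    (h : ∀ a : LocOp d {p}, IsTraceless a → ⁅embed hp a, H.1 {1, 2}⁆ = 0 → a = 0) {i q : ℤ}
    (hq : q + (1 - i) = p) {a : Obs ℂ ℤ (Fin d)} (ha : a ∈ localAlgebra {q})
    (htrace : siteTrace q a = 0) (hab : ⁅a, bond H i⁆ = 0) : a = 0 := by
  have hsite : translateSet (1 - i) {q} = {p} := by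
    ext x; simp only [mem_translateSet, Finset.mem_singleton]; omega
  have hpair : translateSet (1 - i) {i, i + 1} = {1, 2} := by
    ext x; simp only [mem_translateSet, Finset.mem_singleton, Finset.mem_insert]; omega
  have hbond : translate (1 - i) (bond H i) = actOn {1, 2} (H.1 {1, 2}) := by
    rw [← summand_apply, ← hpair, isTranslationInvariant_iff_summand.1 hHt, bond]
  obtain ⟨b, hb⟩ := exists_actOn_eq (hsite ▸ translate_mem_localAlgebra ha (1 - i))
  have hb0 : b = 0 := by
    refine h b ((isTraceless_iff_siteTrace b).2 fun s hs => ?_) (actOn_injective _ ?_)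
    · rw [hb, Finset.mem_singleton.1 hs, ← hq, ← translate_siteTrace, htrace, map_zero]
    · rw [actOn_lie, actOn_embed, hb, ← hbond, ← translate_lie, hab, map_zero, map_zero]
  rw [hb0, map_zero] at hb
  exact (map_eq_zero_iff _ (translate (1 - i)).injective).1 hb.symm

theorem InjectiveInteraction.injectiveBonds (h : InjectiveInteraction H)
    (hHt : IsTranslationInvariant H) : InjectiveBonds H := fun _ =>
  ⟨fun _ => eq_zero_of_lie_bond hHt (by decide) h.1 (by ring),
    fun _ => eq_zero_of_lie_bond hHt (by decide) h.2 (by ring)⟩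

theorem UniqueTwoLocalCharge.uniqueBonds (h : UniqueTwoLocalCharge H) : UniqueBonds H := by
  intro ψ hψ heq
  rw [mem_spanningFamilies_zero] at hψ
  choose a ha using fun i => exists_actOn_eq (hψ i).1
  obtain ⟨α, hα⟩ := h a
    (fun i => (isTraceless_iff_siteTrace _).2 fun s hs => by rw [ha]; exact (hψ i).2 s hs)
    fun i => actOn_injective _ (by
      simp only [actOn_lie, actOn_embed, ha]
      exact heq i)
  refine ⟨α, fun i => ?_⟩
  rw [← ha, hα, map_smul, bond, summand_apply]

theorem exists_bond_eq {θ : ℤ → Obs ℂ ℤ (Fin d)} (hθ : θ ∈ spanningFamilies 0) :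
    ∃ R ∈ rangeLE (d := d) 2, ∀ i, bond R i = θ i := by
  classical
  rw [mem_spanningFamilies_zero] at hθ
  obtain ⟨R, hR⟩ := exists_summand_eq
    (fun A => if h : ∃ i : ℤ, A = {i, i + 1} then θ h.choose else 0)
    (fun A => by
      beta_reduce
      split_ifs with h
      · exact (congrArg (θ h.choose ∈ localAlgebra ·) h.choose_spec).mpr (hθ _).1
      · exact zero_mem _)
    (fun A a ha => by
      split_ifs with h
      · rw [h.choose_spec] at ha
        exact (hθ _).2 a ha
      · exact map_zero _)
  refine ⟨R, fun A hA a ha b hb => ?_, fun i => ?_⟩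
  · obtain ⟨i, rfl⟩ : ∃ i : ℤ, A = {i, i + 1} := of_not_not fun h => hA ((hR A).trans (dif_neg h))
    simp only [Finset.mem_insert, Finset.mem_singleton] at ha hb
    push_cast
    omega
  · have h : ∃ j : ℤ, ({i, i + 1} : Finset ℤ) = {j, j + 1} := ⟨i, rfl⟩
    rw [bond, hR, dif_pos h, ← pair_injective h.choose_spec]

end NearestNeighbour

section Boost

variable {d : ℕ} {H C Φ Ψ : FormalOp d}

theorem summand_moment {A : Finset ℤ} {m : ℤ} (hm : m ∈ A) (hle : ∀ a ∈ A, m ≤ a) :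
    summand A (moment H) = (m : ℂ) • summand A H := by
  have hA : A.Nonempty := ⟨m, hm⟩
  have hmin : A.min' hA = m := le_antisymm (A.min'_le m hm) (hle _ (A.min'_mem hA))
  simp only [summand_apply, moment, dif_pos hA, hmin, map_smul]

theorem summand_empty_moment : summand ∅ (moment H) = 0 := by
  simp [summand_apply, moment]

theorem moment_mem_rangeLE {n : ℕ} (hH : H ∈ rangeLE n) : moment H ∈ rangeLE n := by
  intro A hA a ha
  refine hH A (fun h => hA ?_) a ha
  rw [summand_moment (A.min'_mem ⟨a, ha⟩) fun b hb => A.min'_le b hb, h, smul_zero]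

theorem boost_mem_rangeLE (hH : H ∈ rangeLE 2) (hC : C ∈ rangeLE 1) : boost H C ∈ rangeLE 2 :=
  add_mem (moment_mem_rangeLE hH) (rangeLE_mono one_le_two hC)

theorem bond_eq_zero (hC : C ∈ rangeLE 1) (i : ℤ) : bond C i = 0 := by
  by_contra h
  have hlt := hC _ h i (by simp) (i + 1) (by simp)
  push_cast at hlt
  omega

theorem bond_boost (H : FormalOp d) (hC : C ∈ rangeLE 1) (i : ℤ) :
    bond (boost H C) i = (i : ℂ) • bond H i := by
  have hmoment : bond (moment H) i = (i : ℂ) • bond H i := summand_moment (by simp) (by simp)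
  have hadd : bond (boost H C) i = bond (moment H) i + bond C i := map_add _ _ _
  rw [hadd, hmoment, bond_eq_zero hC, add_zero]

variable [NeZero d]

theorem translateOp_moment (hHt : IsTranslationInvariant H) (h0 : summand ∅ H = 0) (x : ℤ) :
    translateOp x (moment H) = moment H - (x : ℂ) • H := by
  refine ext_summand fun A => ?_
  rw [summand_translateOp, map_sub, map_smul]
  rcases A.eq_empty_or_nonempty with rfl | hA
  · rw [h0, summand_empty_moment, smul_zero, sub_zero]
    exact (congrArg _ summand_empty_moment).trans (map_zero (translate x))
  · have htranslate : summand A H = translate x (summand (translateSet (-x) A) H) := by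
      rw [← summand_translateOp, isTranslationInvariant_iff.1 hHt x]
    rw [summand_moment (m := A.min' hA - x), summand_moment (A.min'_mem hA) fun b hb =>
      A.min'_le b hb, map_smul, ← htranslate, ← sub_smul, Int.cast_sub]
    · simp [mem_translateSet, A.min'_mem hA]
    · intro a ha
      have hle := A.min'_le _ (mem_translateSet.1 ha)
      omega

theorem translateOp_boost (hHt : IsTranslationInvariant H) (h0 : summand ∅ H = 0)
    (hCt : IsTranslationInvariant C) (x : ℤ) :
    translateOp x (boost H C) = boost H C - (x : ℂ) • H := by
  have hadd : translateOp x (boost H C) = translateOp x (moment H) + translateOp x C :=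
    ext_summand fun A => by simp only [boost, summand_translateOp, map_add]
  rw [hadd, translateOp_moment hHt h0, isTranslationInvariant_iff.1 hCt, boost]
  abel

variable {Θ : FormalOp d} {r s : ℕ}

theorem comm_sub_left (hΦ : Φ ∈ rangeLE r) (hΨ : Ψ ∈ rangeLE r) (hΘ : Θ ∈ rangeLE s) :
    comm (Φ - Ψ) Θ = comm Φ Θ - comm Ψ Θ := by
  rw [comm_antisymm (sub_mem hΦ hΨ) hΘ, comm_sub_right hΘ, comm_antisymm hΦ hΘ,
    comm_antisymm hΨ hΘ]
  abel

theorem comm_smul_left (hΦ : Φ ∈ rangeLE r) (hΘ : Θ ∈ rangeLE s) (c : ℂ) :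
    comm (c • Φ) Θ = c • comm Φ Θ := by
  rw [comm_antisymm (Submodule.smul_mem _ c hΦ) hΘ, comm_smul_right hΘ, comm_antisymm hΦ hΘ,
    smul_neg]

/-- A translation changes the boost by a multiple of `H`, which commutes with `Q`. -/
theorem isTranslationInvariant_comm_boost {Q : FormalOp d} (hH : H ∈ rangeLE 2)
    (hHt : IsTranslationInvariant H) (h0 : summand ∅ H = 0) (hC : C ∈ rangeLE 1)
    (hCt : IsTranslationInvariant C) (hQr : Q ∈ rangeLE r) (hQt : IsTranslationInvariant Q)
    (hQ : comm H Q = 0) : IsTranslationInvariant (comm (boost H C) Q) := by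
  have hB := boost_mem_rangeLE hH hC
  refine isTranslationInvariant_iff.2 fun x => ?_
  rw [← comm_translateOp hB, translateOp_boost hHt h0 hCt, isTranslationInvariant_iff.1 hQt,
    comm_sub_left hB (Submodule.smul_mem _ _ hH) hQr, comm_smul_left hH hQr, hQ, smul_zero,
    sub_zero]

end Boost

section ExtremalFamily

variable {d : ℕ} {H C Ψ : FormalOp d}

/-- The parts of a formal operator that live on the intervals `i, …, i + n + 1` and are traceless
at both ends: what has to vanish for an operator of range at most `n + 2` to have range at most
`n + 1`. -/
noncomputable def extremalFamily (n : ℕ) : FormalOp d →ₗ[ℂ] (ℤ → Obs ℂ ℤ (Fin d)) :=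
  LinearMap.pi fun i => extremalPart i (i + n + 1)

theorem extremalFamily_apply (n : ℕ) (Ψ : FormalOp d) (i : ℤ) :
    extremalFamily n Ψ i = extremalPart i (i + n + 1) Ψ := rfl

theorem bondLie_nest [NeZero d] (H : FormalOp d) (n : ℕ) : bondLie H n (nest H n) = 0 :=
  funext fun i => by rw [bondLie_apply, ← nest_succ, nest_succ_right, sub_self, Pi.zero_apply]

/-- The solvability of the next-to-leading equation for the conservation of a three-local operator
with leading part `nest H 1`. -/
def ReshetikhinCondition (H : FormalOp d) : Prop :=
  ∃ ω ∈ spanningFamilies 0, bondLie H 0 ω = nestSource H 1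

theorem ReshetikhinCondition.of_smul {c : ℂ} (hc : c ≠ 0) {ω : ℤ → Obs ℂ ℤ (Fin d)}
    (hω : ω ∈ spanningFamilies 0) (h : bondLie H 0 ω = c • nestSource H 1) :
    ReshetikhinCondition H :=
  ⟨c⁻¹ • ω, Submodule.smul_mem _ _ hω, by rw [map_smul, h, inv_smul_smul₀ hc]⟩

variable [NeZero d]

theorem extremalFamily_zero (Ψ : FormalOp d) : extremalFamily 0 Ψ = bond Ψ :=
  funext fun i => by
    rw [extremalFamily_apply, Nat.cast_zero, add_zero, extremalPart_succ]

theorem extremalFamily_mem_spanningFamilies (n : ℕ) (Ψ : FormalOp d) :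
    extremalFamily n Ψ ∈ spanningFamilies n :=
  mem_spanningFamilies.2 fun i => extremalPart_mem_spanningOps Ψ i _

theorem extremalFamily_eq_zero {n : ℕ} (hΨ : Ψ ∈ rangeLE (n + 1)) : extremalFamily n Ψ = 0 :=
  funext fun i => extremalPart_eq_zero hΨ (by push_cast; omega)

theorem mem_rangeLE_of_extremalFamily_eq_zero {n : ℕ} (hΨ : Ψ ∈ rangeLE (n + 2))
    (h : extremalFamily n Ψ = 0) : Ψ ∈ rangeLE (n + 1) := by
  refine mem_rangeLE_of_extremalPart fun i j hij => ?_
  push_cast at hij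
  obtain rfl | hj : j = i + n + 1 ∨ i + n + 2 ≤ j := by omega
  · exact congrFun h i
  · exact extremalPart_eq_zero hΨ (by push_cast; omega)

theorem extremalFamily_comm (hH : H ∈ rangeLE 2) {n : ℕ} (hΨ : Ψ ∈ rangeLE (n + 2)) :
    extremalFamily (n + 1) (comm H Ψ) = bondLie H n (extremalFamily n Ψ) := by
  funext i
  rw [extremalFamily_apply, show i + ((n + 1 : ℕ) : ℤ) + 1 = i + n + 1 + 1 by push_cast; ring,
    extremalPart_comm_succ_of_le hH hΨ (by omega) (by push_cast; omega), bondLie_apply,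
    extremalFamily_apply, extremalFamily_apply, show i + 1 + (n : ℤ) + 1 = i + n + 1 + 1 by ring,
    ← lie_skew (extremalPart i _ Ψ)]
  abel

theorem extremalFamily_comm_of_eq_smul_nest (hH : H ∈ rangeLE 2) {n : ℕ} {α : ℂ}
    (hΨ : Ψ ∈ rangeLE (n + 3)) (h : extremalFamily (n + 1) Ψ = α • nest H (n + 1)) :
    extremalFamily (n + 1) (comm H Ψ)
      = bondLie H n (extremalFamily n Ψ) + α • nestSource H (n + 1) := by
  funext i
  have hend : i + ((n + 1 : ℕ) : ℤ) + 1 = i + n + 1 + 1 := by push_cast; ring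
  have htop : extremalPart i (i + n + 1 + 1) Ψ = α • nest H (n + 1) i := hend ▸ congrFun h i
  rw [extremalFamily_apply, hend,
    extremalPart_comm_succ hH hΨ (by omega) (by push_cast; omega), htop, lie_smul, map_smul,
    Pi.add_apply, Pi.smul_apply, nestSource, hend, bondLie_apply, extremalFamily_apply,
    extremalFamily_apply, show i + 1 + (n : ℤ) + 1 = i + n + 1 + 1 by ring,
    ← lie_skew (extremalPart i _ Ψ)]
  abel

theorem extremalFamily_comm_boost {n : ℕ} (hH : H ∈ rangeLE 2) (hC : C ∈ rangeLE 1)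
    (hΨr : Ψ ∈ rangeLE (n + 2)) (hΨ : comm H Ψ = 0) (i : ℤ) :
    extremalFamily (n + 1) (comm (boost H C) Ψ) i
      = ((n : ℂ) + 1) • ⁅bond H (i + n + 1), extremalFamily n Ψ i⁆ := by
  have hboost := extremalPart_comm_succ_of_le (boost_mem_rangeLE hH hC) hΨr (i := i)
    (j := i + n + 1) (by omega) (by push_cast; omega)
  have hzero := extremalPart_comm_succ_of_le hH hΨr (i := i) (j := i + n + 1) (by omega)
    (by push_cast; omega)
  rw [hΨ, map_zero, eq_comm, add_comm, add_eq_zero_iff_eq_neg] at hzero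
  rw [extremalFamily_apply, show i + ((n + 1 : ℕ) : ℤ) + 1 = i + n + 1 + 1 by push_cast; ring,
    hboost, bond_boost H hC, bond_boost H hC, smul_lie, smul_lie, hzero, extremalFamily_apply]
  push_cast
  module

end ExtremalFamily

section Nonintegrability

variable {d : ℕ} [NeZero d] {H C Ψ : FormalOp d}

theorem Q3_mem_rangeLE (hH : H ∈ rangeLE 2) (hC : C ∈ rangeLE 1) : Q3 H C ∈ rangeLE 3 :=
  comm_mem_rangeLE (boost_mem_rangeLE hH hC) hH (by norm_num)

theorem extremalFamily_Q3 (hH : H ∈ rangeLE 2) (hC : C ∈ rangeLE 1) :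
    extremalFamily 1 (Q3 H C) = -nest H 1 := by
  funext i
  have h := extremalFamily_comm_boost (n := 0) hH hC hH (comm_self hH) i
  simp only [Nat.cast_zero, zero_add, one_smul, add_zero, extremalFamily_zero] at h
  exact h.trans (lie_skew _ _).symm

theorem ReshetikhinCondition.exists_comm_Q3_add_mem_rangeLE (h : ReshetikhinCondition H)
    (hH : H ∈ rangeLE 2) (hC : C ∈ rangeLE 1) :
    ∃ R ∈ rangeLE 2, comm H (Q3 H C + R) ∈ rangeLE 2 := by
  obtain ⟨ω, hω, hωs⟩ := h
  obtain ⟨R, hR, hbond⟩ := exists_bond_eq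
    (sub_mem hω (extremalFamily_mem_spanningFamilies 0 (Q3 H C)))
  have hr : Q3 H C + R ∈ rangeLE 3 := add_mem (Q3_mem_rangeLE hH hC) (rangeLE_mono (by norm_num) hR)
  have hlead : extremalFamily 1 (Q3 H C + R) = (-1 : ℂ) • nest H 1 := by
    rw [map_add, extremalFamily_eq_zero hR, add_zero, extremalFamily_Q3 hH hC, neg_one_smul]
  have hnext : extremalFamily 0 (Q3 H C + R) = ω := by
    rw [map_add, extremalFamily_zero R, funext hbond, add_sub_cancel]
  refine ⟨R, hR, mem_rangeLE_of_extremalFamily_eq_zero (n := 1)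
    (mem_rangeLE_of_extremalFamily_eq_zero (n := 2) (comm_mem_rangeLE hH hr (by norm_num)) ?_) ?_⟩
  · rw [extremalFamily_comm hH hr, hlead, map_smul, bondLie_nest, smul_zero]
  · rw [extremalFamily_comm_of_eq_smul_nest hH hr hlead, hnext, hωs, neg_one_smul, add_neg_cancel]

theorem exists_extremalFamily_eq_smul_nest (hH : H ∈ rangeLE 2) (hinj : InjectiveBonds H)
    (huniq : UniqueBonds H) {n : ℕ} (hr : Ψ ∈ rangeLE (n + 2)) (hΨ : comm H Ψ = 0) :
    ∃ α : ℂ, extremalFamily n Ψ = α • nest H n := by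
  have hlead := extremalFamily_comm hH hr
  rw [hΨ, map_zero] at hlead
  obtain ⟨α, hα⟩ := eq_smul_nest hinj huniq (extremalFamily_mem_spanningFamilies n Ψ) fun i =>
    sub_eq_zero.1 (congrFun hlead i).symm
  exact ⟨α, funext hα⟩

theorem mem_rangeLE_pred_of_comm_eq_zero (hH : H ∈ rangeLE 2) (hinj : InjectiveBonds H)
    (huniq : UniqueBonds H) (hno : ¬ ReshetikhinCondition H) {n : ℕ} (hr : Ψ ∈ rangeLE (n + 3))
    (hΨ : comm H Ψ = 0) : Ψ ∈ rangeLE (n + 2) := by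
  obtain ⟨α, hα⟩ := exists_extremalFamily_eq_smul_nest hH hinj huniq hr hΨ
  refine mem_rangeLE_of_extremalFamily_eq_zero hr ?_
  suffices hα0 : α = 0 by rw [hα, hα0, zero_smul]
  have hnext := extremalFamily_comm_of_eq_smul_nest hH hr hα
  rw [hΨ, map_zero, eq_comm, add_eq_zero_iff_eq_neg, ← neg_smul] at hnext
  have hmem := extremalFamily_mem_spanningFamilies n Ψ
  by_contra hα0
  cases n with
  | zero =>
    rw [zero_add] at hnext
    exact hno (.of_smul (neg_ne_zero.2 hα0) hmem hnext)
  | succ m =>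
    obtain ⟨ω, hω, h⟩ := hinj.exists_bondLie_zero_eq hH (n := m) (a := -α) (b := 0) hmem fun i => by
      rw [hnext, zero_smul, add_zero, Pi.smul_apply]
    have hm : (m : ℂ) + 3 ≠ 0 := by exact_mod_cast (by omega : m + 3 ≠ 0)
    exact hno (.of_smul (by simp [hm, hα0]) hω h)

theorem isNonintegrable_of_not_reshetikhinCondition (hH : H ∈ rangeLE 2) (hinj : InjectiveBonds H)
    (huniq : UniqueBonds H) (hno : ¬ ReshetikhinCondition H) : IsNonintegrable H := by
  intro Ψ hloc hΨ
  have hdescend (n : ℕ) (hn : Ψ ∈ rangeLE (n + 2)) : Ψ ∈ rangeLE 2 := by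
    induction n with
    | zero => exact hn
    | succ n ih => exact ih (mem_rangeLE_pred_of_comm_eq_zero hH hinj huniq hno hn hΨ)
  have hr : Ψ ∈ rangeLE (0 + 2) := hdescend (opRange Ψ).toNat
    (rangeLE_mono (Nat.le_add_right _ 2) (mem_rangeLE_toNat hloc))
  obtain ⟨α, hα⟩ := exists_extremalFamily_eq_smul_nest hH hinj huniq hr hΨ
  have hsub : Ψ - α • H ∈ rangeLE (0 + 1) := by
    refine mem_rangeLE_of_extremalFamily_eq_zero (sub_mem hr (Submodule.smul_mem _ α hH)) ?_
    rw [map_sub, map_smul, hα, extremalFamily_zero, sub_eq_zero]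
    rfl
  exact ⟨α, Ψ - α • H, (opRange_le_iff (n := 1)).2 hsub, by abel⟩

theorem isNonintegrable_of_bond_eq_zero (hinj : InjectiveBonds H) (h : ∀ i, bond H i = 0) :
    IsNonintegrable H := by
  refine fun Ψ _ _ => ⟨0, Ψ, (opRange_le_iff (n := 1)).2 fun A hA a ha => absurd ?_ hA, by simp⟩
  have hne : A.Nonempty := ⟨a, ha⟩
  refine hinj.eq_zero_right (i := A.max' hne)
    (localAlgebra_le_trivialAt (fun hmem => ?_) (summand_mem_localAlgebra Ψ A))
    (siteTrace_summand Ψ (A.max'_mem hne)) (by rw [h, lie_zero])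
  have hle := A.le_max' _ hmem
  omega

end Nonintegrability

section Integrability

variable {d : ℕ} {B C H Q : FormalOp d}

/-- Local translation-invariant conserved quantities. -/
structure IsCharge (H Q : FormalOp d) : Prop where
  exists_mem_rangeLE : ∃ r, Q ∈ rangeLE r
  invariant : IsTranslationInvariant Q
  conserved : comm H Q = 0

/-- The charges generated from `H` by repeated commutation with `B`. -/
noncomputable def tower (B H : FormalOp d) : ℕ → FormalOp d
  | 0 => H
  | n + 1 => comm B (tower B H n)

theorem isCharge_tower (hH : IsCharge H H) (hB : ∀ Q, IsCharge H Q → IsCharge H (comm B Q))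
    (n : ℕ) : IsCharge H (tower B H n) := by
  induction n with
  | zero => exact hH
  | succ n ih => exact hB _ ih

variable [NeZero d]

theorem comm_zero_left {s : ℕ} (hQ : Q ∈ rangeLE s) : comm 0 Q = 0 := by
  rw [comm_antisymm (zero_mem (rangeLE 0)) hQ, comm_zero_right hQ, neg_zero]

theorem comm_comm_comm_eq_zero {r s t : ℕ} (hH : H ∈ rangeLE r) (hB : B ∈ rangeLE s)
    (hQ : Q ∈ rangeLE t) (hBH : comm H (comm B H) = 0) (hHQ : comm H Q = 0) :
    comm H (comm H (comm B Q)) = 0 := by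
  have hr : comm H B ∈ rangeLE (r + s) := comm_mem_rangeLE hH hB (by omega)
  have hHB : comm H (comm H B) = 0 := by
    rw [comm_antisymm hH hB, ← neg_one_smul ℂ, comm_smul_right hH, hBH, smul_zero]
  rw [comm_jacobi hH hB hQ, hHQ, comm_zero_right hB, add_zero, comm_jacobi hH hr hQ, hHB, hHQ,
    comm_zero_left hQ, comm_zero_right hr, add_zero]

theorem IsCharge.comm_boost (hH : H ∈ rangeLE 2) (hHsa : IsSelfAdjointOp H)
    (hHt : IsTranslationInvariant H) (h0 : summand ∅ H = 0) (hC : C ∈ rangeLE 1)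
    (hCt : IsTranslationInvariant C) (hQ3 : comm H (Q3 H C) = 0) (hQ : IsCharge H Q) :
    IsCharge H (comm (boost H C) Q) := by
  obtain ⟨⟨r, hr⟩, ht, hc⟩ := hQ
  have hB := boost_mem_rangeLE hH hC
  have hDr : comm (boost H C) Q ∈ rangeLE (2 + r) := comm_mem_rangeLE hB hr (by omega)
  have hDt := isTranslationInvariant_comm_boost hH hHt h0 hC hCt hr ht hc
  exact ⟨⟨_, hDr⟩, hDt,
    comm_eq_zero_of_comm_comm hH hDr hHsa hHt hDt (comm_comm_comm_eq_zero hH hB hr hQ3 hc)⟩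

theorem comm_tower {s : ℕ} (hBs : B ∈ rangeLE s) (hH : IsCharge H H)
    (hB : ∀ Q, IsCharge H Q → IsCharge H (comm B Q)) (n : ℕ) (hQ : IsCharge H Q) :
    comm (tower B H n) Q = 0 := by
  induction n generalizing Q with
  | zero => exact hQ.conserved
  | succ n ih =>
    obtain ⟨r, hr⟩ := hQ.exists_mem_rangeLE
    obtain ⟨t, ht⟩ := (isCharge_tower hH hB n).exists_mem_rangeLE
    have hjacobi := comm_jacobi hBs ht hr
    rw [ih hQ, ih (hB Q hQ), comm_zero_right hBs, add_zero] at hjacobi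
    exact hjacobi.symm

theorem tower_mem_rangeLE (hB : B ∈ rangeLE 2) (hH : H ∈ rangeLE 2) (n : ℕ) :
    tower B H n ∈ rangeLE (n + 2) := by
  induction n with
  | zero => exact hH
  | succ n ih => exact comm_mem_rangeLE hB ih (by omega)

theorem extremalFamily_tower_ne_zero (hH : H ∈ rangeLE 2) (hC : C ∈ rangeLE 1)
    (hinj : InjectiveBonds H) (hcons : ∀ n, comm H (tower (boost H C) H n) = 0) {i : ℤ}
    (hi : bond H i ≠ 0) (n : ℕ) : extremalFamily n (tower (boost H C) H n) i ≠ 0 := by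
  induction n with
  | zero => rwa [extremalFamily_zero]
  | succ n ih =>
    intro h
    have hcomm := extremalFamily_comm_boost hH hC
      (tower_mem_rangeLE (boost_mem_rangeLE hH hC) hH n) (hcons n) i
    rw [← tower, h, eq_comm, smul_eq_zero, or_iff_right (by exact_mod_cast n.succ_ne_zero)] at hcomm
    have hmem := mem_spanningFamilies.1
      (extremalFamily_mem_spanningFamilies n (tower (boost H C) H n)) i
    exact ih (hinj.eq_zero_right (mem_trivialAt_of_mem_spanningOps hmem (Or.inr (by omega)))
      (mem_spanningOps.1 hmem).2.2 (by rw [← lie_skew, hcomm, neg_zero]))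

theorem isIntegrable_of_comm_Q3_eq_zero (hH : H ∈ rangeLE 2) (hHsa : IsSelfAdjointOp H)
    (hHt : IsTranslationInvariant H) (h0 : summand ∅ H = 0) (hC : C ∈ rangeLE 1)
    (hCt : IsTranslationInvariant C) (hinj : InjectiveBonds H) {i : ℤ} (hi : bond H i ≠ 0)
    (hQ3 : comm H (Q3 H C) = 0) : IsIntegrable H := by
  have hB := boost_mem_rangeLE hH hC
  have hHH : IsCharge H H := ⟨⟨2, hH⟩, hHt, comm_self hH⟩
  have hboost (Q) (hQ : IsCharge H Q) := hQ.comm_boost hH hHsa hHt h0 hC hCt hQ3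
  have hcharge := isCharge_tower hHH hboost
  refine ⟨fun k => tower (boost H C) H (k - 2), fun k hk => ⟨?_, (hcharge _).conserved⟩,
    fun k l _ _ => comm_tower hB hHH hboost _ (hcharge _)⟩
  obtain ⟨n, rfl⟩ := Nat.exists_eq_add_of_le' hk
  beta_reduce
  rw [Nat.add_sub_cancel]
  refine le_antisymm (opRange_le_iff.2 (tower_mem_rangeLE hB hH n)) ?_
  have hlt : ((n + 1 : ℕ) : ℕ∞) < opRange (tower (boost H C) H n) := not_le.1 fun h =>
    extremalFamily_tower_ne_zero hH hC hinj (fun m => (hcharge m).conserved) hi n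
      (congrFun (extremalFamily_eq_zero (opRange_le_iff.1 h)) i)
  exact_mod_cast Order.add_one_le_of_lt hlt

theorem not_isIntegrable_and_isNonintegrable (hH : H ∈ rangeLE 2) :
    ¬ (IsIntegrable H ∧ IsNonintegrable H) := by
  rintro ⟨⟨Q, hQ, -⟩, hN⟩
  obtain ⟨hr, hc⟩ := hQ 3 (by norm_num)
  obtain ⟨α, R, hR, h⟩ := hN (Q 3) (by rw [hr]; exact ENat.natCast_lt_top 3) hc
  have hR1 : R ∈ rangeLE 1 := opRange_le_iff.1 hR
  have hQ2 : Q 3 ∈ rangeLE 2 :=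
    h ▸ add_mem (Submodule.smul_mem _ α hH) (rangeLE_mono one_le_two hR1)
  have hle := opRange_le_iff.2 hQ2
  rw [hr] at hle
  norm_num at hle

end Integrability

end SpinChain

open SpinChain in
theorem proposition1 (d : ℕ) [NeZero d]
    -- The Hamiltonian, Hermitian and translation invariant, and the one-local part of the boost.
    (H C : FormalOp d)
    (hHnn : IsNearestNeighbour H) (hHsa : IsSelfAdjointOp H) (hHinv : IsTranslationInvariant H)
    (hCloc : opRange C ≤ 1) (hCinv : IsTranslationInvariant C)
    (hinj : InjectiveInteraction H) (huniq : UniqueTwoLocalCharge H)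
    -- Condition (A).
    (hA : (∃ R : FormalOp d, opRange R ≤ 2 ∧ opRange (comm H (Q3 H C + R)) ≤ 2) →
      comm H (Q3 H C) = 0) :
    (IsIntegrable H ∨ IsNonintegrable H) ∧ ¬ (IsIntegrable H ∧ IsNonintegrable H) := by
  have hH : H ∈ rangeLE 2 := hHnn.mem_rangeLE
  have hC : C ∈ rangeLE 1 := opRange_le_iff.1 hCloc
  have hbonds : InjectiveBonds H := hinj.injectiveBonds hHinv
  refine ⟨?_, not_isIntegrable_and_isNonintegrable hH⟩
  by_cases hR : ReshetikhinCondition H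
  · obtain ⟨R, hR2, hcomm⟩ := hR.exists_comm_Q3_add_mem_rangeLE hH hC
    have hQ3 := hA ⟨R, opRange_le_iff.2 hR2, opRange_le_iff.2 hcomm⟩
    by_cases hb : ∀ i, bond H i = 0
    · exact Or.inr (isNonintegrable_of_bond_eq_zero hbonds hb)
    · obtain ⟨i, hi⟩ := not_forall.1 hb
      exact Or.inl (isIntegrable_of_comm_Q3_eq_zero hH hHsa hHinv hHnn.summand_empty hC hCinv
        hbonds hi hQ3)
  · exact Or.inr (isNonintegrable_of_not_reshetikhinCondition hH hbonds huniq.uniqueBonds hR)
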